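/- **Setting.** Fix $d\ge 1$ and let $B(x,r)$ denote open balls in $\mathbb R^{d+1}$; supports of measures and functions are closed. For $\delta>0$ put $K_\delta(x)=x/\max(\delta,|x|)^{d+1}$ and $R_\delta(f\mu)(x)=\int K_\delta(x-y)f(y)\,d\mu(y)$; for a linear hyperplane $H$ with orthogonal projection $\pi_H$, $R^H_\delta$ is defined in the same way with the kernel $K^H_\delta=\pi_H K_\delta$. A Borel measure $\mu$ on $\mathbb R^{d+1}$ is *$C$-good* if $\mu(B(x,r))\le Cr^d$ for all $x$ and $r>0$, and $\|R_\delta(f\mu)\|_{L^2(\mu)}\le C\|f\|_{L^2(\mu)}$ for all $\delta>0$, $f\in L^2(\mu)$. It is *AD regular with lower constant $c$* if moreover $\mu(B(x,r))\ge cr^d$ for all $x\in\operatorname{supp}\mu$, $r>0$. For such $\mu$, $R^H_\mu f$ denotes the weak limit in $L^2(\mu)$ of $R^H_\delta(f\mu)$ as $\delta\to0+$. *Lattice.* A David–Semmes lattice $\mathcal D$ associated with $\mu$ is a disjoint union of families $\mathcal D_k$, $k\in\mathbb Z$, of Borel sets (cells) such that: cells of the same level are pairwise disjoint and cover $\operatorname{supp}\mu$;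 each cell of level $k+1$ lies in a cell of level $k$; each $Q\in\mathcal D_k$ has a center $z_Q\in Q\cap\operatorname{supp}\mu$ with $B(z_Q,2^{-4k-3})\subset Q\subset B(z_Q,2^{-4k+2})$. Write $\ell(Q)=2^{-4k}$ for $Q\in\mathcal D_k$. *Flatness.* For a hyperplane $H$, a cell $Q$ with $L=L(Q)=z_Q+H$, $\ell=\ell(Q)$, and Lebesgue measure $m_L$ on $L$, $Q$ is *$(H,A,\alpha)$-flat* if every point of $\operatorname{supp}\mu\cap B(z_Q,A\ell)$ is within distance $\alpha\ell$ of $L$, every point of $L\cap B(z_Q,A\ell)$ is within distance $\alpha\ell$ of $\operatorname{supp}\mu$, and $|\int f\,d\mu|\le\alpha\ell^d$ for every real Lipschitz $f$ with $\operatorname{supp}f\subset B(z_Q,A\ell)$, Lipschitz constant at most $\ell^{-1}$ and $\int f\,dm_L=0$. A cell $P$ is *$\beta$-non-BAUP* if there is $x\in P\cap\operatorname{supp}\mu$ such that every affine hyperplane through $x$ contains a point $y\in B(x,\ell(P))$ with $B(y,\beta\ell(P))\cap\operatorname{supp}\mu=\varnothing$. *Layers.* Let $\mathcal F$ be the family of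 all $\beta$-non-BAUP cells that contain an $(H,A,\alpha)$-flat cell at most $N$ levels down. Alternating layers starting from a cell $P\in\mathcal F$ are finite families $\mathfrak P_k,\mathfrak Q_k\subset\mathcal D$ $(0\le k\le K)$, each consisting of pairwise disjoint cells, with $\mathfrak P_0=\{P\}$; every cell of $\mathfrak P_k$ belongs to $\mathcal F$ and is contained in $P$; every cell of $\mathfrak Q_k$ is $(H,A,\alpha)$-flat and contained in a cell of $\mathfrak P_k$; every cell of $\mathfrak P_{k+1}$ is contained in a cell of $\mathfrak Q_k$ $(k<K)$; and $\sum_{Q\in\mathfrak Q_K}\mu(Q)\ge(1-\eta)\mu(P)$. *Functions.* Fix a $C^\infty$ function $\varphi_0\ge0$ with $\operatorname{supp}\varphi_0\subset B(0,1)$ and $\int\varphi_0=1$. Put $Q_t=\{x\in Q:\operatorname{dist}(x,\mathbb R^{d+1}\setminus Q)\ge t\ell(Q)\}$, $$\varphi_Q=\chi_{Q_{2\varepsilon}}*\frac1{(\varepsilon\ell(Q))^{d+1}}\varphi_0\Bigl(\frac{\cdot}{\varepsilon\ell(Q)}\Bigr),\qquad \nu_Q=a_Q\varphi_Q\,m_{L(Q)},\quad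 \nu_Q(\mathbb R^{d+1})=\int\varphi_Q\,d\mu,$$ $$G_k=\sum_{Q\in\mathfrak Q_k}\varphi_Q\,R^H[\varphi_Q\mu-\nu_Q]\ (0\le k\le K),\qquad F_k=G_k-G_{k+1}\ (k<K),\quad F_K=G_K,$$ where $R^H[\varphi_Q\mu-\nu_Q]=R^H_\mu\varphi_Q-R^H\nu_Q$ and $R^H\nu_Q$ is the pointwise limit of $R^H_\delta\nu_Q$ as $\delta\to0+$. **Proposition (almost orthogonality).** For every $d\ge1$, $C,c>0$ and $\varphi_0$ as above there is a positive function $\sigma(\varepsilon,\alpha)$, $\varepsilon,\alpha>0$, with $$\lim_{\varepsilon\to0+}\Bigl[\lim_{\alpha\to0+}\sigma(\varepsilon,\alpha)\Bigr]=0$$ (the inner limit existing for every $\varepsilon>0$) such that the following holds. Let $\mu$ be a $C$-good measure that is AD regular in $\mathbb R^{d+1}$ with lower constant $c$, $\mathcal D$ a David–Semmes lattice associated with $\mu$, and $H$ a linear hyperplane. Let $0<\varepsilon<\frac1{48}$, $A>5$, $0<\alpha<\varepsilon^8$, $\eta,\beta>0$, let $K,N\ge 0$ be integers, and let $\mathfrak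 P_k,\mathfrak Q_k$ $(0\le k\le K)$ be alternating layers as above starting from a cell $P$. Then all limits in the definition of the functions $G_k$ exist, $\int\varphi_Q\,dm_{L(Q)}>0$ for every $Q$ in the flat layers (so that $a_Q$ is well defined), and for all $k=0,\dots,K-1$ the function $\langle F_k,G_{k+1}\rangle$ is $\mu$-integrable and $$|\langle F_k,G_{k+1}\rangle_\mu|=\left|\int\langle F_k,G_{k+1}\rangle\,d\mu\right|\le\sigma(\varepsilon,\alpha)\,\mu(P).$$ -/

import Mathlib

open MeasureTheory Filter Topology Metric
open scoped ENNReal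

noncomputable section

/-- The ambient space `ℝ^(d+1)` with its Euclidean norm. -/
abbrev Space (d : ℕ) : Type := EuclideanSpace ℝ (Fin (d + 1))

/-! ### Riesz transforms and good measures -/

/-- The regularized `d`-dimensional Riesz kernel `K_δ(x) = x / max(δ, |x|)^(d+1)`. -/
def rieszKernel {d : ℕ} (δ : ℝ) (x : Space d) : Space d :=
  ((max δ ‖x‖) ^ (d + 1))⁻¹ • x

/-- The regularized Riesz transform `R_δ(f μ)(x) = ∫ K_δ(x - y) f(y) dμ(y)`. -/
def rieszReg {d : ℕ} (δ : ℝ) (μ : Measure (Space d)) (f : Space d → ℝ) (x : Space d) : Space d :=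
  ∫ y, f y • rieszKernel δ (x - y) ∂μ

/-- The regularized `H`-restricted Riesz transform `R^H_δ(f μ)`, with kernel `π_H K_δ`. -/
def rieszRegH {d : ℕ} (H : Submodule ℝ (Space d)) (δ : ℝ) (μ : Measure (Space d))
    (f : Space d → ℝ) (x : Space d) : Space d :=
  ∫ y, f y • H.starProjection (rieszKernel δ (x - y)) ∂μ

/-- `C`-nice measures: `μ(B(x,r)) ≤ C r^d` for all balls. -/
def IsNiceMeasure {d : ℕ} (C : ℝ) (μ : Measure (Space d)) : Prop :=
  ∀ (x : Space d) (r : ℝ), 0 < r → μ (ball x r) ≤ ENNReal.ofReal (C * r ^ d)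

/-- `C`-good measures: `C`-nice, and the regularized Riesz transforms are bounded in `L²(μ)` with
norm at most `C`, uniformly in `δ > 0`. -/
def IsGoodMeasure {d : ℕ} (C : ℝ) (μ : Measure (Space d)) : Prop :=
  IsNiceMeasure C μ ∧
    ∀ δ : ℝ, 0 < δ → ∀ f : Space d → ℝ, MemLp f 2 μ →
      eLpNorm (rieszReg δ μ f) 2 μ ≤ ENNReal.ofReal C * eLpNorm f 2 μ

/-- The lower bound in AD regularity of `μ` in the open set `U`, with constant `c`. -/
def IsLowerRegularIn {d : ℕ} (U : Set (Space d)) (c : ℝ) (μ : Measure (Space d)) : Prop :=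
  ∀ x ∈ μ.support ∩ U, ∀ r : ℝ, 0 < r → ball x r ⊆ U →
    ENNReal.ofReal (c * r ^ d) ≤ μ (ball x r)

/-- `u` is the weak limit in `L²(μ)` of `R^H_δ(f μ)` as `δ → 0+`. -/
def IsWeakRieszLimit {d : ℕ} (H : Submodule ℝ (Space d)) (μ : Measure (Space d))
    (f : Space d → ℝ) (u : Space d → Space d) : Prop :=
  MemLp u 2 μ ∧ ∀ g : Space d → Space d, MemLp g 2 μ →
    Tendsto (fun δ : ℝ => ∫ x, inner ℝ (rieszRegH H δ μ f x) (g x) ∂μ) (𝓝[>] 0)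
      (𝓝 (∫ x, inner ℝ (u x) (g x) ∂μ))

open Classical in
/-- The function `R^H_μ f`, determined up to a `μ`-null set: the weak limit in `L²(μ)` of
`R^H_δ(f μ)` as `δ → 0+`. -/
def rieszMu {d : ℕ} (H : Submodule ℝ (Space d)) (μ : Measure (Space d))
    (f : Space d → ℝ) : Space d → Space d :=
  if h : ∃ u, IsWeakRieszLimit H μ f u then h.choose else 0

/-- The pointwise limit `R^H(f μ)(x)` of `R^H_δ(f μ)(x)` as `δ → 0+`. -/
def rieszPtw {d : ℕ} (H : Submodule ℝ (Space d)) (μ : Measure (Space d))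
    (f : Space d → ℝ) (x : Space d) : Space d :=
  limUnder (𝓝[>] (0 : ℝ)) (fun δ : ℝ => rieszRegH H δ μ f x)

/-! ### Hyperplanes and flatness -/

/-- The Lebesgue measure `m_L` on the affine plane `L = z + H`. -/
def planeMeasure {d : ℕ} (H : Submodule ℝ (Space d)) (z : Space d) : Measure (Space d) :=
  (volume : Measure H).map (fun h : H => z + (h : Space d))

/-- Geometric `(H, A, α)`-flatness of `μ` at `z` on the scale `ℓ`. -/
def IsGeomFlatAt {d : ℕ} (H : Submodule ℝ (Space d)) (A α : ℝ) (μ : Measure (Space d))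
    (z : Space d) (ℓ : ℝ) : Prop :=
  (∀ x ∈ μ.support ∩ ball z (A * ℓ), ∃ y, y - z ∈ H ∧ dist x y ≤ α * ℓ) ∧
  (∀ y ∈ ball z (A * ℓ), y - z ∈ H → ∃ x ∈ μ.support, dist y x ≤ α * ℓ)

/-- `(H, A, α)`-flatness of `μ` at `z` on the scale `ℓ`. -/
def IsFlatAt {d : ℕ} (H : Submodule ℝ (Space d)) (A α : ℝ) (μ : Measure (Space d))
    (z : Space d) (ℓ : ℝ) : Prop :=
  IsGeomFlatAt H A α μ z ℓ ∧
    ∀ f : Space d → ℝ, tsupport f ⊆ ball z (A * ℓ) → LipschitzWith (Real.toNNReal ℓ⁻¹) f →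
      ∫ x, f x ∂(planeMeasure H z) = 0 → |∫ x, f x ∂μ| ≤ α * ℓ ^ d

/-! ### David-Semmes lattices -/

/-- A David-Semmes lattice associated with `μ`. The set `cells k` is the family of cells of
level `k`, whose size is `2^(-4k)`. (The small boundary property of the cells need not be listed:
for a nice lower regular measure it follows from the properties below.) -/
structure DSLattice {d : ℕ} (μ : Measure (Space d)) where
  cells : ℤ → Set (Set (Space d))
  center : Set (Space d) → Space d
  measurableSet : ∀ k, ∀ Q ∈ cells k, MeasurableSet Q
  levels_disjoint : Pairwise (fun j k => Disjoint (cells j) (cells k))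
  pairwiseDisjoint : ∀ k, (cells k).PairwiseDisjoint id
  nested : ∀ k, ∀ Q' ∈ cells (k + 1), ∃ Q ∈ cells k, Q' ⊆ Q
  cover : ∀ k, μ.support ⊆ ⋃₀ cells k
  center_mem : ∀ k, ∀ Q ∈ cells k, center Q ∈ Q ∩ μ.support
  ball_subset : ∀ k, ∀ Q ∈ cells k, ball (center Q) ((2 : ℝ) ^ (-4 * k - 3)) ⊆ Q
  subset_ball : ∀ k, ∀ Q ∈ cells k, Q ⊆ ball (center Q) ((2 : ℝ) ^ (-4 * k + 2))

namespace DSLattice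

variable {d : ℕ} {μ : Measure (Space d)}

/-- A cell of the lattice, together with its level (which is determined by the set). -/
structure Cell (D : DSLattice μ) where
  level : ℤ
  carrier : Set (Space d)
  mem_cells : carrier ∈ D.cells level

namespace Cell

variable {D : DSLattice μ}

/-- The size `ℓ(Q) = 2^(-4k)` of a cell of level `k`. -/
def size (Q : D.Cell) : ℝ := (2 : ℝ) ^ (-4 * Q.level)

/-- The center `z_Q`. -/
def center (Q : D.Cell) : Space d := D.center Q.carrier

/-- The cell `Q` is `(H, A, α)`-flat. -/
def IsFlat (H : Submodule ℝ (Space d)) (A α : ℝ) (Q : D.Cell) : Prop :=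
  IsFlatAt H A α μ Q.center Q.size

/-- The cell `P` is `β`-non-BAUP: for some `x ∈ P ∩ supp μ`, every hyperplane `L` through `x`
contains a point `y ∈ B(x, ℓ(P))` such that `B(y, β ℓ(P))` does not meet `supp μ`. -/
def IsNonBAUP (β : ℝ) (P : D.Cell) : Prop :=
  ∃ x ∈ P.carrier ∩ μ.support, ∀ V : Submodule ℝ (Space d), Module.finrank ℝ V = d →
    ∃ y ∈ ball x P.size, y - x ∈ V ∧ ball y (β * P.size) ∩ μ.support = ∅

/-- The part `Q_t` of the points of `Q` at distance at least `t ℓ(Q)` from the complement. -/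
def shrink (Q : D.Cell) (t : ℝ) : Set (Space d) :=
  {x ∈ Q.carrier | t * Q.size ≤ infDist x Q.carrierᶜ}

/-- The cutoff `φ_Q`: the convolution of the characteristic function of `Q_{2ε}` with the
rescaled mollifier `(ε ℓ(Q))^(-(d+1)) φ₀(· / (ε ℓ(Q)))`. -/
def cutoff (φ₀ : Space d → ℝ) (ε : ℝ) (Q : D.Cell) (x : Space d) : ℝ :=
  ∫ y in Q.shrink (2 * ε), ((ε * Q.size) ^ (d + 1))⁻¹ * φ₀ ((ε * Q.size)⁻¹ • (x - y))

/-- The normalizing factor `a_Q`, chosen so that `ν_Q(ℝ^(d+1)) = ∫ φ_Q dμ`. -/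
def normFactor (φ₀ : Space d → ℝ) (ε : ℝ) (H : Submodule ℝ (Space d)) (Q : D.Cell) : ℝ :=
  (∫ x, Q.cutoff φ₀ ε x ∂(planeMeasure H Q.center))⁻¹ * ∫ x, Q.cutoff φ₀ ε x ∂μ

/-- The density `a_Q φ_Q` of the approximating measure `ν_Q = a_Q φ_Q m_{L(Q)}` with respect to
the Lebesgue measure on the plane `L(Q) = z_Q + H`. -/
def approxDensity (φ₀ : Space d → ℝ) (ε : ℝ) (H : Submodule ℝ (Space d)) (Q : D.Cell)
    (x : Space d) : ℝ :=
  Q.normFactor φ₀ ε H * Q.cutoff φ₀ ε x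

/-- The function `R^H ν_Q`, as a pointwise limit of the regularized transforms. -/
def rieszApprox (φ₀ : Space d → ℝ) (ε : ℝ) (H : Submodule ℝ (Space d)) (Q : D.Cell) :
    Space d → Space d :=
  rieszPtw H (planeMeasure H Q.center) (Q.approxDensity φ₀ ε H)

/-- The summand `φ_Q R^H(φ_Q μ - ν_Q)`, where `R^H(φ_Q μ)` means `R^H_μ φ_Q`. -/
def summand (φ₀ : Space d → ℝ) (ε : ℝ) (H : Submodule ℝ (Space d)) (Q : D.Cell)
    (x : Space d) : Space d :=
  Q.cutoff φ₀ ε x • (rieszMu H μ (Q.cutoff φ₀ ε) x - Q.rieszApprox φ₀ ε H x)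

/-- All the objects entering `φ_Q R^H(φ_Q μ - ν_Q)` exist: `ν_Q` has total mass `∫ φ_Q dμ`,
`R^H_μ φ_Q` is the weak limit in `L²(μ)`, and `R^H ν_Q` is the pointwise limit everywhere,
of the regularized transforms. -/
def SummandExists (φ₀ : Space d → ℝ) (ε : ℝ) (H : Submodule ℝ (Space d)) (Q : D.Cell) : Prop :=
  0 < ∫ x, Q.cutoff φ₀ ε x ∂(planeMeasure H Q.center) ∧
  ∫ x, Q.approxDensity φ₀ ε H x ∂(planeMeasure H Q.center) = ∫ x, Q.cutoff φ₀ ε x ∂μ ∧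
  IsWeakRieszLimit H μ (Q.cutoff φ₀ ε) (rieszMu H μ (Q.cutoff φ₀ ε)) ∧
  ∀ x, Tendsto
    (fun δ : ℝ => rieszRegH H δ (planeMeasure H Q.center) (Q.approxDensity φ₀ ε H) x)
    (𝓝[>] 0) (𝓝 (Q.rieszApprox φ₀ ε H x))

end Cell

/-! ### Alternating layers -/

/-- The family of all `β`-non-BAUP cells that contain an `(H, A, α)`-flat cell at most `N` levels
down. -/
def nonBAUPFamily (D : DSLattice μ) (β : ℝ) (H : Submodule ℝ (Space d)) (A α : ℝ) (N : ℕ) :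
    Set D.Cell :=
  {P | P.IsNonBAUP β ∧
    ∃ Q : D.Cell, Q.carrier ⊆ P.carrier ∧ Q.level ≤ P.level + N ∧ Q.IsFlat H A α}

/-- `𝔓 0, 𝔔 0, …, 𝔓 K, 𝔔 K` are alternating non-BAUP and flat layers starting from the cell
`P ∈ ℱ`, covering `P` up to a portion `η` of its measure. -/
structure IsAlternatingLayers (D : DSLattice μ) (ℱ : Set D.Cell) (H : Submodule ℝ (Space d))
    (A α : ℝ) (K : ℕ) (η : ℝ) (P : D.Cell) (𝔓 𝔔 : ℕ → Finset D.Cell) : Prop where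
  start_mem : P ∈ ℱ
  start : 𝔓 0 = {P}
  nonBAUP : ∀ k ≤ K, ∀ P' ∈ 𝔓 k, P' ∈ ℱ ∧ P'.carrier ⊆ P.carrier
  flat : ∀ k ≤ K, ∀ Q ∈ 𝔔 k, Q.IsFlat H A α
  disjoint_nonBAUP : ∀ k ≤ K, (𝔓 k : Set D.Cell).PairwiseDisjoint Cell.carrier
  disjoint_flat : ∀ k ≤ K, (𝔔 k : Set D.Cell).PairwiseDisjoint Cell.carrier
  flat_subset : ∀ k ≤ K, ∀ Q ∈ 𝔔 k, ∃ P' ∈ 𝔓 k, Q.carrier ⊆ P'.carrier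
  nonBAUP_subset : ∀ k < K, ∀ P' ∈ 𝔓 (k + 1), ∃ Q ∈ 𝔔 k, P'.carrier ⊆ Q.carrier
  measure_ge : (1 - η) * μ.real P.carrier ≤ ∑ Q ∈ 𝔔 K, μ.real Q.carrier

/-- `G_k = ∑_{Q ∈ 𝔔_k} φ_Q R^H(φ_Q μ - ν_Q)`. -/
def layerG (D : DSLattice μ) (φ₀ : Space d → ℝ) (ε : ℝ) (H : Submodule ℝ (Space d))
    (𝔔 : ℕ → Finset D.Cell) (k : ℕ) (x : Space d) : Space d :=
  ∑ Q ∈ 𝔔 k, Q.summand φ₀ ε H x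

/-- `F_k = G_k - G_{k+1}` for `k < K`, and `F_K = G_K`. -/
def layerF (D : DSLattice μ) (φ₀ : Space d → ℝ) (ε : ℝ) (H : Submodule ℝ (Space d))
    (𝔔 : ℕ → Finset D.Cell) (K k : ℕ) (x : Space d) : Space d :=
  if k < K then D.layerG φ₀ ε H 𝔔 k x - D.layerG φ₀ ε H 𝔔 (k + 1) x
  else D.layerG φ₀ ε H 𝔔 k x

end DSLattice

/-- The mollifiers `φ₀`: nonnegative, smooth, supported in `B(0,1)`, of integral `1`. -/
structure IsUnitMollifier {d : ℕ} (φ₀ : Space d → ℝ) : Prop where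
  smooth : ContDiff ℝ (⊤ : ℕ∞) φ₀
  nonneg : ∀ x, 0 ≤ φ₀ x
  tsupport_subset : tsupport φ₀ ⊆ ball 0 1
  integral_eq : ∫ x, φ₀ x = 1

end

/-! ### Dyadic estimates for nice measures -/

/-! Each cell Q' of the flat layer k+1 lies in a cell Q of the flat layer k, and cells of one layer
are disjoint. Hence ⟨F_k, G_{k+1}⟩ is a sum over Q' of interactions ⟨φ_Q f - φ_{Q'} f', φ_{Q'} f'⟩,
where f = R^H[φ_Q μ - ν_Q] and f' is its analogue for Q'. It suffices to bound the interactions with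
all Q' ⊂ Q by σ μ(Q), and then to add over Q.

Interior part. Well inside both cells the cutoffs are 1 and the interaction is ⟨f - f', f'⟩. There f
- f' is the transform of (φ_Q - φ_{Q'})μ - ν_Q + ν_{Q'}: the first density vanishes nearby, and the
other two are Lipschitz on planes parallel to H, along which π_H K is odd. So f - f' differs by O(s)
from a function Ψ regularized on the scale εsℓ(Q') or larger, with Lipschitz constant O(1/(εsℓ(Q')))
(`ae_norm_field_sub_le`, `norm_regDiff_sub_le`). The pairing of a Lipschitz function with f' is
small (`abs_integral_inner_field_le`): by antisymmetry, regularizing R^H_μ φ_{Q'} at scale Δ costs Δ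
times the Lipschitz constant, and flatness makes the Δ-regularized transforms of φ_{Q'}μ and ν_{Q'}
differ by at most α(ℓ(Q')/Δ)^(d+1) times a constant depending on ε. With s = α^(1/(2d+3)) and Δ =
(εs)²ℓ(Q') all errors are O(s) for fixed ε (`abs_integral_interior_le`), so they vanish as α → 0.

Boundary part. With 256^J comparable to 1/ε, the points of the support near the boundary of a cell
lie in a union of its subcells 2J levels down, of relative measure at most r^(2J), where r < 1
depends on d, C, c only (`measureReal_boundaryLayer_le`). On unions of cells that are not too deep,
the squared L² norm of a field is at most the measure times a factor quadratic in J
(`setIntegral_field_sq_inter_le`). Here f' is localized to the layers, while f is kept on all of Q'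
with a small weight: Q' may be arbitrarily deep in Q, and only the sum of ∫_{Q'}|f|² over Q' is
under control. Choosing the weight r^J gives a total of order J² r^J, which tends to 0 with ε
(`sum_abs_integral_interaction_le`). -/

theorem lintegral_le_tsum_of_ball_cover {d : ℕ} {C : ℝ} {ν : Measure (Space d)}
    (hν : IsNiceMeasure C ν) {ι : Type*} [Countable ι] (x : Space d) (r a : ι → ℝ)
    (hr : ∀ i, 0 < r i) (ha : ∀ i, 0 ≤ a i) (g : Space d → ℝ≥0∞)
    (hg : ∀ y, g y ≠ 0 → ∃ i, dist y x < r i ∧ g y ≤ ENNReal.ofReal (a i)) :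
    ∫⁻ y, g y ∂ν ≤ ∑' i, ENNReal.ofReal (a i * (C * r i ^ d)) := by
  calc ∫⁻ y, g y ∂ν
      ≤ ∫⁻ y, ∑' i, (ball x (r i)).indicator (fun _ => ENNReal.ofReal (a i)) y ∂ν := by
        refine lintegral_mono fun y => ?_
        by_cases h : g y = 0
        · simp [h]
        · obtain ⟨i, hi, hgi⟩ := hg y h
          refine le_trans ?_ (ENNReal.le_tsum i)
          rwa [Set.indicator_of_mem (mem_ball.2 hi)]
    _ = ∑' i, ENNReal.ofReal (a i) * ν (ball x (r i)) := by
        rw [lintegral_tsum fun i =>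
          (measurable_const.indicator measurableSet_ball).aemeasurable]
        simp_rw [lintegral_indicator_const measurableSet_ball]
    _ ≤ _ := by
        refine ENNReal.tsum_le_tsum fun i => ?_
        rw [ENNReal.ofReal_mul (ha i)]
        gcongr
        exact hν x _ (hr i)

/-- On the shell |x - y| ~ 2^j δ the integrand is of order (2^j δ)^(-(d+1)) and the mass at most
C(2^j δ)^d, so the shells form a geometric series of order 1/δ. This is the source of the Lipschitz
bounds for regularized transforms. -/
theorem lintegral_inv_max_pow_succ_le {d : ℕ} {C : ℝ} (hC : 0 ≤ C) {ν : Measure (Space d)}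
    (hν : IsNiceMeasure C ν) (x : Space d) {δ : ℝ} (hδ : 0 < δ) :
    ∫⁻ y, ENNReal.ofReal ((max δ ‖x - y‖ ^ (d + 1))⁻¹) ∂ν
      ≤ ENNReal.ofReal (C * 4 ^ (d + 1) / δ) := by
  refine (lintegral_le_tsum_of_ball_cover hν x (fun j : ℕ => 2 ^ j * δ)
    (fun j : ℕ => ((2 ^ j * δ / 2) ^ (d + 1))⁻¹) (fun j => by positivity)
    (fun j => by positivity) _ fun y _ => ?_).trans ?_
  · rw [dist_comm, dist_eq_norm]
    rcases lt_or_ge ‖x - y‖ δ with h | h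
    · refine ⟨0, by simpa using h, ENNReal.ofReal_le_ofReal ?_⟩
      gcongr
      rw [max_eq_left h.le]; linarith
    · obtain ⟨n, h1, h2⟩ := exists_nat_pow_near (x := ‖x - y‖ / δ) (y := 2)
        ((one_le_div hδ).2 h) one_lt_two
      rw [le_div_iff₀ hδ] at h1
      rw [div_lt_iff₀ hδ] at h2
      refine ⟨n + 1, h2, ENNReal.ofReal_le_ofReal ?_⟩
      gcongr
      refine le_trans (le_of_eq ?_) (h1.trans (le_max_right _ _))
      rw [pow_succ]; ring
  · have h : ∀ j : ℕ, ((2 ^ j * δ / 2) ^ (d + 1))⁻¹ * (C * (2 ^ j * δ) ^ d)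
        = C * 2 ^ (d + 1) / δ * (1 / 2) ^ j := by
      intro j
      rw [div_pow, pow_succ (2 ^ j * δ) d, one_div, inv_pow]
      field_simp
    simp_rw [h]
    rw [← ENNReal.ofReal_tsum_of_nonneg (fun j => by positivity)
      (summable_geometric_two.mul_left _), tsum_mul_left, tsum_geometric_two]
    refine ENNReal.ofReal_le_ofReal ?_
    rw [div_mul_eq_mul_div, mul_assoc]
    gcongr
    rw [show (4 : ℝ) = 2 * 2 by norm_num, mul_pow]
    gcongr
    exact le_self_pow₀ one_le_two (by omega)

/-- The integrand |x - y|^(1-d) is one power better than the critical one, so the shells shrinking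
to x sum to a multiple of Δ. This quantifies what cancellation gains when a regularization below Δ
is removed. -/
theorem lintegral_near_le {d : ℕ} {C : ℝ} (hC : 0 ≤ C) {ν : Measure (Space d)}
    (hν : IsNiceMeasure C ν) (x : Space d) {Δ : ℝ} (hΔ : 0 < Δ) :
    ∫⁻ y, ENNReal.ofReal (if ‖x - y‖ < Δ then ‖x - y‖ ^ 2 / ‖x - y‖ ^ (d + 1) else 0) ∂ν
      ≤ ENNReal.ofReal (C * 4 ^ (d + 1) * Δ) := by
  -- The radii are doubled because the shells are closed on the outside while the covering balls are
  -- open.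
  refine (lintegral_le_tsum_of_ball_cover hν x (fun j : ℕ => 2 * ((1 / 2) ^ j * Δ))
    (fun j : ℕ => ((1 / 2) ^ j * Δ) ^ 2 / (((1 / 2) ^ j * Δ) / 2) ^ (d + 1))
    (fun j => by positivity) (fun j => by positivity) _ fun y hy => ?_).trans ?_
  · rw [dist_comm, dist_eq_norm]
    split_ifs at hy ⊢ with h
    · have h0 : 0 < ‖x - y‖ := by
        rcases (norm_nonneg (x - y)).eq_or_lt with h0 | h0
        · simp [← h0] at hy
        · exact h0
      obtain ⟨n, h1, h2⟩ := exists_nat_pow_near_of_lt_one (x := ‖x - y‖ / Δ) (y := 1 / 2)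
        (by positivity) ((div_le_one hΔ).2 h.le) (by norm_num) (by norm_num)
      rw [lt_div_iff₀ hΔ] at h1
      rw [div_le_iff₀ hΔ] at h2
      have h3 : 0 < (1 / 2 : ℝ) ^ n * Δ := by positivity
      refine ⟨n, by linarith, ENNReal.ofReal_le_ofReal ?_⟩
      gcongr
      rw [pow_succ] at h1; linarith
    · simp at hy
  · have h : ∀ j : ℕ, ((1 / 2 : ℝ) ^ j * Δ) ^ 2 / (((1 / 2) ^ j * Δ) / 2) ^ (d + 1)
        * (C * (2 * ((1 / 2) ^ j * Δ)) ^ d) = C * 2 ^ (d + 1) * 2 ^ d * Δ * (1 / 2) ^ j := by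
      intro j
      have : 0 < (1 / 2 : ℝ) ^ j := by positivity
      generalize (1 / 2 : ℝ) ^ j = q at *
      rw [div_pow, mul_pow 2, pow_succ (q * Δ) d]
      field_simp
    simp_rw [h]
    rw [← ENNReal.ofReal_tsum_of_nonneg (fun j => by positivity)
      (summable_geometric_two.mul_left _), tsum_mul_left, tsum_geometric_two]
    refine ENNReal.ofReal_le_ofReal (le_of_eq ?_)
    rw [show (4 : ℝ) = 2 * 2 by norm_num, mul_pow]
    ring

/-- At the critical exponent every dyadic shell contributes the same amount, so the bound is the
number of scales, that is, a logarithm of the ratio of the radii. -/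
theorem setLIntegral_inv_max_pow_le {d : ℕ} {C : ℝ} (hC : 0 ≤ C) {ν : Measure (Space d)}
    (hν : IsNiceMeasure C ν) (x : Space d) {δ : ℝ} (hδ : 0 < δ) (n : ℕ) :
    ∫⁻ y in ball x (2 ^ n * δ), ENNReal.ofReal ((max δ ‖x - y‖ ^ d)⁻¹) ∂ν
      ≤ ENNReal.ofReal (C * 4 ^ (d + 1) * (n + 1)) := by
  rw [← lintegral_indicator measurableSet_ball]
  refine (lintegral_le_tsum_of_ball_cover hν x (fun j : Fin (n + 1) => 2 ^ (j : ℕ) * δ)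
    (fun j => ((2 ^ (j : ℕ) * δ / 2) ^ d)⁻¹) (fun j => by positivity)
    (fun j => by positivity) _ fun y hy => ?_).trans ?_
  · have hyb : y ∈ ball x (2 ^ n * δ) := by
      by_contra h
      exact hy (Set.indicator_of_notMem h _)
    rw [Set.indicator_of_mem hyb]
    rw [mem_ball] at hyb
    rw [dist_comm, dist_eq_norm] at hyb ⊢
    rcases lt_or_ge ‖x - y‖ δ with h | h
    · refine ⟨0, by simpa using h, ENNReal.ofReal_le_ofReal ?_⟩
      gcongr
      rw [max_eq_left h.le]; simp; linarith
    · obtain ⟨m, h1, h2⟩ := exists_nat_pow_near (x := ‖x - y‖ / δ) (y := 2)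
        ((one_le_div hδ).2 h) one_lt_two
      rw [le_div_iff₀ hδ] at h1
      rw [div_lt_iff₀ hδ] at h2
      have hm : m < n := by
        have := lt_of_mul_lt_mul_right (h1.trans_lt hyb) hδ.le
        exact (pow_lt_pow_iff_right₀ (one_lt_two (α := ℝ))).1 this
      refine ⟨⟨m + 1, by omega⟩, h2, ENNReal.ofReal_le_ofReal ?_⟩
      gcongr
      refine le_trans (le_of_eq ?_) (h1.trans (le_max_right _ _))
      simp only [pow_succ]; ring
  · have h : ∀ j : Fin (n + 1), ((2 ^ (j : ℕ) * δ / 2) ^ d)⁻¹ * (C * (2 ^ (j : ℕ) * δ) ^ d)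
        = C * 2 ^ d := by
      intro j
      rw [div_pow]
      field_simp
    simp_rw [h]
    rw [tsum_fintype, Finset.sum_const, Finset.card_univ, Fintype.card_fin, nsmul_eq_mul,
      ← ENNReal.ofReal_natCast, ← ENNReal.ofReal_mul (by positivity)]
    refine ENNReal.ofReal_le_ofReal ?_
    push_cast
    rw [mul_comm]
    gcongr
    calc (2 : ℝ) ^ d ≤ 4 ^ d := by gcongr; norm_num
      _ ≤ 4 ^ (d + 1) := by gcongr <;> [norm_num; omega]

theorem IsNiceMeasure.isLocallyFinite {d : ℕ} {C : ℝ} {ν : Measure (Space d)}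
    (hν : IsNiceMeasure C ν) : IsLocallyFiniteMeasure ν :=
  ⟨fun x => ⟨ball x 1, ball_mem_nhds x one_pos, (hν x 1 one_pos).trans_lt ENNReal.ofReal_lt_top⟩⟩

theorem norm_integral_le_of_lintegral_le {α E : Type*} [MeasurableSpace α] [NormedAddCommGroup E]
    [NormedSpace ℝ E] {μ : Measure α} {f : α → E} {a : ℝ} (ha : 0 ≤ a)
    (h : ∫⁻ x, ‖f x‖ₑ ∂μ ≤ ENNReal.ofReal a) : ‖∫ x, f x ∂μ‖ ≤ a := by
  have := (enorm_integral_le_lintegral_enorm f).trans h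
  rwa [← ofReal_norm, ENNReal.ofReal_le_ofReal_iff ha] at this

/-- If `‖f y‖ ≤ b g(y)` and `∫ g ≤ a` then `‖∫ f‖ ≤ b a`. -/
theorem norm_integral_le_mul_of_lintegral_le {α E : Type*} [MeasurableSpace α]
    [NormedAddCommGroup E] [NormedSpace ℝ E] {μ : Measure α} {f : α → E} {g : α → ℝ} {a b : ℝ}
    (ha : 0 ≤ a) (hb : 0 ≤ b) (hfg : ∀ᵐ x ∂μ, ‖f x‖ ≤ b * g x)
    (h : ∫⁻ x, ENNReal.ofReal (g x) ∂μ ≤ ENNReal.ofReal a) : ‖∫ x, f x ∂μ‖ ≤ b * a := by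
  refine norm_integral_le_of_lintegral_le (by positivity) ?_
  calc ∫⁻ x, ‖f x‖ₑ ∂μ ≤ ∫⁻ x, ENNReal.ofReal b * ENNReal.ofReal (g x) ∂μ := by
        refine lintegral_mono_ae (hfg.mono fun x hx => ?_)
        rw [← ofReal_norm, ← ENNReal.ofReal_mul hb]
        exact ENNReal.ofReal_le_ofReal hx
    _ = ENNReal.ofReal b * ∫⁻ x, ENNReal.ofReal (g x) ∂μ :=
        lintegral_const_mul' _ _ ENNReal.ofReal_ne_top
    _ ≤ _ := by
        rw [ENNReal.ofReal_mul hb]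
        gcongr

/-! ### The Riesz kernel -/

section Kernel

variable {d : ℕ}

theorem rieszKernel_neg (δ : ℝ) (u : Space d) : rieszKernel δ (-u) = -rieszKernel δ u := by
  simp [rieszKernel]

theorem norm_rieszKernel_le {δ : ℝ} (hδ : 0 < δ) (u : Space d) :
    ‖rieszKernel δ u‖ ≤ (max δ ‖u‖ ^ d)⁻¹ := by
  have h : 0 < max δ ‖u‖ := lt_max_of_lt_left hδ
  rw [rieszKernel, norm_smul, Real.norm_of_nonneg (by positivity), pow_succ, mul_inv, mul_assoc]
  refine mul_le_of_le_one_right (by positivity) ?_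
  rw [inv_mul_le_iff₀ h, mul_one]
  exact le_max_right _ _

theorem norm_rieszKernel_le' {δ : ℝ} (hδ : 0 < δ) (u : Space d) :
    ‖rieszKernel δ u‖ ≤ (δ ^ d)⁻¹ := by
  refine (norm_rieszKernel_le hδ u).trans ?_
  gcongr
  exact le_max_left _ _

theorem continuous_rieszKernel {δ : ℝ} (hδ : 0 < δ) :
    Continuous (rieszKernel δ : Space d → Space d) := by
  unfold rieszKernel
  refine Continuous.smul (Continuous.inv₀
    ((continuous_const.max continuous_norm).pow _) fun x => ?_) continuous_id
  exact (pow_pos (lt_max_of_lt_left hδ) _).ne'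

theorem rieszKernel_congr {δ Δ : ℝ} {u : Space d} (h1 : δ ≤ ‖u‖) (h2 : Δ ≤ ‖u‖) :
    rieszKernel δ u = rieszKernel Δ u := by
  simp [rieszKernel, max_eq_right h1, max_eq_right h2]

/-- Write the increment as a change of the vector plus a change of the scalar factor: the first
contributes 1 and the second, by telescoping the difference of powers, d + 1. Keeping both endpoints
on the right avoids any assumption that u and v are comparable, and each term can be integrated
separately. -/
theorem norm_rieszKernel_sub_le {δ : ℝ} (hδ : 0 < δ) (u v : Space d) :
    ‖rieszKernel δ u - rieszKernel δ v‖
      ≤ (d + 2) * ‖u - v‖ * ((max δ ‖u‖ ^ (d + 1))⁻¹ + (max δ ‖v‖ ^ (d + 1))⁻¹) := by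
  set a := max δ ‖u‖ with ha
  set b := max δ ‖v‖ with hb
  have ha0 : 0 < a := lt_max_of_lt_left hδ
  have hb0 : 0 < b := lt_max_of_lt_left hδ
  have hab : |a - b| ≤ ‖u - v‖ := by
    refine (abs_max_sub_max_le_max δ ‖u‖ δ ‖v‖).trans ?_
    simp only [sub_self, abs_zero]
    exact max_le (norm_nonneg _) (abs_norm_sub_norm_le u v)
  have hvb : ‖v‖ ≤ b := le_max_right _ _
  have hpow : |b ^ (d + 1) - a ^ (d + 1)| * b
      ≤ (d + 1) * ‖u - v‖ * (a ^ (d + 1) + b ^ (d + 1)) := by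
    rw [← geom_sum₂_mul, abs_mul, abs_sub_comm b a]
    have h1 : |∑ i ∈ Finset.range (d + 1), b ^ i * a ^ (d + 1 - 1 - i)| * b
        ≤ (d + 1) * (a ^ (d + 1) + b ^ (d + 1)) := by
      rw [abs_of_nonneg (by positivity), Finset.sum_mul]
      have : ∀ i ∈ Finset.range (d + 1), b ^ i * a ^ (d + 1 - 1 - i) * b
          ≤ a ^ (d + 1) + b ^ (d + 1) := by
        intro i hi
        have hi' : i ≤ d := by simpa [Nat.lt_succ_iff] using hi
        have e : d + 1 = (i + 1) + (d - i) := by omega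
        rcases le_total a b with h | h
        · calc b ^ i * a ^ (d + 1 - 1 - i) * b ≤ b ^ i * b ^ (d - i) * b := by
                gcongr
                exact pow_le_pow_left₀ ha0.le h _
            _ = b ^ (d + 1) := by rw [e]; ring
            _ ≤ _ := by linarith [pow_pos ha0 (d + 1)]
        · calc b ^ i * a ^ (d + 1 - 1 - i) * b ≤ a ^ i * a ^ (d - i) * a := by
                have := pow_le_pow_left₀ hb0.le h i
                have := pow_pos ha0 (d - i)
                simp only [Nat.add_sub_cancel]
                gcongr
            _ = a ^ (d + 1) := by rw [e]; ring
            _ ≤ _ := by linarith [pow_pos hb0 (d + 1)]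
      refine (Finset.sum_le_sum this).trans (le_of_eq ?_)
      simp
      ring
    calc _ = |∑ i ∈ Finset.range (d + 1), b ^ i * a ^ (d + 1 - 1 - i)| * b * |a - b| := by ring
      _ ≤ ((d + 1) * (a ^ (d + 1) + b ^ (d + 1))) * ‖u - v‖ := by gcongr
      _ = _ := by ring
  have key : rieszKernel δ u - rieszKernel δ v
      = (a ^ (d + 1))⁻¹ • (u - v)
        + ((b ^ (d + 1) - a ^ (d + 1)) / (a ^ (d + 1) * b ^ (d + 1))) • v := by
    simp only [rieszKernel, ← ha, ← hb]
    rw [smul_sub, sub_add, ← sub_smul]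
    congr 2
    field_simp
    ring
  rw [key]
  have hA := pow_pos ha0 (d + 1)
  have hB := pow_pos hb0 (d + 1)
  generalize a ^ (d + 1) = A at *
  generalize b ^ (d + 1) = B at *
  have h2 : ‖((B - A) / (A * B)) • v‖ ≤ (d + 1) * ‖u - v‖ * (A⁻¹ + B⁻¹) := by
    rw [norm_smul, Real.norm_eq_abs, abs_div, abs_of_pos (mul_pos hA hB)]
    calc |B - A| / (A * B) * ‖v‖ ≤ |B - A| / (A * B) * b := by gcongr
      _ = (|B - A| * b) / (A * B) := by ring
      _ ≤ ((d + 1) * ‖u - v‖ * (A + B)) / (A * B) := by gcongr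
      _ = _ := by field_simp; ring
  have h3 : ‖A⁻¹ • (u - v)‖ ≤ ‖u - v‖ * (A⁻¹ + B⁻¹) := by
    rw [norm_smul, Real.norm_of_nonneg (by positivity), mul_comm]
    gcongr
    linarith [inv_pos.2 hB]
  calc _ ≤ _ := (norm_add_le _ _).trans (add_le_add h3 h2)
    _ = _ := by ring

theorem norm_rieszKernel_sub_le' {δ : ℝ} (hδ : 0 < δ) (u v : Space d) :
    ‖rieszKernel δ u - rieszKernel δ v‖ ≤ 2 * (d + 2) * (δ ^ (d + 1))⁻¹ * ‖u - v‖ := by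
  have h : ∀ w : Space d, (max δ ‖w‖ ^ (d + 1))⁻¹ ≤ (δ ^ (d + 1))⁻¹ := fun w => by
    gcongr; exact le_max_left _ _
  calc _ ≤ _ := norm_rieszKernel_sub_le hδ u v
    _ ≤ (d + 2) * ‖u - v‖ * ((δ ^ (d + 1))⁻¹ + (δ ^ (d + 1))⁻¹) := by
      gcongr <;> exact le_max_left _ _
    _ = _ := by ring

/-- Changing the regularization affects the Riesz kernel only near the origin. -/
theorem norm_mul_norm_rieszKernel_sub_le {δ Δ : ℝ} (hδ : 0 < δ) (h : δ ≤ Δ) (u : Space d) :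
    ‖u‖ * ‖rieszKernel δ u - rieszKernel Δ u‖
      ≤ if ‖u‖ < Δ then ‖u‖ ^ 2 / ‖u‖ ^ (d + 1) else 0 := by
  split_ifs with hu
  · rcases (norm_nonneg u).eq_or_lt with h0 | h0
    · rw [← h0]; simp
    · have hΔ : 0 < Δ := hδ.trans_le h
      have h1 : ‖rieszKernel δ u - rieszKernel Δ u‖ ≤ (‖u‖ ^ (d + 1))⁻¹ * ‖u‖ := by
        simp only [rieszKernel]
        rw [← sub_smul, norm_smul]
        gcongr
        rw [Real.norm_of_nonneg]
        · have : (max δ ‖u‖ ^ (d + 1))⁻¹ ≤ (‖u‖ ^ (d + 1))⁻¹ := by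
            gcongr; exact le_max_right _ _
          have : 0 < (max Δ ‖u‖ ^ (d + 1))⁻¹ := by
            have : 0 < max Δ ‖u‖ := lt_max_of_lt_left hΔ
            positivity
          linarith
        · rw [sub_nonneg]
          have : 0 < max δ ‖u‖ := lt_max_of_lt_left hδ
          gcongr
      calc _ ≤ ‖u‖ * ((‖u‖ ^ (d + 1))⁻¹ * ‖u‖) := by gcongr
        _ = _ := by field_simp
  · push Not at hu
    rw [rieszKernel_congr (h.trans hu) hu]
    simp

end Kernel

/-! ### Regularized transforms of bounded densities -/

section Reg

variable {d : ℕ} {C : ℝ} {ν : Measure (Space d)} {f : Space d → ℝ}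

theorem integrable_smul_rieszKernel (hf : Integrable f ν) {δ : ℝ} (hδ : 0 < δ) (x : Space d) :
    Integrable (fun y => f y • rieszKernel δ (x - y)) ν := by
  refine (hf.norm.mul_const ((δ ^ d)⁻¹)).mono'
    (hf.1.smul ((continuous_rieszKernel hδ).comp
      (continuous_const.sub continuous_id)).aestronglyMeasurable) (ae_of_all _ fun y => ?_)
  rw [norm_smul]
  gcongr
  exact norm_rieszKernel_le' hδ _

theorem rieszRegH_eq (H : Submodule ℝ (Space d)) (hf : Integrable f ν) {δ : ℝ} (hδ : 0 < δ)
    (x : Space d) : rieszRegH H δ ν f x = H.starProjection (rieszReg δ ν f x) := by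
  rw [rieszReg, ← ContinuousLinearMap.integral_comp_comm _ (integrable_smul_rieszKernel hf hδ x)]
  simp [rieszRegH]

theorem integrable_smul_rieszKernelH (H : Submodule ℝ (Space d)) (hf : Integrable f ν) {δ : ℝ}
    (hδ : 0 < δ) (x : Space d) :
    Integrable (fun y => f y • H.starProjection (rieszKernel δ (x - y))) ν := by
  have := H.starProjection.integrable_comp (integrable_smul_rieszKernel hf hδ x)
  simpa using this

theorem norm_rieszRegH_le (H : Submodule ℝ (Space d)) (hf : Integrable f ν) {δ : ℝ} (hδ : 0 < δ)
    (x : Space d) : ‖rieszRegH H δ ν f x‖ ≤ ‖rieszReg δ ν f x‖ := by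
  rw [rieszRegH_eq H hf hδ]
  exact H.norm_starProjection_apply_le _

theorem rieszReg_add {g : Space d → ℝ} (hf : Integrable f ν) (hg : Integrable g ν) {δ : ℝ}
    (hδ : 0 < δ) (x : Space d) :
    rieszReg δ ν (fun y => f y + g y) x = rieszReg δ ν f x + rieszReg δ ν g x := by
  simp only [rieszReg, add_smul]
  exact integral_add (integrable_smul_rieszKernel hf hδ x) (integrable_smul_rieszKernel hg hδ x)

theorem rieszRegH_sub (H : Submodule ℝ (Space d)) {g : Space d → ℝ} (hf : Integrable f ν)
    (hg : Integrable g ν) {δ : ℝ} (hδ : 0 < δ) (x : Space d) :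
    rieszRegH H δ ν (fun y => f y - g y) x = rieszRegH H δ ν f x - rieszRegH H δ ν g x := by
  simp only [rieszRegH, sub_smul]
  exact integral_sub (integrable_smul_rieszKernelH H hf hδ x)
    (integrable_smul_rieszKernelH H hg hδ x)

theorem norm_rieszReg_sub_le (hC : 0 ≤ C) (hν : IsNiceMeasure C ν) (hf : Integrable f ν) {B : ℝ}
    (hB : 0 ≤ B) (hfB : ∀ y, |f y| ≤ B) {δ : ℝ} (hδ : 0 < δ) (x x' : Space d) :
    ‖rieszReg δ ν f x - rieszReg δ ν f x'‖
      ≤ B * (d + 2) * (2 * C * 4 ^ (d + 1)) / δ * ‖x - x'‖ := by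
  rw [rieszReg, rieszReg, ← integral_sub (integrable_smul_rieszKernel hf hδ x)
    (integrable_smul_rieszKernel hf hδ x')]
  have h := norm_integral_le_mul_of_lintegral_le (μ := ν)
    (f := fun y => f y • rieszKernel δ (x - y) - f y • rieszKernel δ (x' - y))
    (g := fun y => (max δ ‖x - y‖ ^ (d + 1))⁻¹ + (max δ ‖x' - y‖ ^ (d + 1))⁻¹)
    (a := C * 4 ^ (d + 1) / δ + C * 4 ^ (d + 1) / δ) (b := B * ((d + 2) * ‖x - x'‖))
    (by positivity) (by positivity) (ae_of_all _ fun y => ?_) ?_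
  · refine h.trans (le_of_eq ?_)
    ring
  · have hp : ∀ w : Space d, 0 ≤ (max δ ‖w‖ ^ (d + 1))⁻¹ := fun w =>
      (inv_pos.2 (pow_pos (lt_max_of_lt_left hδ) _)).le
    rw [← smul_sub, norm_smul, Real.norm_eq_abs, mul_assoc]
    refine mul_le_mul (hfB y) ?_ (norm_nonneg _) hB
    have := norm_rieszKernel_sub_le hδ (x - y) (x' - y)
    rwa [sub_sub_sub_cancel_right] at this
  · have hp : ∀ w : Space d, 0 ≤ (max δ ‖w‖ ^ (d + 1))⁻¹ := fun w =>
      (inv_pos.2 (pow_pos (lt_max_of_lt_left hδ) _)).le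
    simp_rw [ENNReal.ofReal_add (hp _) (hp _)]
    rw [lintegral_add_left, ENNReal.ofReal_add (by positivity) (by positivity)]
    · exact add_le_add (lintegral_inv_max_pow_succ_le hC hν x hδ)
        (lintegral_inv_max_pow_succ_le hC hν x' hδ)
    · fun_prop

theorem continuous_rieszReg (hC : 0 ≤ C) (hν : IsNiceMeasure C ν) (hf : Integrable f ν) {B : ℝ}
    (hB : 0 ≤ B) (hfB : ∀ y, |f y| ≤ B) {δ : ℝ} (hδ : 0 < δ) : Continuous (rieszReg δ ν f) := by
  refine (LipschitzWith.of_dist_le_mul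
    (K := ⟨B * (d + 2) * (2 * C * 4 ^ (d + 1)) / δ, by positivity⟩) fun x x' => ?_).continuous
  rw [dist_eq_norm, dist_eq_norm]
  exact norm_rieszReg_sub_le hC hν hf hB hfB hδ x x'

theorem norm_rieszRegH_sub_le (H : Submodule ℝ (Space d)) (hC : 0 ≤ C) (hν : IsNiceMeasure C ν)
    (hf : Integrable f ν) {B : ℝ} (hB : 0 ≤ B) (hfB : ∀ y, |f y| ≤ B) {δ : ℝ} (hδ : 0 < δ)
    (x x' : Space d) :
    ‖rieszRegH H δ ν f x - rieszRegH H δ ν f x'‖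
      ≤ B * (d + 2) * (2 * C * 4 ^ (d + 1)) / δ * ‖x - x'‖ := by
  rw [rieszRegH_eq H hf hδ, rieszRegH_eq H hf hδ, ← map_sub]
  exact (H.norm_starProjection_apply_le _).trans (norm_rieszReg_sub_le hC hν hf hB hfB hδ x x')

theorem continuous_rieszRegH (H : Submodule ℝ (Space d)) (hC : 0 ≤ C) (hν : IsNiceMeasure C ν)
    (hf : Integrable f ν) {B : ℝ} (hB : 0 ≤ B) (hfB : ∀ y, |f y| ≤ B) {δ : ℝ} (hδ : 0 < δ) :
    Continuous (rieszRegH H δ ν f) := by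
  have : rieszRegH H δ ν f = fun x => H.starProjection (rieszReg δ ν f x) :=
    funext fun x => rieszRegH_eq H hf hδ x
  rw [this]
  exact H.starProjection.continuous.comp (continuous_rieszReg hC hν hf hB hfB hδ)

/-- Size alone, without cancellation: a bounded density seen from x on n + 1 dyadic scales has a
transform of order n + 1. -/
theorem norm_rieszReg_le_of_support_subset (hC : 0 ≤ C) (hν : IsNiceMeasure C ν) {B : ℝ}
    (hB : 0 ≤ B) (hfB : ∀ y, |f y| ≤ B) {δ : ℝ} (hδ : 0 < δ) (n : ℕ) (x : Space d)
    (hsupp : ∀ y, f y ≠ 0 → ‖x - y‖ < 2 ^ n * δ) :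
    ‖rieszReg δ ν f x‖ ≤ B * (C * 4 ^ (d + 1) * (n + 1)) := by
  have h0 : rieszReg δ ν f x = ∫ y in ball x (2 ^ n * δ), f y • rieszKernel δ (x - y) ∂ν := by
    rw [rieszReg, setIntegral_eq_integral_of_forall_compl_eq_zero]
    intro y hy
    rw [mem_ball, dist_comm, dist_eq_norm] at hy
    have : f y = 0 := by
      by_contra h
      exact hy (hsupp y h)
    simp [this]
  rw [h0]
  refine norm_integral_le_mul_of_lintegral_le (by positivity) hB (ae_of_all _ fun y => ?_)
    (setLIntegral_inv_max_pow_le hC hν x hδ n)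
  rw [norm_smul]
  exact mul_le_mul (hfB y) (norm_rieszKernel_le hδ _) (norm_nonneg _) hB

/-- Away from the support of the density the regularization is irrelevant, so a smaller
regularization may be replaced by a larger one. -/
theorem rieszReg_congr_of_far {δ Δ : ℝ} (h : δ ≤ Δ) (x : Space d)
    (hsupp : ∀ y, f y ≠ 0 → Δ ≤ ‖x - y‖) : rieszReg δ ν f x = rieszReg Δ ν f x := by
  refine integral_congr_ae (ae_of_all _ fun y => ?_)
  by_cases hy : f y = 0
  · simp [hy]
  · simp only
    rw [rieszKernel_congr (h.trans (hsupp y hy)) (hsupp y hy)]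

theorem rieszRegH_congr_of_far (H : Submodule ℝ (Space d)) {δ Δ : ℝ} (h : δ ≤ Δ) (x : Space d)
    (hsupp : ∀ y, f y ≠ 0 → Δ ≤ ‖x - y‖) : rieszRegH H δ ν f x = rieszRegH H Δ ν f x := by
  refine integral_congr_ae (ae_of_all _ fun y => ?_)
  by_cases hy : f y = 0
  · simp [hy]
  · simp only
    rw [rieszKernel_congr (h.trans (hsupp y hy)) (hsupp y hy)]

/-- When the density keeps distance r from x, any regularization below r is invisible. The scales to
be counted therefore run from r outwards, uniformly in δ. -/
theorem norm_rieszReg_le_of_far (hC : 0 ≤ C) (hν : IsNiceMeasure C ν) {B : ℝ}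
    (hB : 0 ≤ B) (hfB : ∀ y, |f y| ≤ B) {δ r : ℝ} (hδ : 0 < δ) (hr : 0 < r) (n : ℕ) (x : Space d)
    (hfar : ∀ y, f y ≠ 0 → r ≤ ‖x - y‖) (hsupp : ∀ y, f y ≠ 0 → ‖x - y‖ < 2 ^ n * r) :
    ‖rieszReg δ ν f x‖ ≤ B * (C * 4 ^ (d + 1) * (n + 1)) := by
  rcases le_total δ r with h | h
  · rw [rieszReg_congr_of_far h x hfar]
    exact norm_rieszReg_le_of_support_subset hC hν hB hfB hr n x hsupp
  · refine norm_rieszReg_le_of_support_subset hC hν hB hfB hδ n x fun y hy => ?_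
    exact (hsupp y hy).trans_le (by gcongr)

/-- Antisymmetry of the kernel: for functions `φ`, `g` with `φ ⊗ g` almost symmetric, changing the
regularization has a small effect on the bilinear form. -/
theorem abs_integral_inner_rieszRegH_sub_le (H : Submodule ℝ (Space d)) (hC : 0 ≤ C)
    (hν : IsNiceMeasure C ν) {φ W : Space d → ℝ} {g : Space d → Space d} (hφ : Integrable φ ν)
    (hg : Integrable g ν) (hW : Integrable W ν) (hW0 : ∀ y, 0 ≤ W y) {δ Δ : ℝ} (hδ : 0 < δ)
    (h : δ ≤ Δ)
    (hφg : ∀ x y, ‖x - y‖ < Δ → ‖φ y • g x - φ x • g y‖ ≤ ‖x - y‖ * W y) :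
    |∫ x, inner ℝ (g x) (rieszRegH H δ ν φ x - rieszRegH H Δ ν φ x) ∂ν|
      ≤ C * 4 ^ (d + 1) * Δ * ∫ y, W y ∂ν := by
  have hΔ : 0 < Δ := hδ.trans_le h
  have := hν.isLocallyFinite
  set k : Space d → Space d := fun u => H.starProjection (rieszKernel δ u - rieszKernel Δ u)
    with hk
  have hkc : Continuous k := H.starProjection.continuous.comp
    ((continuous_rieszKernel hδ).sub (continuous_rieszKernel hΔ))
  have hkle : ∀ u, ‖k u‖ ≤ ‖rieszKernel δ u - rieszKernel Δ u‖ := fun u =>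
    H.norm_starProjection_apply_le _
  have hkM : ∀ u, ‖k u‖ ≤ (δ ^ d)⁻¹ + (Δ ^ d)⁻¹ := fun u =>
    (hkle u).trans ((norm_sub_le _ _).trans
      (add_le_add (norm_rieszKernel_le' hδ u) (norm_rieszKernel_le' hΔ u)))
  have hkneg : ∀ u, k (-u) = -k u := fun u => by
    simp only [hk, rieszKernel_neg, ← map_neg]
    congr 1
    abel
  set Φ : Space d × Space d → ℝ := fun p => inner ℝ (g p.1) (φ p.2 • k (p.1 - p.2)) with hΦ
  have hΦi : Integrable Φ (ν.prod ν) := by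
    refine ((hg.norm.mul_prod hφ.norm).mul_const ((δ ^ d)⁻¹ + (Δ ^ d)⁻¹)).mono' ?_
      (ae_of_all _ fun p => ?_)
    · exact hg.1.comp_fst.inner (hφ.1.comp_snd.smul
        (hkc.comp (continuous_fst.sub continuous_snd)).aestronglyMeasurable)
    · refine (norm_inner_le_norm _ _).trans ?_
      rw [norm_smul, mul_assoc]
      gcongr
      exact hkM _
  have hI : ∫ x, inner ℝ (g x) (rieszRegH H δ ν φ x - rieszRegH H Δ ν φ x) ∂ν
      = ∫ p, Φ p ∂(ν.prod ν) := by
    rw [integral_prod _ hΦi]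
    refine integral_congr_ae (ae_of_all _ fun x => ?_)
    have hi1 := integrable_smul_rieszKernelH H hφ hδ x
    have hi2 := integrable_smul_rieszKernelH H hφ hΔ x
    simp only [hΦ]
    rw [rieszRegH, rieszRegH, ← integral_sub hi1 hi2]
    rw [← integral_inner (𝕜 := ℝ) (f := fun y => φ y • H.starProjection (rieszKernel δ (x - y))
      - φ y • H.starProjection (rieszKernel Δ (x - y))) (hi1.sub hi2)]
    simp only [hk, map_sub, smul_sub]
  have hswap : ∫ p, Φ p ∂(ν.prod ν) = ∫ p, Φ p.swap ∂(ν.prod ν) :=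
    (integral_prod_swap Φ).symm
  have h2 : ∫ p, Φ p ∂(ν.prod ν) + ∫ p, Φ p ∂(ν.prod ν)
      = ∫ p, (Φ p + Φ p.swap) ∂(ν.prod ν) := by
    have := integral_add hΦi hΦi.swap
    simp only [Function.comp_def] at this
    rw [this, ← hswap]
  -- The kernel is odd, so adding the swapped integrand replaces φ(y)g(x) by φ(y)g(x) - φ(x)g(y).
  -- This gains a factor |x - y|, enough to make the kernel absolutely integrable near the diagonal.
  have hpt : ∀ p : Space d × Space d, ‖Φ p + Φ p.swap‖ ≤ W p.2 *
      (if ‖p.2 - p.1‖ < Δ then ‖p.2 - p.1‖ ^ 2 / ‖p.2 - p.1‖ ^ (d + 1) else 0) := by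
    rintro ⟨x, y⟩
    have e : Φ (x, y) + Φ (x, y).swap = inner ℝ (φ y • g x - φ x • g y) (k (x - y)) := by
      simp only [hΦ, Prod.swap, inner_sub_left, inner_smul_left, inner_smul_right]
      rw [show y - x = -(x - y) by abel, hkneg, inner_neg_right]
      simp
      ring
    rw [e]
    refine (norm_inner_le_norm _ _).trans ?_
    have hnear := norm_mul_norm_rieszKernel_sub_le hδ h (x - y)
    simp only
    rw [norm_sub_rev y x]
    by_cases hxy : ‖x - y‖ < Δ
    · calc _ ≤ (‖x - y‖ * W y) * ‖rieszKernel δ (x - y) - rieszKernel Δ (x - y)‖ := by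
            gcongr
            · exact mul_nonneg (norm_nonneg _) (hW0 y)
            · exact hφg x y hxy
            · exact hkle _
        _ = W y * (‖x - y‖ * ‖rieszKernel δ (x - y) - rieszKernel Δ (x - y)‖) := by ring
        _ ≤ _ := mul_le_mul_of_nonneg_left hnear (hW0 y)
    · push Not at hxy
      have : k (x - y) = 0 := by
        simp only [hk]
        rw [rieszKernel_congr (h.trans hxy) hxy, sub_self, map_zero]
      rw [this, norm_zero, mul_zero, if_neg (not_lt.2 hxy), mul_zero]
  have hfin : ‖∫ p, (Φ p + Φ p.swap) ∂(ν.prod ν)‖ ≤ C * 4 ^ (d + 1) * Δ * ∫ y, W y ∂ν := by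
    refine norm_integral_le_of_lintegral_le
      (mul_nonneg (by positivity) (integral_nonneg hW0)) ?_
    calc ∫⁻ p, ‖Φ p + Φ p.swap‖ₑ ∂(ν.prod ν)
        ≤ ∫⁻ p, ENNReal.ofReal (W p.2) * ENNReal.ofReal (if ‖p.2 - p.1‖ < Δ then
            ‖p.2 - p.1‖ ^ 2 / ‖p.2 - p.1‖ ^ (d + 1) else 0) ∂(ν.prod ν) := by
          refine lintegral_mono fun p => ?_
          rw [← ofReal_norm, ← ENNReal.ofReal_mul (hW0 _)]
          exact ENNReal.ofReal_le_ofReal (hpt p)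
      _ = ∫⁻ y, ∫⁻ x, ENNReal.ofReal (W y) * ENNReal.ofReal (if ‖y - x‖ < Δ then
            ‖y - x‖ ^ 2 / ‖y - x‖ ^ (d + 1) else 0) ∂ν ∂ν := by
          rw [lintegral_prod_symm]
          have h1 : AEMeasurable (fun p : Space d × Space d => ENNReal.ofReal (W p.2))
              (ν.prod ν) := (hW.1.aemeasurable.comp_snd).ennreal_ofReal
          refine h1.mul ?_
          · refine (Measurable.ennreal_ofReal (Measurable.ite ?_ ?_ measurable_const)).aemeasurable
            · exact measurableSet_lt (by fun_prop) measurable_const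
            · fun_prop
      _ ≤ ∫⁻ y, ENNReal.ofReal (W y) * ENNReal.ofReal (C * 4 ^ (d + 1) * Δ) ∂ν := by
          refine lintegral_mono fun y => ?_
          rw [lintegral_const_mul' _ _ ENNReal.ofReal_ne_top]
          gcongr
          exact lintegral_near_le hC hν y hΔ
      _ = ENNReal.ofReal (C * 4 ^ (d + 1) * Δ * ∫ y, W y ∂ν) := by
          rw [lintegral_mul_const' _ _ ENNReal.ofReal_ne_top,
            ← ofReal_integral_eq_lintegral_ofReal hW (ae_of_all _ hW0), mul_comm,
            ← ENNReal.ofReal_mul (by positivity)]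
  rw [hI]
  -- The symmetrized integral is twice the original one; the resulting gain of a factor 2 is
  -- discarded.
  rw [← h2, ← two_mul, norm_mul, Real.norm_eq_abs, Real.norm_eq_abs] at hfin
  norm_num at hfin
  have := abs_nonneg (∫ p, Φ p ∂(ν.prod ν))
  linarith

end Reg

/-! ### Weak limits -/

theorem integral_inner_eq_inner_toLp {α E : Type*} [MeasurableSpace α] [NormedAddCommGroup E]
    [InnerProductSpace ℝ E] {μ : Measure α} {f g : α → E} (hf : MemLp f 2 μ) (hg : MemLp g 2 μ) :
    ∫ x, inner ℝ (f x) (g x) ∂μ = inner ℝ hf.toLp hg.toLp := by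
  rw [L2.inner_def]
  refine integral_congr_ae ?_
  filter_upwards [hf.coeFn_toLp, hg.coeFn_toLp] with x h1 h2
  rw [h1, h2]

theorem abs_integral_inner_le {α E : Type*} [MeasurableSpace α] [NormedAddCommGroup E]
    [InnerProductSpace ℝ E] {μ : Measure α} {f g : α → E} (hf : MemLp f 2 μ) (hg : MemLp g 2 μ) :
    |∫ x, inner ℝ (f x) (g x) ∂μ| ≤ (eLpNorm f 2 μ).toReal * (eLpNorm g 2 μ).toReal := by
  rw [integral_inner_eq_inner_toLp hf hg, ← Real.norm_eq_abs]
  refine (norm_inner_le_norm _ _).trans (le_of_eq ?_)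
  rw [Lp.norm_toLp, Lp.norm_toLp]

theorem integrable_inner {α E : Type*} [MeasurableSpace α] [NormedAddCommGroup E]
    [InnerProductSpace ℝ E] {μ : Measure α} {f g : α → E} (hf : MemLp f 2 μ) (hg : MemLp g 2 μ) :
    Integrable (fun x => inner ℝ (f x) (g x)) μ := by
  refine (L2.integrable_inner (𝕜 := ℝ) hf.toLp hg.toLp).congr ?_
  filter_upwards [hf.coeFn_toLp, hg.coeFn_toLp] with x h1 h2
  rw [h1, h2]

theorem integrable_norm_sq {α E : Type*} [MeasurableSpace α] [NormedAddCommGroup E]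
    {μ : Measure α} {f : α → E} (hf : MemLp f 2 μ) : Integrable (fun x => ‖f x‖ ^ 2) μ :=
  hf.norm.integrable_sq

section Good

variable {d : ℕ} {C : ℝ} {μ : Measure (Space d)}

/-- Projection onto H does not increase norms, so the full transform controls the restricted one. -/
theorem IsGoodMeasure.eLpNorm_rieszRegH_le (hμ : IsGoodMeasure C μ) (H : Submodule ℝ (Space d))
    {φ : Space d → ℝ} (hφ : Integrable φ μ) (hφ2 : MemLp φ 2 μ) {δ : ℝ} (hδ : 0 < δ) :
    eLpNorm (rieszRegH H δ μ φ) 2 μ ≤ ENNReal.ofReal C * eLpNorm φ 2 μ :=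
  (eLpNorm_mono (fun x => norm_rieszRegH_le H hφ hδ x)).trans (hμ.2 δ hδ φ hφ2)

theorem memLp_two_of_bounded {φ : Space d → ℝ} (hφ : Integrable φ μ) {B : ℝ}
    (hφB : ∀ y, |φ y| ≤ B) : MemLp φ 2 μ := by
  refine (memLp_two_iff_integrable_sq hφ.1).2 ((hφ.norm.const_mul B).mono' (hφ.1.pow 2)
    (ae_of_all _ fun x => ?_))
  rw [norm_pow, sq, Real.norm_eq_abs]
  exact mul_le_mul_of_nonneg_right (hφB x) (abs_nonneg _)

theorem IsGoodMeasure.memLp_rieszRegH (hC : 0 ≤ C) (hμ : IsGoodMeasure C μ)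
    (H : Submodule ℝ (Space d)) {φ : Space d → ℝ} (hφ : Integrable φ μ) {B : ℝ} (hB : 0 ≤ B)
    (hφB : ∀ y, |φ y| ≤ B) {δ : ℝ} (hδ : 0 < δ) : MemLp (rieszRegH H δ μ φ) 2 μ := by
  have h2 := memLp_two_of_bounded hφ hφB
  have := hμ.1.isLocallyFinite
  refine ⟨(continuous_rieszRegH H hC hμ.1 hφ hB hφB hδ).aestronglyMeasurable,
    (hμ.eLpNorm_rieszRegH_le H hφ h2 hδ).trans_lt ?_⟩
  exact ENNReal.mul_lt_top ENNReal.ofReal_lt_top h2.2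

/-- For compactly supported Lipschitz functions the bilinear form of the regularized transforms
converges. -/
theorem IsGoodMeasure.cauchy_inner (hC : 0 ≤ C) (hμ : IsGoodMeasure C μ)
    (H : Submodule ℝ (Space d)) {φ : Space d → ℝ} (hφ : Integrable φ μ) {B : ℝ} (hB : 0 ≤ B)
    (hφB : ∀ y, |φ y| ≤ B) {L : ℝ} (hL : 0 ≤ L) (hφL : ∀ x y, |φ x - φ y| ≤ L * ‖x - y‖)
    {g : Space d → Space d} (hg : MemLp g 2 μ) :
    Cauchy (map (fun δ : ℝ => ∫ x, inner ℝ (rieszRegH H δ μ φ x) (g x) ∂μ) (𝓝[>] 0)) := by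
  have := hμ.1.isLocallyFinite
  have hφ2 := memLp_two_of_bounded hφ hφB
  set M := C * (eLpNorm φ 2 μ).toReal with hM
  have hM0 : 0 ≤ M := by positivity
  have hRM : ∀ δ : ℝ, 0 < δ → (eLpNorm (rieszRegH H δ μ φ) 2 μ).toReal ≤ M := by
    intro δ hδ
    have h := ENNReal.toReal_mono (ENNReal.mul_lt_top ENNReal.ofReal_lt_top hφ2.2).ne
      (hμ.eLpNorm_rieszRegH_le H hφ hφ2 hδ)
    rwa [ENNReal.toReal_mul, ENNReal.toReal_ofReal hC] at h
  have hR := fun δ (hδ : 0 < δ) => hμ.memLp_rieszRegH hC H hφ hB hφB hδ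
  rw [Metric.cauchy_iff]
  refine ⟨inferInstance, fun η hη => ?_⟩
  -- The uniform L² bound M allows the test function to be replaced by a smooth compactly supported
  -- one, at a cost independent of δ. Antisymmetry can then be used, since g' is Lipschitz.
  obtain ⟨g', hg'c, hg's, hgg'⟩ := hg.exist_eLpNorm_sub_le (by norm_num) (by norm_num)
    (ε := η / (8 * (M + 1))) (by positivity)
  obtain ⟨L', hL'⟩ := hg's.lipschitzWith_of_hasCompactSupport hg'c (by simp)
  have hg'2 : MemLp g' 2 μ := hg's.continuous.memLp_of_hasCompactSupport hg'c
  have hg'i : Integrable g' μ := hg's.continuous.integrable_of_hasCompactSupport hg'c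
  -- The weight comes from φ(y)g'(x) - φ(x)g'(y) = φ(y)(g'(x) - g'(y)) + (φ(y) - φ(x))g'(y).
  set W : Space d → ℝ := fun y => |φ y| * L' + L * ‖g' y‖ with hW
  have hWi : Integrable W μ := (hφ.abs.mul_const _).add (hg'i.norm.const_mul _)
  have hW0 : ∀ y, 0 ≤ W y := fun y => by positivity
  set I := ∫ y, W y ∂μ with hI
  have hI0 : 0 ≤ I := integral_nonneg hW0
  set Δ := η / (8 * (C * 4 ^ (d + 1) * I + 1)) with hΔ
  have hΔ0 : 0 < Δ := by positivity
  have happ : ∀ δ : ℝ, 0 < δ → |∫ x, inner ℝ (rieszRegH H δ μ φ x) (g x) ∂μ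
      - ∫ x, inner ℝ (rieszRegH H δ μ φ x) (g' x) ∂μ| ≤ η / 8 := by
    intro δ hδ
    rw [← integral_sub (integrable_inner (hR δ hδ) hg) (integrable_inner (hR δ hδ) hg'2)]
    simp_rw [← inner_sub_right]
    have h := abs_integral_inner_le (hR δ hδ) (hg.sub hg'2)
    simp only [Pi.sub_apply] at h
    refine h.trans ?_
    have h1 : (eLpNorm (g - g') 2 μ).toReal ≤ η / (8 * (M + 1)) := by
      have := ENNReal.toReal_mono ENNReal.ofReal_ne_top hgg'
      rwa [ENNReal.toReal_ofReal (by positivity)] at this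
    calc _ ≤ M * (η / (8 * (M + 1))) := by
          gcongr
          exact hRM δ hδ
      _ ≤ (M + 1) * (η / (8 * (M + 1))) := by gcongr; linarith
      _ = η / 8 := by field_simp
  have hcau : ∀ δ : ℝ, 0 < δ → δ ≤ Δ → |∫ x, inner ℝ (rieszRegH H δ μ φ x) (g' x) ∂μ
      - ∫ x, inner ℝ (rieszRegH H Δ μ φ x) (g' x) ∂μ| ≤ η / 8 := by
    intro δ hδ hδΔ
    rw [← integral_sub (integrable_inner (hR δ hδ) hg'2) (integrable_inner (hR Δ hΔ0) hg'2)]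
    simp_rw [← inner_sub_left, real_inner_comm (g' _)]
    refine (abs_integral_inner_rieszRegH_sub_le H hC hμ.1 hφ hg'i hWi hW0 hδ hδΔ
      fun x y _ => ?_).trans ?_
    · have e : φ y • g' x - φ x • g' y = φ y • (g' x - g' y) + (φ y - φ x) • g' y := by
        rw [smul_sub, sub_smul]; abel
      rw [e]
      refine (norm_add_le _ _).trans ?_
      rw [norm_smul, norm_smul, Real.norm_eq_abs, Real.norm_eq_abs]
      have h1 : ‖g' x - g' y‖ ≤ L' * ‖x - y‖ := by
        simpa [dist_eq_norm] using hL'.dist_le_mul x y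
      have h2 := hφL y x
      rw [norm_sub_rev] at h2
      calc _ ≤ |φ y| * (L' * ‖x - y‖) + (L * ‖x - y‖) * ‖g' y‖ := by gcongr
        _ = _ := by simp only [hW]; ring
    · calc C * 4 ^ (d + 1) * Δ * I = (C * 4 ^ (d + 1) * I) * Δ := by ring
        _ ≤ (C * 4 ^ (d + 1) * I + 1) * Δ := by gcongr; linarith
        _ = η / 8 := by rw [hΔ]; field_simp
  refine ⟨_, image_mem_map (Ioc_mem_nhdsGT hΔ0), ?_⟩
  have key : ∀ δ ∈ Set.Ioc 0 Δ, |∫ x, inner ℝ (rieszRegH H δ μ φ x) (g x) ∂μ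
      - ∫ x, inner ℝ (rieszRegH H Δ μ φ x) (g' x) ∂μ| ≤ η / 4 := fun δ hδ => by
    have h1 := happ δ hδ.1
    have h2 := hcau δ hδ.1 hδ.2
    rw [abs_le] at h1 h2 ⊢
    constructor <;> linarith
  rintro _ ⟨δ, hδ, rfl⟩ _ ⟨δ', hδ', rfl⟩
  have h1 := key δ hδ
  have h2 := key δ' hδ'
  rw [Real.dist_eq]
  rw [abs_le] at h1 h2
  rw [abs_lt]
  constructor <;> linarith

/-- The weak limit of the regularized transforms of a Lipschitz function exists. -/
theorem IsGoodMeasure.exists_isWeakRieszLimit (hC : 0 ≤ C) (hμ : IsGoodMeasure C μ)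
    (H : Submodule ℝ (Space d)) {φ : Space d → ℝ} (hφ : Integrable φ μ) {B : ℝ} (hB : 0 ≤ B)
    (hφB : ∀ y, |φ y| ≤ B) {L : ℝ} (hL : 0 ≤ L) (hφL : ∀ x y, |φ x - φ y| ≤ L * ‖x - y‖) :
    ∃ u, IsWeakRieszLimit H μ φ u := by
  have hφ2 := memLp_two_of_bounded hφ hφB
  have hR := fun δ (hδ : 0 < δ) => hμ.memLp_rieszRegH hC H hφ hB hφB hδ
  have hlim : ∀ g : Lp (Space d) 2 μ, ∃ l : ℝ, Tendsto
      (fun δ : ℝ => ∫ x, inner ℝ (rieszRegH H δ μ φ x) (g x) ∂μ) (𝓝[>] 0) (𝓝 l) := fun g =>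
    cauchy_map_iff_exists_tendsto.1 (hμ.cauchy_inner hC H hφ hB hφB hL hφL (Lp.memLp g))
  choose Λ hΛ using hlim
  have hpos : ∀ᶠ δ : ℝ in 𝓝[>] 0, 0 < δ := eventually_mem_nhdsWithin
  let Λ' : Lp (Space d) 2 μ →ₗ[ℝ] ℝ :=
    { toFun := Λ
      map_add' := fun g h => by
        refine tendsto_nhds_unique (hΛ (g + h)) (((hΛ g).add (hΛ h)).congr' ?_)
        filter_upwards [hpos] with δ hδ
        rw [← integral_add (integrable_inner (hR δ hδ) (Lp.memLp g))
          (integrable_inner (hR δ hδ) (Lp.memLp h))]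
        refine integral_congr_ae ?_
        filter_upwards [Lp.coeFn_add g h] with x hx
        rw [hx, Pi.add_apply, inner_add_right]
      map_smul' := fun c g => by
        refine tendsto_nhds_unique (hΛ (c • g)) (((hΛ g).const_mul c).congr' ?_)
        filter_upwards [hpos] with δ hδ
        rw [← integral_const_mul]
        refine integral_congr_ae ?_
        filter_upwards [Lp.coeFn_smul c g] with x hx
        rw [hx, Pi.smul_apply, inner_smul_right] }
  have hbound : ∀ g, ‖Λ' g‖ ≤ C * (eLpNorm φ 2 μ).toReal * ‖g‖ := by
    intro g
    refine le_of_tendsto (hΛ g).norm ?_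
    filter_upwards [hpos] with δ hδ
    refine (abs_integral_inner_le (hR δ hδ) (Lp.memLp g)).trans ?_
    rw [Lp.norm_def]
    gcongr
    have h := ENNReal.toReal_mono (ENNReal.mul_lt_top ENNReal.ofReal_lt_top hφ2.2).ne
      (hμ.eLpNorm_rieszRegH_le H hφ hφ2 hδ)
    rwa [ENNReal.toReal_mul, ENNReal.toReal_ofReal hC] at h
  -- The limits of the pairings form a bounded linear functional on L², and u is its Riesz
  -- representative.
  let u := (InnerProductSpace.toDual ℝ (Lp (Space d) 2 μ)).symm (Λ'.mkContinuous _ hbound)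
  refine ⟨u, Lp.memLp u, fun g hg => ?_⟩
  have h1 : ∫ x, inner ℝ (u x) (g x) ∂μ = Λ hg.toLp := by
    have : inner ℝ u hg.toLp = Λ hg.toLp := by
      rw [InnerProductSpace.toDual_symm_apply]
      rfl
    rw [← this, L2.inner_def]
    refine integral_congr_ae ?_
    filter_upwards [hg.coeFn_toLp] with x hx
    rw [hx]
  rw [h1]
  refine (hΛ hg.toLp).congr fun δ => integral_congr_ae ?_
  filter_upwards [hg.coeFn_toLp] with x hx
  rw [hx]

theorem isWeakRieszLimit_rieszMu {H : Submodule ℝ (Space d)} {φ : Space d → ℝ}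
    (h : ∃ u, IsWeakRieszLimit H μ φ u) : IsWeakRieszLimit H μ φ (rieszMu H μ φ) := by
  rw [rieszMu, dif_pos h]
  exact h.choose_spec

/-- Lower semicontinuity of local `L²` norms under weak limits. -/
theorem IsWeakRieszLimit.setIntegral_norm_sq_le {H : Submodule ℝ (Space d)} {φ : Space d → ℝ}
    {u : Space d → Space d} (hu : IsWeakRieszLimit H μ φ u) {E : Set (Space d)}
    (hE : MeasurableSet E) {M : ℝ} (hR : ∀ δ > 0, MemLp (rieszRegH H δ μ φ) 2 μ)
    (hM : ∀ δ > 0, ∫ x in E, ‖rieszRegH H δ μ φ x‖ ^ 2 ∂μ ≤ M) :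
    ∫ x in E, ‖u x‖ ^ 2 ∂μ ≤ M := by
  -- Testing against u itself on E and applying the inequality of arithmetic and geometric means
  -- gives X ≤ (M + X)/2 for X = ∫_E |u|², hence X ≤ M.
  have hg : MemLp (E.indicator u) 2 μ := hu.1.indicator hE
  have h1 : ∫ x, inner ℝ (u x) (E.indicator u x) ∂μ = ∫ x in E, ‖u x‖ ^ 2 ∂μ := by
    rw [← integral_indicator hE]
    refine integral_congr_ae (ae_of_all _ fun x => ?_)
    by_cases hx : x ∈ E <;> simp [hx]
  have h2 : ∫ x in E, ‖u x‖ ^ 2 ∂μ ≤ (M + ∫ x in E, ‖u x‖ ^ 2 ∂μ) / 2 := by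
    have ht := hu.2 _ hg
    rw [h1] at ht
    refine le_of_tendsto ht ?_
    filter_upwards [eventually_mem_nhdsWithin] with δ hδ
    have hi1 := (integrable_norm_sq (hR δ hδ)).integrableOn (s := E)
    have hi2 := (integrable_norm_sq hu.1).integrableOn (s := E)
    calc ∫ x, inner ℝ (rieszRegH H δ μ φ x) (E.indicator u x) ∂μ
        = ∫ x in E, inner ℝ (rieszRegH H δ μ φ x) (u x) ∂μ := by
          rw [← integral_indicator hE]
          refine integral_congr_ae (ae_of_all _ fun x => ?_)
          by_cases hx : x ∈ E <;> simp [hx]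
      _ ≤ ∫ x in E, (‖rieszRegH H δ μ φ x‖ ^ 2 + ‖u x‖ ^ 2) / 2 ∂μ := by
          refine integral_mono (integrable_inner (hR δ hδ) hu.1).integrableOn
            ((hi1.add hi2).div_const 2) fun x => ?_
          have := real_inner_le_norm (rieszRegH H δ μ φ x) (u x)
          have := two_mul_le_add_sq ‖rieszRegH H δ μ φ x‖ ‖u x‖
          simp only
          linarith
      _ = (∫ x in E, ‖rieszRegH H δ μ φ x‖ ^ 2 ∂μ + ∫ x in E, ‖u x‖ ^ 2 ∂μ) / 2 := by
          rw [integral_div, integral_add hi1 hi2]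
      _ ≤ _ := by gcongr; exact hM δ hδ
  linarith

/-- Where the density vanishes in a neighborhood, the weak limit is given by the kernel. -/
theorem IsWeakRieszLimit.ae_eq_of_far {H : Submodule ℝ (Space d)} {φ : Space d → ℝ}
    {u : Space d → Space d} (hu : IsWeakRieszLimit H μ φ u) {U : Set (Space d)}
    (hU : MeasurableSet U) (hR : ∀ δ > 0, MemLp (rieszRegH H δ μ φ) 2 μ) {Δ : ℝ} (hΔ : 0 < Δ)
    (hfar : ∀ x ∈ U, ∀ y, φ y ≠ 0 → Δ ≤ ‖x - y‖) :
    ∀ᵐ x ∂μ, x ∈ U → u x = rieszRegH H Δ μ φ x := by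
  have hv : MemLp (fun x => u x - rieszRegH H Δ μ φ x) 2 μ := hu.1.sub (hR Δ hΔ)
  have hg := hv.indicator hU
  have ht := hu.2 _ hg
  -- For δ ≤ Δ the regularized transforms coincide on U, so the pairing with the difference (cut off
  -- to U) is constant in δ. Its limit then forces the squared norm of that difference to vanish.
  have hconst : ∀ᶠ δ : ℝ in 𝓝[>] 0,
      ∫ x, inner ℝ (rieszRegH H Δ μ φ x) (U.indicator (fun x => u x - rieszRegH H Δ μ φ x) x) ∂μ
      = ∫ x, inner ℝ (rieszRegH H δ μ φ x)
        (U.indicator (fun x => u x - rieszRegH H Δ μ φ x) x) ∂μ := by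
    filter_upwards [Ioc_mem_nhdsGT hΔ] with δ hδ
    refine integral_congr_ae (ae_of_all _ fun x => ?_)
    by_cases hx : x ∈ U
    · simp only
      rw [rieszRegH_congr_of_far H hδ.2 x (hfar x hx)]
    · simp [hx]
  have h1 := tendsto_nhds_unique ht (tendsto_const_nhds.congr' hconst)
  have h2 : ∫ x in U, ‖u x - rieszRegH H Δ μ φ x‖ ^ 2 ∂μ = 0 := by
    rw [← sub_eq_zero, ← integral_sub (integrable_inner hu.1 hg)
      (integrable_inner (hR Δ hΔ) hg)] at h1
    rw [← integral_indicator hU, ← h1]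
    refine integral_congr_ae (ae_of_all _ fun x => ?_)
    by_cases hx : x ∈ U
    · simp only [hx, Set.indicator_of_mem]
      rw [← inner_sub_left, real_inner_self_eq_norm_sq]
    · simp [hx]
  rw [integral_eq_zero_iff_of_nonneg (fun _ => by positivity)
    (integrable_norm_sq hv).integrableOn] at h2
  have h3 := (ae_restrict_iff' hU).1 h2
  filter_upwards [h3] with x hx hxU
  have := hx hxU
  simpa [sub_eq_zero] using this

theorem IsWeakRieszLimit.sub {H : Submodule ℝ (Space d)} {φ ψ : Space d → ℝ}
    {u v : Space d → Space d} (hu : IsWeakRieszLimit H μ φ u) (hv : IsWeakRieszLimit H μ ψ v)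
    (hφ : Integrable φ μ) (hψ : Integrable ψ μ)
    (hRφ : ∀ δ > 0, MemLp (rieszRegH H δ μ φ) 2 μ) (hRψ : ∀ δ > 0, MemLp (rieszRegH H δ μ ψ) 2 μ) :
    IsWeakRieszLimit H μ (fun y => φ y - ψ y) (fun x => u x - v x) := by
  refine ⟨hu.1.sub hv.1, fun g hg => ?_⟩
  have h := (hu.2 g hg).sub (hv.2 g hg)
  rw [← integral_sub (integrable_inner hu.1 hg) (integrable_inner hv.1 hg)] at h
  simp_rw [inner_sub_left]
  refine h.congr' ?_
  filter_upwards [eventually_mem_nhdsWithin] with δ hδ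
  rw [← integral_sub (integrable_inner (hRφ δ hδ) hg) (integrable_inner (hRψ δ hδ) hg)]
  refine integral_congr_ae (ae_of_all _ fun x => ?_)
  simp only
  rw [rieszRegH_sub H hφ hψ hδ, inner_sub_left]

end Good

/-! ### Lebesgue measure on a hyperplane -/

/-- The volume of the unit ball of `ℝ^d`. -/
noncomputable def unitBallVolume (d : ℕ) : ℝ := √Real.pi ^ d / Real.Gamma ((d : ℝ) / 2 + 1)

theorem unitBallVolume_pos (d : ℕ) : 0 < unitBallVolume d := by
  have h := Real.Gamma_pos_of_pos (show 0 < (d : ℝ) / 2 + 1 by positivity)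
  have := Real.pi_pos
  unfold unitBallVolume
  positivity

section Plane

variable {d : ℕ} {H : Submodule ℝ (Space d)} {z : Space d}

theorem measurableEmbedding_plane (H : Submodule ℝ (Space d)) (z : Space d) :
    MeasurableEmbedding (fun h : H => z + (h : Space d)) := by
  have h1 : IsClosedEmbedding (fun h : H => (h : Space d)) :=
    H.closed_of_finiteDimensional.isClosedEmbedding_subtypeVal
  exact ((Homeomorph.addLeft z).isClosedEmbedding.comp h1).measurableEmbedding

theorem integral_planeMeasure {E : Type*} [NormedAddCommGroup E] [NormedSpace ℝ E]
    (f : Space d → E) : ∫ y, f y ∂(planeMeasure H z) = ∫ h : H, f (z + h) :=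
  (measurableEmbedding_plane H z).integral_map f

theorem ae_mem_plane : ∀ᵐ y ∂(planeMeasure H z), y - z ∈ H := by
  rw [planeMeasure, (measurableEmbedding_plane H z).ae_map_iff]
  exact ae_of_all _ fun h => by simp

/-- For y in the plane, the left side is the norm of the projection of y - x. Thus the foot of x is
never farther from y than x is, and the density at the foot serves as the value to be subtracted
even when x is off the plane. -/
theorem norm_sub_projection_le (x : Space d) {y : Space d} (hy : y - z ∈ H) :
    ‖y - (z + H.starProjection (x - z))‖ ≤ ‖x - y‖ := by
  have h1 : y - (z + H.starProjection (x - z)) = H.starProjection (y - x) := by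
    have h2 : H.starProjection (y - z) = y - z := H.starProjection_eq_self_iff.2 hy
    have h3 : y - x = (y - z) - (x - z) := by abel
    rw [h3, map_sub H.starProjection (y - z), h2]
    abel
  rw [h1, norm_sub_rev x y]
  exact H.norm_starProjection_apply_le _

/-- The trace of a ball on the plane lies in the ball of the same radius around the foot of its
center. -/
theorem isNiceMeasure_planeMeasure (hd : 1 ≤ d) (hH : Module.finrank ℝ H = d) (z : Space d) :
    IsNiceMeasure (unitBallVolume d) (planeMeasure H z) := by
  intro x r hr
  have : Nontrivial H := Module.nontrivial_of_finrank_pos (R := ℝ) (by omega)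
  let p : H := ⟨H.starProjection (x - z), H.starProjection_apply_mem _⟩
  rw [planeMeasure, (measurableEmbedding_plane H z).map_apply]
  have hsub : (fun h : H => z + (h : Space d)) ⁻¹' ball x r ⊆ ball p r := by
    intro h hh
    rw [Set.mem_preimage, mem_ball, dist_eq_norm] at hh
    rw [mem_ball, dist_eq_norm, ← Submodule.norm_coe]
    refine lt_of_le_of_lt ?_ hh
    have := norm_sub_projection_le (H := H) (z := z) x (y := z + h) (by simp)
    rw [norm_sub_rev x] at this
    simpa [p] using this
  refine (measure_mono hsub).trans (le_of_eq ?_)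
  rw [InnerProductSpace.volume_ball, hH, ← ENNReal.ofReal_pow hr.le,
    ← ENNReal.ofReal_mul (by positivity), mul_comm, unitBallVolume]

/-- The average of the kernel `π_H K` over a hyperplane parallel to `H` vanishes. -/
theorem integral_rieszKernelH_sub_eq_zero (δ Δ : ℝ) (x : Space d) :
    ∫ y, H.starProjection (rieszKernel δ (x - y) - rieszKernel Δ (x - y)) ∂(planeMeasure H z)
      = 0 := by
  rw [integral_planeMeasure]
  let p : H := ⟨H.starProjection (x - z), H.starProjection_apply_mem _⟩
  set F : H → Space d := fun h =>
    H.starProjection (rieszKernel δ (x - (z + (h : Space d)))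
      - rieszKernel Δ (x - (z + (h : Space d)))) with hF
  -- Reflect the plane in the foot p of x. The component of x - y orthogonal to H is unchanged and
  -- the component along H changes sign, so |x - y| is preserved and π_H K is reversed. Without π_H
  -- the orthogonal component would survive.
  have hodd : ∀ h, F ((p + p) - h) = -F h := by
    intro h
    set q := x - z - H.starProjection (x - z) with hq
    have hqH : q ∈ Hᗮ := H.sub_starProjection_mem_orthogonal _
    have hproj : ∀ w : H, H.starProjection (q + w) = w := fun w => by
      rw [map_add, H.starProjection_apply_eq_zero_iff.2 hqH, zero_add]
      exact H.starProjection_eq_self_iff.2 w.2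
    have hnorm : ∀ w : H, ‖q + ((-w : H) : Space d)‖ = ‖q + (w : Space d)‖ := fun w => by
      have h0 : inner ℝ q (w : Space d) = 0 := (Submodule.mem_orthogonal' H q).1 hqH w w.2
      rw [← sq_eq_sq₀ (norm_nonneg _) (norm_nonneg _), norm_add_sq_real, norm_add_sq_real]
      simp [h0]
    have e1 : x - (z + h) = q + ((p - h : H) : Space d) := by
      simp [hq, p]; abel
    have e2 : x - (z + ((p + p - h : H) : Space d)) = q + ((-(p - h) : H) : Space d) := by
      simp [hq, p]; abel
    simp only [hF]
    rw [e1, e2]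
    simp only [rieszKernel, map_sub, map_smul, hproj, hnorm]
    rw [Submodule.coe_neg]
    simp only [smul_neg]
    abel
  have h1 : ∫ h, F h = ∫ h, F ((p + p) - h) := (integral_sub_left_eq_self F volume (p + p)).symm
  simp_rw [hodd] at h1
  rw [integral_neg] at h1
  have h2 : (2 : ℝ) • ∫ h, F h = 0 := by
    rw [two_smul]
    exact add_eq_zero_iff_eq_neg.2 h1
  exact (smul_eq_zero.1 h2).resolve_left two_ne_zero

/-- For a Lipschitz density on a hyperplane, the regularized `H`-transforms converge at a linear
rate, uniformly in the whole space. -/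
theorem norm_rieszRegH_plane_sub_le (hd : 1 ≤ d) (hH : Module.finrank ℝ H = d) (z : Space d)
    {f : Space d → ℝ} (hf : Integrable f (planeMeasure H z)) {L : ℝ} (hL : 0 ≤ L)
    (hfL : ∀ x y, |f x - f y| ≤ L * ‖x - y‖) {δ Δ : ℝ} (hδ : 0 < δ) (h : δ ≤ Δ) (x : Space d) :
    ‖rieszRegH H δ (planeMeasure H z) f x - rieszRegH H Δ (planeMeasure H z) f x‖
      ≤ L * (unitBallVolume d * 4 ^ (d + 1) * Δ) := by
  have hΔ : 0 < Δ := hδ.trans_le h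
  have hν := isNiceMeasure_planeMeasure hd hH z
  have hV := unitBallVolume_pos d
  have := hν.isLocallyFinite
  set F : Space d → Space d := fun y =>
    H.starProjection (rieszKernel δ (x - y) - rieszKernel Δ (x - y)) with hF
  have hFi : Integrable F (planeMeasure H z) := by
    refine Continuous.integrable_of_hasCompactSupport ?_ ?_
    · exact H.starProjection.continuous.comp (((continuous_rieszKernel hδ).comp
        (continuous_const.sub continuous_id)).sub ((continuous_rieszKernel hΔ).comp
        (continuous_const.sub continuous_id)))
    · refine HasCompactSupport.intro (isCompact_closedBall x Δ) fun y hy => ?_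
      rw [mem_closedBall, not_le, dist_comm, dist_eq_norm] at hy
      simp only [hF]
      rw [rieszKernel_congr (h.trans hy.le) hy.le, sub_self, map_zero]
  -- The constant c may be subtracted from the density because the difference of kernels averages to
  -- zero on the plane; the Lipschitz bound then supplies the factor |x - y|.
  set c := f (z + H.starProjection (x - z)) with hc
  have e : rieszRegH H δ (planeMeasure H z) f x - rieszRegH H Δ (planeMeasure H z) f x
      = ∫ y, (f y - c) • F y ∂(planeMeasure H z) := by
    have hi1 := integrable_smul_rieszKernelH H hf hδ x
    have hi2 := integrable_smul_rieszKernelH H hf hΔ x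
    have e1 : ∀ y, (f y - c) • F y = (f y • H.starProjection (rieszKernel δ (x - y))
        - f y • H.starProjection (rieszKernel Δ (x - y))) - c • F y := fun y => by
      simp only [hF, map_sub, sub_smul, smul_sub]
      abel
    have h0 : ∫ y, F y ∂(planeMeasure H z) = 0 := integral_rieszKernelH_sub_eq_zero δ Δ x
    have s1 := integral_sub (hi1.sub hi2) (hFi.smul c)
    simp only [Pi.sub_apply, Pi.smul_apply] at s1
    simp_rw [e1]
    rw [s1, integral_smul, h0, smul_zero, sub_zero, integral_sub hi1 hi2]
    rfl
  rw [e]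
  refine norm_integral_le_mul_of_lintegral_le (by positivity) hL ?_
    (lintegral_near_le hV.le hν x hΔ)
  filter_upwards [ae_mem_plane] with y hy
  rw [norm_smul, Real.norm_eq_abs]
  calc |f y - c| * ‖F y‖ ≤ (L * ‖x - y‖) * ‖rieszKernel δ (x - y) - rieszKernel Δ (x - y)‖ := by
        gcongr
        · exact (hfL _ _).trans (by gcongr; exact norm_sub_projection_le x hy)
        · exact H.norm_starProjection_apply_le _
    _ = L * (‖x - y‖ * ‖rieszKernel δ (x - y) - rieszKernel Δ (x - y)‖) := by ring
    _ ≤ _ := by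
        gcongr
        exact norm_mul_norm_rieszKernel_sub_le hδ h _

theorem tendsto_rieszRegH_plane (hd : 1 ≤ d) (hH : Module.finrank ℝ H = d) (z : Space d)
    {f : Space d → ℝ} (hf : Integrable f (planeMeasure H z)) {L : ℝ} (hL : 0 ≤ L)
    (hfL : ∀ x y, |f x - f y| ≤ L * ‖x - y‖) (x : Space d) :
    Tendsto (fun δ : ℝ => rieszRegH H δ (planeMeasure H z) f x) (𝓝[>] 0)
      (𝓝 (rieszPtw H (planeMeasure H z) f x)) := by
  have hV := unitBallVolume_pos d
  refine tendsto_nhds_limUnder (cauchy_map_iff_exists_tendsto.1 ?_)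
  rw [Metric.cauchy_iff]
  refine ⟨inferInstance, fun η hη => ?_⟩
  set Δ := η / (4 * (L * (unitBallVolume d * 4 ^ (d + 1)) + 1)) with hΔ
  have hΔ0 : 0 < Δ := by positivity
  refine ⟨_, image_mem_map (Ioc_mem_nhdsGT hΔ0), ?_⟩
  have key : ∀ δ ∈ Set.Ioc 0 Δ, dist (rieszRegH H δ (planeMeasure H z) f x)
      (rieszRegH H Δ (planeMeasure H z) f x) ≤ η / 4 := fun δ hδ => by
    rw [dist_eq_norm]
    refine (norm_rieszRegH_plane_sub_le hd hH z hf hL hfL hδ.1 hδ.2 x).trans ?_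
    calc _ = (L * (unitBallVolume d * 4 ^ (d + 1))) * Δ := by ring
      _ ≤ (L * (unitBallVolume d * 4 ^ (d + 1)) + 1) * Δ := by gcongr; linarith
      _ = η / 4 := by rw [hΔ]; field_simp
  rintro _ ⟨δ, hδ, rfl⟩ _ ⟨δ', hδ', rfl⟩
  have h1 := key δ hδ
  have h2 := key δ' hδ'
  have := dist_triangle_right (rieszRegH H δ (planeMeasure H z) f x)
    (rieszRegH H δ' (planeMeasure H z) f x) (rieszRegH H Δ (planeMeasure H z) f x)
  simp only
  linarith

theorem norm_rieszPtw_sub_le (hd : 1 ≤ d) (hH : Module.finrank ℝ H = d) (z : Space d)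
    {f : Space d → ℝ} (hf : Integrable f (planeMeasure H z)) {L : ℝ} (hL : 0 ≤ L)
    (hfL : ∀ x y, |f x - f y| ≤ L * ‖x - y‖) {Δ : ℝ} (hΔ : 0 < Δ) (x : Space d) :
    ‖rieszPtw H (planeMeasure H z) f x - rieszRegH H Δ (planeMeasure H z) f x‖
      ≤ L * (unitBallVolume d * 4 ^ (d + 1) * Δ) := by
  refine le_of_tendsto ((tendsto_rieszRegH_plane hd hH z hf hL hfL x).sub_const _).norm ?_
  filter_upwards [Ioc_mem_nhdsGT hΔ] with δ hδ
  exact norm_rieszRegH_plane_sub_le hd hH z hf hL hfL hδ.1 hδ.2 x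

/-- The linear rate is uniform in x, so the limit is a uniform limit of continuous transforms. -/
theorem continuous_rieszPtw (hd : 1 ≤ d) (hH : Module.finrank ℝ H = d) (z : Space d)
    {f : Space d → ℝ} (hf : Integrable f (planeMeasure H z)) {L : ℝ} (hL : 0 ≤ L)
    (hfL : ∀ x y, |f x - f y| ≤ L * ‖x - y‖) {B : ℝ} (hB : 0 ≤ B) (hfB : ∀ y, |f y| ≤ B) :
    Continuous (rieszPtw H (planeMeasure H z) f) := by
  have hV := unitBallVolume_pos d
  have hν := isNiceMeasure_planeMeasure hd hH z
  refine continuous_of_uniform_approx_of_continuous (fun u hu => ?_)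
  obtain ⟨η, hη, hηu⟩ := Metric.mem_uniformity_dist.1 hu
  set Δ := η / (4 * (L * (unitBallVolume d * 4 ^ (d + 1)) + 1)) with hΔ
  have hΔ0 : 0 < Δ := by positivity
  refine ⟨_, continuous_rieszRegH H hV.le hν hf hB hfB hΔ0, fun x => hηu ?_⟩
  rw [dist_eq_norm]
  refine (norm_rieszPtw_sub_le hd hH z hf hL hfL hΔ0 x).trans_lt ?_
  calc _ = (L * (unitBallVolume d * 4 ^ (d + 1))) * Δ := by ring
    _ ≤ (L * (unitBallVolume d * 4 ^ (d + 1)) + 1) * Δ := by gcongr; linarith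
    _ = η / 4 := by rw [hΔ]; field_simp
    _ < η := by linarith

end Plane

/-! ### Cells and cutoffs -/

namespace DSLattice.Cell

variable {d : ℕ} {C : ℝ} {μ : Measure (Space d)} {D : DSLattice μ}

theorem size_pos (Q : D.Cell) : 0 < Q.size := by unfold size; positivity

theorem measurableSet (Q : D.Cell) : MeasurableSet Q.carrier := D.measurableSet _ _ Q.mem_cells

theorem center_mem (Q : D.Cell) : Q.center ∈ Q.carrier := (D.center_mem _ _ Q.mem_cells).1

theorem center_mem_support (Q : D.Cell) : Q.center ∈ μ.support :=
  (D.center_mem _ _ Q.mem_cells).2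

theorem carrier_subset_ball (Q : D.Cell) : Q.carrier ⊆ ball Q.center (4 * Q.size) := by
  have h := D.subset_ball _ _ Q.mem_cells
  rw [zpow_add₀ two_ne_zero, show (2 : ℝ) ^ (2 : ℤ) = 4 by norm_num, mul_comm] at h
  exact h

theorem ball_subset_carrier (Q : D.Cell) : ball Q.center (Q.size / 8) ⊆ Q.carrier := by
  have h := D.ball_subset _ _ Q.mem_cells
  rw [sub_eq_add_neg, zpow_add₀ two_ne_zero, show (2 : ℝ) ^ (-3 : ℤ) = 1 / 8 by norm_num,
    mul_one_div] at h
  exact h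

theorem compl_nonempty (Q : D.Cell) : (Q.carrierᶜ).Nonempty := by
  rw [Set.nonempty_compl]
  intro h
  have hb : Bornology.IsBounded (Set.univ : Set (Space d)) :=
    isBounded_ball.subset (h ▸ Q.carrier_subset_ball)
  exact NormedSpace.unbounded_univ ℝ (Space d) hb

/-- The distance to the complement of the cell. -/
noncomputable def depth (Q : D.Cell) (x : Space d) : ℝ := infDist x Q.carrierᶜ

theorem continuous_depth (Q : D.Cell) : Continuous Q.depth := continuous_infDist_pt _

theorem abs_depth_sub_le (Q : D.Cell) (x y : Space d) : |Q.depth x - Q.depth y| ≤ ‖x - y‖ := by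
  have := (lipschitz_infDist_pt Q.carrierᶜ).dist_le_mul x y
  simpa [Real.dist_eq, dist_eq_norm, depth] using this

theorem mem_of_depth_pos {Q : D.Cell} {x : Space d} (h : 0 < Q.depth x) : x ∈ Q.carrier := by
  by_contra hx
  exact h.ne' (infDist_zero_of_mem hx)

theorem le_depth_of_ball_subset {Q : D.Cell} {x : Space d} {r : ℝ} (h : ball x r ⊆ Q.carrier) :
    r ≤ Q.depth x := by
  refine (le_infDist Q.compl_nonempty).2 fun y hy => ?_
  by_contra hlt
  rw [not_le, dist_comm] at hlt
  exact hy (h hlt)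

theorem depth_mono {Q Q' : D.Cell} (h : Q'.carrier ⊆ Q.carrier) (x : Space d) :
    Q'.depth x ≤ Q.depth x :=
  infDist_le_infDist_of_subset (Set.compl_subset_compl.2 h) Q.compl_nonempty

/-! ### Mollified cutoffs of cells -/

variable {φ₀ : Space d → ℝ} {ε : ℝ}

/-- The rescaled mollifier. -/
noncomputable def mollifier (φ₀ : Space d → ℝ) (s : ℝ) (u : Space d) : ℝ :=
  (s ^ (d + 1))⁻¹ * φ₀ (s⁻¹ • u)

theorem cutoff_eq (φ₀ : Space d → ℝ) (ε : ℝ) (Q : D.Cell) (x : Space d) :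
    Q.cutoff φ₀ ε x = ∫ y in Q.shrink (2 * ε), mollifier φ₀ (ε * Q.size) (x - y) := rfl

theorem mollifier_nonneg (hφ : IsUnitMollifier φ₀) {s : ℝ} (hs : 0 < s) (u : Space d) :
    0 ≤ mollifier φ₀ s u := mul_nonneg (by positivity) (hφ.nonneg _)

theorem mollifier_eq_zero (hφ : IsUnitMollifier φ₀) {s : ℝ} (hs : 0 < s) {u : Space d}
    (hu : s ≤ ‖u‖) : mollifier φ₀ s u = 0 := by
  have : φ₀ (s⁻¹ • u) = 0 := by
    by_contra h
    have h1 := hφ.tsupport_subset (subset_tsupport _ h)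
    rw [mem_ball_zero_iff, norm_smul, Real.norm_of_nonneg (by positivity), inv_mul_lt_iff₀ hs,
      mul_one] at h1
    linarith
  rw [mollifier, this, mul_zero]

theorem hasCompactSupport_of_mollifier (hφ : IsUnitMollifier φ₀) : HasCompactSupport φ₀ :=
  (isCompact_closedBall (0 : Space d) 1).of_isClosed_subset (isClosed_tsupport _)
    (hφ.tsupport_subset.trans ball_subset_closedBall)

theorem integrable_mollifier (hφ : IsUnitMollifier φ₀) {s : ℝ} (hs : 0 < s) :
    Integrable (mollifier φ₀ s) :=
  (((hφ.smooth.continuous.integrable_of_hasCompactSupport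
    (hasCompactSupport_of_mollifier hφ)).comp_smul (inv_ne_zero hs.ne')).const_mul _)

theorem integral_mollifier (hφ : IsUnitMollifier φ₀) {s : ℝ} (hs : 0 < s) :
    ∫ u, mollifier φ₀ s u = 1 := by
  simp only [mollifier]
  rw [integral_const_mul, Measure.integral_comp_smul_of_nonneg volume φ₀ s⁻¹
    (hR := by positivity), hφ.integral_eq, finrank_euclideanSpace_fin]
  simp only [smul_eq_mul, mul_one]
  rw [inv_pow, inv_inv, inv_mul_cancel₀ (by positivity)]

theorem integrable_mollifier_sub (hφ : IsUnitMollifier φ₀) {s : ℝ} (hs : 0 < s) (x : Space d) :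
    Integrable (fun y => mollifier φ₀ s (x - y)) :=
  (integrable_mollifier hφ hs).comp_sub_left x

theorem cutoff_nonneg (hφ : IsUnitMollifier φ₀) (hε : 0 < ε) (Q : D.Cell) (x : Space d) :
    0 ≤ Q.cutoff φ₀ ε x := by
  rw [cutoff_eq]
  exact integral_nonneg fun y => mollifier_nonneg hφ (mul_pos hε Q.size_pos) _

theorem cutoff_le_one (hφ : IsUnitMollifier φ₀) (hε : 0 < ε) (Q : D.Cell) (x : Space d) :
    Q.cutoff φ₀ ε x ≤ 1 := by
  have hs := mul_pos hε Q.size_pos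
  rw [cutoff_eq, ← integral_mollifier hφ hs, ← integral_sub_left_eq_self _ volume x]
  exact setIntegral_le_integral (integrable_mollifier_sub hφ hs x)
    (ae_of_all _ fun y => mollifier_nonneg hφ hs _)

theorem abs_cutoff_le_one (hφ : IsUnitMollifier φ₀) (hε : 0 < ε) (Q : D.Cell) (x : Space d) :
    |Q.cutoff φ₀ ε x| ≤ 1 := by
  rw [abs_of_nonneg (cutoff_nonneg hφ hε Q x)]
  exact cutoff_le_one hφ hε Q x

/-- The set being mollified has depth at least 2εℓ(Q) and the mollifier has radius εℓ(Q). This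
leaves depth εℓ(Q) on the support and, by the same margin inwards, the value 1 from depth 3εℓ(Q) on.
-/
theorem depth_of_cutoff_ne_zero (hφ : IsUnitMollifier φ₀) (hε : 0 < ε) {Q : D.Cell} {x : Space d}
    (h : Q.cutoff φ₀ ε x ≠ 0) : ε * Q.size ≤ Q.depth x := by
  by_contra hlt
  push Not at hlt
  refine h ?_
  have hs := mul_pos hε Q.size_pos
  rw [cutoff_eq]
  refine setIntegral_eq_zero_of_forall_eq_zero fun y hy => mollifier_eq_zero hφ hs ?_
  have h1 : 2 * ε * Q.size ≤ Q.depth y := hy.2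
  have h2 := Q.abs_depth_sub_le x y
  rw [abs_le] at h2
  linarith

theorem cutoff_eq_one (hφ : IsUnitMollifier φ₀) (hε : 0 < ε) {Q : D.Cell} {x : Space d}
    (h : 3 * ε * Q.size ≤ Q.depth x) : Q.cutoff φ₀ ε x = 1 := by
  have hs := mul_pos hε Q.size_pos
  rw [cutoff_eq, setIntegral_eq_integral_of_forall_compl_eq_zero,
    integral_sub_left_eq_self (mollifier φ₀ (ε * Q.size)) volume x, integral_mollifier hφ hs]
  intro y hy
  refine mollifier_eq_zero hφ hs ?_
  by_contra hlt
  push Not at hlt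
  refine hy ?_
  have h2 := Q.abs_depth_sub_le x y
  rw [abs_le] at h2
  have h3 : 2 * ε * Q.size ≤ Q.depth y := by linarith
  exact ⟨mem_of_depth_pos (lt_of_lt_of_le (by linarith) h3), h3⟩

theorem mem_of_cutoff_ne_zero (hφ : IsUnitMollifier φ₀) (hε : 0 < ε) {Q : D.Cell} {x : Space d}
    (h : Q.cutoff φ₀ ε x ≠ 0) : x ∈ Q.carrier :=
  mem_of_depth_pos (lt_of_lt_of_le (mul_pos hε Q.size_pos) (depth_of_cutoff_ne_zero hφ hε h))

theorem cutoff_eq_zero_of_notMem (hφ : IsUnitMollifier φ₀) (hε : 0 < ε) {Q : D.Cell} {x : Space d}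
    (h : x ∉ Q.carrier) : Q.cutoff φ₀ ε x = 0 := by
  by_contra h1
  exact h (mem_of_cutoff_ne_zero hφ hε h1)

theorem tsupport_cutoff_subset (hφ : IsUnitMollifier φ₀) (hε : 0 < ε) (Q : D.Cell) :
    tsupport (Q.cutoff φ₀ ε) ⊆ {x | ε * Q.size ≤ Q.depth x} :=
  closure_minimal (fun _ h => depth_of_cutoff_ne_zero hφ hε h)
    (isClosed_le continuous_const Q.continuous_depth)

theorem tsupport_cutoff_subset_carrier (hφ : IsUnitMollifier φ₀) (hε : 0 < ε) (Q : D.Cell) :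
    tsupport (Q.cutoff φ₀ ε) ⊆ Q.carrier := fun _ hx =>
  mem_of_depth_pos (lt_of_lt_of_le (mul_pos hε Q.size_pos) (tsupport_cutoff_subset hφ hε Q hx))

theorem hasCompactSupport_cutoff (hφ : IsUnitMollifier φ₀) (hε : 0 < ε) (Q : D.Cell) :
    HasCompactSupport (Q.cutoff φ₀ ε) :=
  (isCompact_closedBall Q.center (4 * Q.size)).of_isClosed_subset (isClosed_tsupport _)
    ((tsupport_cutoff_subset_carrier hφ hε Q).trans
      (Q.carrier_subset_ball.trans ball_subset_closedBall))

/-- The cutoffs are Lipschitz on the scale `ε ℓ(Q)`. -/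
theorem exists_cutoff_lipschitz (hφ : IsUnitMollifier φ₀) :
    ∃ c₀ : ℝ, 0 < c₀ ∧ ∀ (μ : Measure (Space d)) (D : DSLattice μ) (Q : D.Cell) (ε : ℝ), 0 < ε →
      ∀ x x', |Q.cutoff φ₀ ε x - Q.cutoff φ₀ ε x'| ≤ c₀ / (ε * Q.size) * ‖x - x'‖ := by
  obtain ⟨L, hL⟩ := hφ.smooth.lipschitzWith_of_hasCompactSupport
    (hasCompactSupport_of_mollifier hφ) (by simp)
  have hV := unitBallVolume_pos (d + 1)
  -- The summand 1 keeps the constant positive. It depends only on φ₀ and d, and the measure and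
  -- lattice are quantified after it: this is needed because σ is chosen before μ.
  refine ⟨2 * L * unitBallVolume (d + 1) + 1, by positivity, fun μ D Q ε hε x x' => ?_⟩
  set s := ε * Q.size with hs
  have hs0 : 0 < s := mul_pos hε Q.size_pos
  have hvol : ∀ x : Space d, volume.real (ball x s) = s ^ (d + 1) * unitBallVolume (d + 1) := by
    intro x
    rw [measureReal_def, InnerProductSpace.volume_ball, finrank_euclideanSpace_fin,
      ENNReal.toReal_mul, ENNReal.toReal_pow, ENNReal.toReal_ofReal hs0.le,
      ENNReal.toReal_ofReal, unitBallVolume]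
    exact (unitBallVolume_pos (d + 1)).le
  rw [cutoff_eq, cutoff_eq, ← integral_sub (integrable_mollifier_sub hφ hs0 x).integrableOn
    (integrable_mollifier_sub hφ hs0 x').integrableOn]
  have hi : Integrable fun y => |mollifier φ₀ s (x - y) - mollifier φ₀ s (x' - y)| :=
    ((integrable_mollifier_sub hφ hs0 x).sub (integrable_mollifier_sub hφ hs0 x')).abs
  calc |∫ y in Q.shrink (2 * ε), mollifier φ₀ s (x - y) - mollifier φ₀ s (x' - y)|
      ≤ ∫ y in Q.shrink (2 * ε), |mollifier φ₀ s (x - y) - mollifier φ₀ s (x' - y)| :=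
        abs_integral_le_integral_abs
    _ ≤ ∫ y, |mollifier φ₀ s (x - y) - mollifier φ₀ s (x' - y)| :=
        setIntegral_le_integral hi (ae_of_all _ fun y => abs_nonneg _)
    _ = ∫ y in ball x s ∪ ball x' s, |mollifier φ₀ s (x - y) - mollifier φ₀ s (x' - y)| := by
        rw [setIntegral_eq_integral_of_forall_compl_eq_zero]
        intro y hy
        rw [Set.mem_union, not_or, mem_ball, mem_ball, not_lt, not_lt, dist_comm y, dist_comm y,
          dist_eq_norm, dist_eq_norm] at hy
        rw [mollifier_eq_zero hφ hs0 hy.1, mollifier_eq_zero hφ hs0 hy.2, sub_self, abs_zero]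
    -- The normalization s^(-(d+1)) is paid back by the volume of the two balls, leaving the single
    -- factor 1/s.
    _ ≤ ((s ^ (d + 1))⁻¹ * (L * (s⁻¹ * ‖x - x'‖))) * volume.real (ball x s ∪ ball x' s) := by
        have h := norm_setIntegral_le_of_norm_le_const (μ := volume)
          (s := ball x s ∪ ball x' s) (C := (s ^ (d + 1))⁻¹ * (L * (s⁻¹ * ‖x - x'‖)))
          (f := fun y => |mollifier φ₀ s (x - y) - mollifier φ₀ s (x' - y)|)
          ((measure_union_le _ _).trans_lt
            (ENNReal.add_lt_top.2 ⟨measure_ball_lt_top, measure_ball_lt_top⟩)) fun y _ => ?_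
        · exact (Real.le_norm_self _).trans h
        · rw [Real.norm_eq_abs, abs_abs, mollifier, mollifier, ← mul_sub, abs_mul,
            abs_of_pos (by positivity : 0 < (s ^ (d + 1))⁻¹)]
          gcongr
          have h1 := hL.dist_le_mul (s⁻¹ • (x - y)) (s⁻¹ • (x' - y))
          rw [Real.dist_eq, dist_eq_norm, ← smul_sub, norm_smul,
            Real.norm_of_nonneg (by positivity), sub_sub_sub_cancel_right] at h1
          exact h1
    _ ≤ ((s ^ (d + 1))⁻¹ * (L * (s⁻¹ * ‖x - x'‖)))
          * (s ^ (d + 1) * unitBallVolume (d + 1) + s ^ (d + 1) * unitBallVolume (d + 1)) := by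
        gcongr
        exact (measureReal_union_le _ _).trans (by rw [hvol, hvol])
    _ = (2 * L * unitBallVolume (d + 1)) / s * ‖x - x'‖ := by
        field_simp
        ring
    _ ≤ _ := by gcongr; linarith

theorem continuous_cutoff (hφ : IsUnitMollifier φ₀) (hε : 0 < ε) (Q : D.Cell) :
    Continuous (Q.cutoff φ₀ ε) := by
  obtain ⟨c₀, hc₀, h⟩ := exists_cutoff_lipschitz hφ
  have := Q.size_pos
  refine (LipschitzWith.of_dist_le_mul (K := ⟨c₀ / (ε * Q.size), by positivity⟩)
    fun x x' => ?_).continuous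
  rw [Real.dist_eq, dist_eq_norm]
  exact h μ D Q ε hε x x'

theorem integrable_cutoff (hφ : IsUnitMollifier φ₀) (hε : 0 < ε) (Q : D.Cell)
    (ν : Measure (Space d)) [IsLocallyFiniteMeasure ν] : Integrable (Q.cutoff φ₀ ε) ν :=
  (continuous_cutoff hφ hε Q).integrable_of_hasCompactSupport (hasCompactSupport_cutoff hφ hε Q)

/-- The ball of radius ℓ/8 about the center lies in Q, so points of the concentric ball of half the
radius have depth at least ℓ/16. This exceeds 3εℓ because ε < 1/48. -/
theorem cutoff_eq_one_of_mem_ball (hφ : IsUnitMollifier φ₀) (hε : 0 < ε) (hε' : ε < 1 / 48)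
    (Q : D.Cell) {x : Space d} (hx : x ∈ ball Q.center (Q.size / 16)) :
    Q.cutoff φ₀ ε x = 1 := by
  have := Q.size_pos
  refine cutoff_eq_one hφ hε ?_
  have h : Q.size / 16 ≤ Q.depth x := by
    refine le_depth_of_ball_subset ((ball_subset_ball' ?_).trans Q.ball_subset_carrier)
    rw [mem_ball] at hx
    linarith
  nlinarith

/-! ### Measures of cells -/

theorem measure_le (hμ : IsNiceMeasure C μ) (Q : D.Cell) :
    μ Q.carrier ≤ ENNReal.ofReal (C * (4 * Q.size) ^ d) :=
  (measure_mono Q.carrier_subset_ball).trans (hμ _ _ (mul_pos four_pos Q.size_pos))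

theorem measure_lt_top (hμ : IsNiceMeasure C μ) (Q : D.Cell) : μ Q.carrier < ∞ :=
  (Q.measure_le hμ).trans_lt ENNReal.ofReal_lt_top

theorem measureReal_le (hC : 0 ≤ C) (hμ : IsNiceMeasure C μ) (Q : D.Cell) :
    μ.real Q.carrier ≤ C * (4 * Q.size) ^ d := by
  have := Q.size_pos
  exact ENNReal.toReal_le_of_le_ofReal (by positivity) (Q.measure_le hμ)

theorem le_measureReal {c : ℝ} (hμ : IsNiceMeasure C μ)
    (hl : IsLowerRegularIn Set.univ c μ) (Q : D.Cell) :
    c * (Q.size / 8) ^ d ≤ μ.real Q.carrier := by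
  have h1 : 0 < Q.size / 8 := by have := Q.size_pos; positivity
  have h := (hl _ ⟨Q.center_mem_support, trivial⟩ _ h1 (Set.subset_univ _)).trans
    (measure_mono Q.ball_subset_carrier)
  exact (ENNReal.ofReal_le_iff_le_toReal (Q.measure_lt_top hμ).ne).1 h

theorem pow_size_le {c : ℝ} (hc : 0 < c) (hμ : IsNiceMeasure C μ)
    (hl : IsLowerRegularIn Set.univ c μ) (Q : D.Cell) :
    Q.size ^ d ≤ 8 ^ d / c * μ.real Q.carrier := by
  have h := Q.le_measureReal hμ hl
  rw [div_pow] at h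
  calc Q.size ^ d = 8 ^ d / c * (c * (Q.size ^ d / 8 ^ d)) := by field_simp
    _ ≤ _ := by gcongr

theorem integral_cutoff_le (hφ : IsUnitMollifier φ₀) (hε : 0 < ε) (hC : 0 ≤ C)
    (hμ : IsNiceMeasure C μ) (Q : D.Cell) : ∫ x, Q.cutoff φ₀ ε x ∂μ ≤ C * (4 * Q.size) ^ d := by
  refine le_trans ?_ (Q.measureReal_le hC hμ)
  have h0 : ∫ x, Q.cutoff φ₀ ε x ∂μ = ∫ x in Q.carrier, Q.cutoff φ₀ ε x ∂μ := by
    rw [setIntegral_eq_integral_of_forall_compl_eq_zero]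
    exact fun x hx => cutoff_eq_zero_of_notMem hφ hε hx
  rw [h0]
  refine (Real.le_norm_self _).trans ?_
  have := norm_setIntegral_le_of_norm_le_const (μ := μ) (s := Q.carrier) (C := 1)
    (Q.measure_lt_top hμ) (f := Q.cutoff φ₀ ε) fun x _ => abs_cutoff_le_one hφ hε Q x
  rwa [one_mul] at this

/-! ### The approximating measures ν_Q -/

variable {H : Submodule ℝ (Space d)}

theorem le_integral_cutoff_plane (hφ : IsUnitMollifier φ₀) (hε : 0 < ε) (hε' : ε < 1 / 48)
    (hd : 1 ≤ d) (hH : Module.finrank ℝ H = d) (Q : D.Cell) :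
    unitBallVolume d * (Q.size / 16) ^ d ≤ ∫ x, Q.cutoff φ₀ ε x ∂(planeMeasure H Q.center) := by
  have hν := isNiceMeasure_planeMeasure hd hH Q.center
  have := hν.isLocallyFinite
  have hs := Q.size_pos
  have h1 : (planeMeasure H Q.center).real (ball Q.center (Q.size / 16))
      = unitBallVolume d * (Q.size / 16) ^ d := by
    have : Nontrivial H := Module.nontrivial_of_finrank_pos (R := ℝ) (by omega)
    rw [measureReal_def, planeMeasure, (measurableEmbedding_plane H _).map_apply]
    have : (fun h : H => Q.center + (h : Space d)) ⁻¹' ball Q.center (Q.size / 16)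
        = ball 0 (Q.size / 16) := by
      ext h; simp [dist_eq_norm]
    rw [this, InnerProductSpace.volume_ball, hH, ENNReal.toReal_mul, ENNReal.toReal_pow,
      ENNReal.toReal_ofReal (by positivity), mul_comm,
      ENNReal.toReal_ofReal (by exact (unitBallVolume_pos d).le), unitBallVolume]
  rw [← h1, ← mul_one (Measure.real _ _), ← smul_eq_mul, ← setIntegral_const]
  calc ∫ x in ball Q.center (Q.size / 16), (1 : ℝ) ∂(planeMeasure H Q.center)
      = ∫ x in ball Q.center (Q.size / 16), Q.cutoff φ₀ ε x ∂(planeMeasure H Q.center) :=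
        setIntegral_congr_fun measurableSet_ball fun x hx =>
          (cutoff_eq_one_of_mem_ball hφ hε hε' Q hx).symm
    _ ≤ _ := setIntegral_le_integral (integrable_cutoff hφ hε Q _)
        (ae_of_all _ fun x => cutoff_nonneg hφ hε Q x)

theorem integral_cutoff_plane_pos (hφ : IsUnitMollifier φ₀) (hε : 0 < ε) (hε' : ε < 1 / 48)
    (hd : 1 ≤ d) (hH : Module.finrank ℝ H = d) (Q : D.Cell) :
    0 < ∫ x, Q.cutoff φ₀ ε x ∂(planeMeasure H Q.center) := by
  have := Q.size_pos
  have := unitBallVolume_pos d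
  exact lt_of_lt_of_le (by positivity) (le_integral_cutoff_plane hφ hε hε' hd hH Q)

/-- A bound for the normalizing factors `a_Q`. -/
noncomputable def factorBound (d : ℕ) (C : ℝ) : ℝ := C * 64 ^ d / unitBallVolume d

theorem factorBound_nonneg (d : ℕ) (hC : 0 ≤ C) : 0 ≤ factorBound d C := by
  have := unitBallVolume_pos d
  unfold factorBound
  positivity

theorem normFactor_nonneg (hφ : IsUnitMollifier φ₀) (hε : 0 < ε) (Q : D.Cell) :
    0 ≤ Q.normFactor φ₀ ε H :=
  mul_nonneg (inv_nonneg.2 (integral_nonneg (cutoff_nonneg hφ hε Q)))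
    (integral_nonneg (cutoff_nonneg hφ hε Q))

/-- The mass of μ on Q is at most C(4ℓ)^d and the plane mass of φ_Q is at least that of a ball of
radius ℓ/16; the ratio is free of scale, and 64 = 4 · 16. -/
theorem normFactor_le (hφ : IsUnitMollifier φ₀) (hε : 0 < ε) (hε' : ε < 1 / 48)
    (hd : 1 ≤ d) (hH : Module.finrank ℝ H = d) (hC : 0 ≤ C) (hμ : IsNiceMeasure C μ)
    (Q : D.Cell) : Q.normFactor φ₀ ε H ≤ factorBound d C := by
  have hs := Q.size_pos
  have hV := unitBallVolume_pos d
  rw [normFactor, inv_mul_le_iff₀ (integral_cutoff_plane_pos hφ hε hε' hd hH Q)]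
  calc ∫ x, Q.cutoff φ₀ ε x ∂μ ≤ C * (4 * Q.size) ^ d := integral_cutoff_le hφ hε hC hμ Q
    _ = (unitBallVolume d * (Q.size / 16) ^ d) * factorBound d C := by
        rw [factorBound, show (64 : ℝ) = 4 * 16 by norm_num, div_pow, mul_pow, mul_pow]
        field_simp
    _ ≤ _ := by
        gcongr
        · exact factorBound_nonneg d hC
        · exact le_integral_cutoff_plane hφ hε hε' hd hH Q

theorem abs_approxDensity_le (hφ : IsUnitMollifier φ₀) (hε : 0 < ε) (hε' : ε < 1 / 48)
    (hd : 1 ≤ d) (hH : Module.finrank ℝ H = d) (hC : 0 ≤ C) (hμ : IsNiceMeasure C μ)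
    (Q : D.Cell) (x : Space d) : |Q.approxDensity φ₀ ε H x| ≤ factorBound d C := by
  rw [approxDensity, abs_mul, abs_of_nonneg (normFactor_nonneg hφ hε Q)]
  exact (mul_le_of_le_one_right (normFactor_nonneg hφ hε Q) (abs_cutoff_le_one hφ hε Q x)).trans
    (normFactor_le hφ hε hε' hd hH hC hμ Q)

theorem abs_approxDensity_sub_le (hφ : IsUnitMollifier φ₀) (hε : 0 < ε) (hε' : ε < 1 / 48)
    (hd : 1 ≤ d) (hH : Module.finrank ℝ H = d) (hC : 0 ≤ C) (hμ : IsNiceMeasure C μ)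
    (Q : D.Cell) {L : ℝ}
    (hL : ∀ x x', |Q.cutoff φ₀ ε x - Q.cutoff φ₀ ε x'| ≤ L * ‖x - x'‖) (x x' : Space d) :
    |Q.approxDensity φ₀ ε H x - Q.approxDensity φ₀ ε H x'|
      ≤ factorBound d C * L * ‖x - x'‖ := by
  rw [approxDensity, approxDensity, ← mul_sub, abs_mul, abs_of_nonneg (normFactor_nonneg hφ hε Q),
    mul_assoc]
  exact mul_le_mul (normFactor_le hφ hε hε' hd hH hC hμ Q) (hL x x') (abs_nonneg _)
    (factorBound_nonneg d hC)

theorem integrable_approxDensity (hφ : IsUnitMollifier φ₀) (hε : 0 < ε) (hd : 1 ≤ d)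
    (hH : Module.finrank ℝ H = d) (Q : D.Cell) :
    Integrable (Q.approxDensity φ₀ ε H) (planeMeasure H Q.center) := by
  have := (isNiceMeasure_planeMeasure hd hH Q.center).isLocallyFinite
  exact (integrable_cutoff hφ hε Q _).const_mul _

/-- Lipschitz continuity of the cutoff yields both limits: on μ through antisymmetry and the uniform
L² bounds, on the plane through the vanishing averages of the kernel. -/
theorem summandExists (hφ : IsUnitMollifier φ₀) (hε : 0 < ε) (hε' : ε < 1 / 48)
    (hd : 1 ≤ d) (hH : Module.finrank ℝ H = d) (hC : 0 ≤ C) (hμ : IsGoodMeasure C μ)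
    (Q : D.Cell) : Q.SummandExists φ₀ ε H := by
  obtain ⟨c₀, hc₀, hL⟩ := exists_cutoff_lipschitz hφ
  have hs := Q.size_pos
  have := hμ.1.isLocallyFinite
  have hpos := integral_cutoff_plane_pos hφ hε hε' hd hH Q
  refine ⟨hpos, ?_, isWeakRieszLimit_rieszMu ?_, ?_⟩
  · simp only [approxDensity]
    rw [integral_const_mul, normFactor, mul_comm, ← mul_assoc, mul_inv_cancel₀ hpos.ne', one_mul]
  · exact hμ.exists_isWeakRieszLimit hC H (integrable_cutoff hφ hε Q μ) zero_le_one
      (abs_cutoff_le_one hφ hε Q) (by positivity) (hL μ D Q ε hε)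
  · exact tendsto_rieszRegH_plane hd hH Q.center (integrable_approxDensity hφ hε hd hH Q)
      (mul_nonneg (factorBound_nonneg d hC) (by positivity))
      (abs_approxDensity_sub_le hφ hε hε' hd hH hC hμ.1 Q (hL μ D Q ε hε))

end DSLattice.Cell

/-! ### Combinatorics of the lattice -/

namespace DSLattice

variable {d : ℕ} {C c : ℝ} {μ : Measure (Space d)} {D : DSLattice μ}

theorem countable_cells (D : DSLattice μ) (k : ℤ) : (D.cells k).Countable := by
  refine (D.pairwiseDisjoint k).countable_of_nonempty_interior fun Q hQ => ?_
  refine ⟨D.center Q, mem_interior.2 ⟨_, D.ball_subset k Q hQ, isOpen_ball, ?_⟩⟩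
  exact mem_ball_self (by positivity)

theorem eq_of_mem_of_mem {k : ℤ} {S T : Set (Space d)} (hS : S ∈ D.cells k) (hT : T ∈ D.cells k)
    {x : Space d} (hxS : x ∈ S) (hxT : x ∈ T) : S = T := by
  by_contra h
  exact Set.disjoint_left.1 (D.pairwiseDisjoint k hS hT h) hxS hxT

theorem exists_ancestor (D : DSLattice μ) (k : ℤ) (n : ℕ) :
    ∀ S ∈ D.cells (k + n), ∃ Q ∈ D.cells k, S ⊆ Q := by
  induction n with
  | zero => exact fun S hS => ⟨S, by simpa using hS, subset_rfl⟩
  | succ n ih =>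
    intro S hS
    obtain ⟨Q', hQ', h1⟩ := D.nested (k + n) S (by
      rw [Nat.cast_succ, ← add_assoc] at hS; exact hS)
    obtain ⟨Q, hQ, h2⟩ := ih Q' hQ'
    exact ⟨Q, hQ, h1.trans h2⟩

/-- The ancestor of S on the level of T shares the point x with T, so it is T. -/
theorem subset_of_level_le {k n : ℤ} (hkn : k ≤ n) {S T : Set (Space d)} (hS : S ∈ D.cells n)
    (hT : T ∈ D.cells k) {x : Space d} (hxS : x ∈ S) (hxT : x ∈ T) : S ⊆ T := by
  obtain ⟨m, rfl⟩ := Int.le.dest hkn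
  obtain ⟨Q, hQ, h⟩ := D.exists_ancestor k m S hS
  rw [eq_of_mem_of_mem hT hQ hxT (h hxS)]
  exact h

namespace Cell

/-- Otherwise nesting would give the reverse inclusion, and one set would belong to two levels.
Disjointness of the levels is what makes size monotone under inclusion. -/
theorem level_le_of_subset {Q Q' : D.Cell} (h : Q'.carrier ⊆ Q.carrier) :
    Q.level ≤ Q'.level := by
  by_contra hlt
  push Not at hlt
  have h1 : Q.carrier ⊆ Q'.carrier :=
    subset_of_level_le hlt.le Q.mem_cells Q'.mem_cells (h Q'.center_mem) Q'.center_mem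
  have h2 := Q.mem_cells
  rw [h1.antisymm h] at h2
  exact Set.disjoint_left.1 (D.levels_disjoint hlt.ne) Q'.mem_cells h2

theorem size_of_level {Q Q' : D.Cell} {j : ℕ} (h : Q'.level = Q.level + j) :
    Q.size = 16 ^ j * Q'.size := by
  rw [size, size, h, mul_add, zpow_add₀ two_ne_zero, zpow_mul _ (-4) (j : ℤ), zpow_natCast,
    show (2 : ℝ) ^ (-4 : ℤ) = (16 : ℝ)⁻¹ by norm_num, inv_pow]
  field_simp

theorem size_le_of_subset {Q Q' : D.Cell} (h : Q'.carrier ⊆ Q.carrier) : Q'.size ≤ Q.size := by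
  obtain ⟨j, hj⟩ := Int.le.dest (level_le_of_subset h)
  rw [size_of_level hj.symm]
  exact le_mul_of_one_le_left Q'.size_pos.le (one_le_pow₀ (by norm_num))

theorem dist_lt {Q : D.Cell} {x y : Space d} (hx : x ∈ Q.carrier) (hy : y ∈ Q.carrier) :
    ‖x - y‖ < 8 * Q.size := by
  have h1 := mem_ball.1 (Q.carrier_subset_ball hx)
  have h2 := mem_ball.1 (Q.carrier_subset_ball hy)
  have := dist_triangle_right x y Q.center
  rw [← dist_eq_norm]
  linarith

/-! ### Boundary layers -/

/-- The subcells `j` levels down that contain points at distance less than `τ` from the complement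
of the cell. -/
def boundaryFamily (Q : D.Cell) (j : ℕ) (τ : ℝ) : Set (Set (Space d)) :=
  {S | S ∈ D.cells (Q.level + j) ∧ S ⊆ Q.carrier ∧ ∃ x ∈ S, Q.depth x < τ}

/-- The union of the subcells `j` levels down that are close to the boundary of the cell. -/
def boundaryLayer (Q : D.Cell) (j : ℕ) (τ : ℝ) : Set (Space d) := ⋃₀ Q.boundaryFamily j τ

theorem countable_boundaryFamily (Q : D.Cell) (j : ℕ) (τ : ℝ) :
    (Q.boundaryFamily j τ).Countable :=
  (D.countable_cells (Q.level + j)).mono fun _ h => h.1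

theorem measurableSet_of_mem_boundaryFamily {Q : D.Cell} {j : ℕ} {τ : ℝ} {S : Set (Space d)}
    (h : S ∈ Q.boundaryFamily j τ) : MeasurableSet S := D.measurableSet _ _ h.1

theorem measurableSet_boundaryLayer (Q : D.Cell) (j : ℕ) (τ : ℝ) :
    MeasurableSet (Q.boundaryLayer j τ) :=
  MeasurableSet.sUnion (Q.countable_boundaryFamily j τ)
    fun _ h => measurableSet_of_mem_boundaryFamily h

theorem boundaryLayer_subset (Q : D.Cell) (j : ℕ) (τ : ℝ) :
    Q.boundaryLayer j τ ⊆ Q.carrier := Set.sUnion_subset fun _ h => h.2.1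

/-- The layer consists of whole cells and contains every point of the support near the boundary.
Using whole cells allows L² bounds on single cells to be added over the layer. -/
theorem mem_boundaryLayer {Q : D.Cell} (j : ℕ) {τ : ℝ} {x : Space d} (hx : x ∈ Q.carrier)
    (hxs : x ∈ μ.support) (h : Q.depth x < τ) : x ∈ Q.boundaryLayer j τ := by
  obtain ⟨S, hS, hxS⟩ := D.cover (Q.level + j) hxs
  exact ⟨S, ⟨hS, subset_of_level_le (by omega) hS Q.mem_cells hxS hx, x, hxS, h⟩, hxS⟩

/-- The proportion of a cell occupied by the subcell two levels down around its center. -/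
noncomputable def centralPortion (d : ℕ) (C c : ℝ) : ℝ := min (c / (C * 8192 ^ d)) 1

/-- The rate of decay of the boundary layers. -/
noncomputable def boundaryRate (d : ℕ) (C c : ℝ) : ℝ := 1 - centralPortion d C c / 2

theorem centralPortion_pos (d : ℕ) (hC : 0 < C) (hc : 0 < c) : 0 < centralPortion d C c :=
  lt_min (by positivity) one_pos

theorem boundaryRate_pos (d : ℕ) (C c : ℝ) : 0 < boundaryRate d C c := by
  have : centralPortion d C c ≤ 1 := min_le_right _ _
  unfold boundaryRate
  linarith

theorem boundaryRate_lt_one (d : ℕ) (hC : 0 < C) (hc : 0 < c) : boundaryRate d C c < 1 := by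
  have := centralPortion_pos d hC hc
  unfold boundaryRate
  linarith

/-- The subcell T two levels below S that contains the center of S is too deep in Q to come near its
boundary. The layer two levels further down therefore misses T, which by AD regularity is a fixed
portion of S. -/
theorem measure_boundaryLayer_inter_le (hC : 0 < C) (hc : 0 < c) (hμ : IsNiceMeasure C μ)
    (hl : IsLowerRegularIn Set.univ c μ) (Q : D.Cell) (j : ℕ) {τ : ℝ}
    (hτ : 16 * 16 ^ j * τ ≤ Q.size) {S : Set (Space d)} (hS : S ∈ Q.boundaryFamily j τ) :
    μ (Q.boundaryLayer (j + 2) τ ∩ S) ≤ ENNReal.ofReal (boundaryRate d C c ^ 2) * μ S := by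
  let S' : D.Cell := ⟨Q.level + j, S, hS.1⟩
  obtain ⟨T, hT, hzT⟩ := D.cover (Q.level + (j + 2 : ℕ)) S'.center_mem_support
  let T' : D.Cell := ⟨Q.level + (j + 2 : ℕ), T, hT⟩
  have hTS : T ⊆ S := subset_of_level_le (by push_cast; omega) hT hS.1 hzT S'.center_mem
  have hsT := T'.size_pos
  have hsS : S'.size = 256 * T'.size := by
    rw [size_of_level (Q := S') (Q' := T') (j := 2) (by simp [S', T']; ring)]
    norm_num
  have hsQ : Q.size = 16 ^ j * S'.size := size_of_level rfl
  have hτS : 16 * τ ≤ S'.size := by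
    rw [hsQ, mul_assoc, mul_left_comm] at hτ
    exact le_of_mul_le_mul_left hτ (by positivity)
  -- A point of T with depth below τ ≤ ℓ(S)/16 would be within 8ℓ(T) = ℓ(S)/32 of the center of S,
  -- whose depth is at least ℓ(S)/8.
  have hTfam : T ∉ Q.boundaryFamily (j + 2) τ := by
    rintro ⟨_, _, x, hxT, hx⟩
    have h1 : ‖S'.center - x‖ < 8 * T'.size := dist_lt (Q := T') hzT hxT
    have h2 : S'.size / 8 ≤ Q.depth S'.center :=
      (le_depth_of_ball_subset S'.ball_subset_carrier).trans (depth_mono hS.2.1 _)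
    have h3 := Q.abs_depth_sub_le S'.center x
    rw [abs_le] at h3
    linarith
  have hsub : Q.boundaryLayer (j + 2) τ ∩ S ⊆ S \ T := by
    rintro y ⟨⟨R, hR, hyR⟩, hyS⟩
    refine ⟨hyS, fun hyT => hTfam ?_⟩
    rwa [eq_of_mem_of_mem hT hR.1 hyT hyR]
  have hSfin := S'.measure_lt_top hμ
  have hTfin := T'.measure_lt_top hμ
  have hreal : μ.real (S \ T) ≤ boundaryRate d C c ^ 2 * μ.real S := by
    rw [measureReal_sdiff hTS T'.measurableSet hSfin.ne]
    have h1 : μ.real S ≤ C * (4 * S'.size) ^ d := S'.measureReal_le hC.le hμ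
    have h2 : c * (T'.size / 8) ^ d ≤ μ.real T := T'.le_measureReal hμ hl
    have h3 : centralPortion d C c * μ.real S ≤ μ.real T := by
      -- The constant 8192 = 4 · 256 · 8 is the ratio of the outer radius 4ℓ(S) to the inner radius
      -- ℓ(T)/8.
      calc centralPortion d C c * μ.real S ≤ c / (C * 8192 ^ d) * (C * (4 * S'.size) ^ d) := by
            gcongr
            exact min_le_left _ _
        _ = c * (T'.size / 8) ^ d := by
            rw [hsS, show 4 * (256 * T'.size) = 8192 * (T'.size / 8) by ring, mul_pow]
            field_simp
        _ ≤ _ := h2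
    have h4 : 0 ≤ (centralPortion d C c / 2) ^ 2 * μ.real S := by positivity
    -- With p the central portion, 1 - p ≤ (1 - p/2)². The decay is written as a square because its
    -- square root serves later as the weight in the estimate of products.
    have h5 : boundaryRate d C c ^ 2 * μ.real S = μ.real S - centralPortion d C c * μ.real S
        + (centralPortion d C c / 2) ^ 2 * μ.real S := by
      unfold boundaryRate; ring
    linarith
  calc μ (Q.boundaryLayer (j + 2) τ ∩ S) ≤ μ (S \ T) := measure_mono hsub
    _ = ENNReal.ofReal (μ.real (S \ T)) :=
        (ENNReal.ofReal_toReal ((measure_mono Set.sdiff_subset).trans_lt hSfin).ne).symm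
    _ ≤ ENNReal.ofReal (boundaryRate d C c ^ 2 * μ.real S) := ENNReal.ofReal_le_ofReal hreal
    _ = _ := by
        rw [ENNReal.ofReal_mul (sq_nonneg _), measureReal_def, ENNReal.ofReal_toReal hSfin.ne]

/-- A cell of the finer family hands its near-boundary point to its ancestor, so the finer layer is
covered by cells of the coarser family. The estimate on each of them is then added. -/
theorem measure_boundaryLayer_succ_le (hC : 0 < C) (hc : 0 < c) (hμ : IsNiceMeasure C μ)
    (hl : IsLowerRegularIn Set.univ c μ) (Q : D.Cell) (j : ℕ) {τ : ℝ}
    (hτ : 16 * 16 ^ j * τ ≤ Q.size) :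
    μ (Q.boundaryLayer (j + 2) τ)
      ≤ ENNReal.ofReal (boundaryRate d C c ^ 2) * μ (Q.boundaryLayer j τ) := by
  have hcount := Q.countable_boundaryFamily j τ
  have hsub : Q.boundaryLayer (j + 2) τ
      ⊆ ⋃ S ∈ Q.boundaryFamily j τ, Q.boundaryLayer (j + 2) τ ∩ S := by
    rintro x ⟨T, hT, hxT⟩
    obtain ⟨S, hS, hTS⟩ := D.exists_ancestor (Q.level + j) 2 T (by
      have := hT.1; rwa [Nat.cast_add, ← add_assoc] at this)
    obtain ⟨y, hyT, hy⟩ := hT.2.2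
    refine Set.mem_biUnion (x := S) ⟨hS, subset_of_level_le (by omega) hS Q.mem_cells
      (hTS hyT) (hT.2.1 hyT), y, hTS hyT, hy⟩ ⟨⟨T, hT, hxT⟩, hTS hxT⟩
  calc μ (Q.boundaryLayer (j + 2) τ)
      ≤ μ (⋃ S ∈ Q.boundaryFamily j τ, Q.boundaryLayer (j + 2) τ ∩ S) := measure_mono hsub
    _ ≤ ∑' S : Q.boundaryFamily j τ, μ (Q.boundaryLayer (j + 2) τ ∩ S) :=
        measure_biUnion_le μ hcount _
    _ ≤ ∑' S : Q.boundaryFamily j τ, ENNReal.ofReal (boundaryRate d C c ^ 2) * μ S :=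
        ENNReal.tsum_le_tsum fun S =>
          measure_boundaryLayer_inter_le hC hc hμ hl Q j hτ S.2
    _ = ENNReal.ofReal (boundaryRate d C c ^ 2) * μ (Q.boundaryLayer j τ) := by
        rw [ENNReal.tsum_mul_left, boundaryLayer, measure_sUnion hcount]
        · exact (D.pairwiseDisjoint (Q.level + j)).subset fun _ h => h.1
        · exact fun S hS => measurableSet_of_mem_boundaryFamily hS

/-- The small boundary property. -/
theorem measureReal_boundaryLayer_le (hC : 0 < C) (hc : 0 < c) (hμ : IsNiceMeasure C μ)
    (hl : IsLowerRegularIn Set.univ c μ) (Q : D.Cell) (i : ℕ) {τ : ℝ} (hτ0 : 0 ≤ τ)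
    (hτ : 256 ^ i * τ ≤ Q.size) :
    μ.real (Q.boundaryLayer (2 * i) τ) ≤ (boundaryRate d C c ^ 2) ^ i * μ.real Q.carrier := by
  have key : ∀ m ≤ i, μ (Q.boundaryLayer (2 * m) τ)
      ≤ ENNReal.ofReal ((boundaryRate d C c ^ 2) ^ m) * μ Q.carrier := by
    intro m
    induction m with
    | zero =>
      intro _
      simpa using measure_mono (Q.boundaryLayer_subset 0 τ)
    | succ m ih =>
      intro hm
      rw [mul_add, mul_one]
      -- Step m needs 16 · 256^m τ ≤ ℓ(Q), which the hypothesis on 256^i τ gives as long as m < i.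
      refine (measure_boundaryLayer_succ_le hC hc hμ hl Q (2 * m) ?_).trans ?_
      · refine le_trans ?_ hτ
        gcongr
        rw [pow_mul]
        have := pow_pos (show (0 : ℝ) < 256 by norm_num) m
        calc (16 : ℝ) * (16 ^ 2) ^ m = 16 * 256 ^ m := by norm_num
          _ ≤ 256 ^ m * 256 := by linarith
          _ = 256 ^ (m + 1) := (pow_succ _ _).symm
          _ ≤ 256 ^ i := pow_le_pow_right₀ (by norm_num) hm
      · rw [pow_succ (_ ^ 2) m, mul_comm (_ ^ m), ENNReal.ofReal_mul (sq_nonneg _), mul_assoc]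
        gcongr
        exact ih (by omega)
  have h := key i le_rfl
  have hfin := Q.measure_lt_top hμ
  have h' := ENNReal.toReal_mono (ENNReal.mul_lt_top ENNReal.ofReal_lt_top hfin).ne h
  rwa [ENNReal.toReal_mul, ENNReal.toReal_ofReal (by positivity)] at h'

end Cell

end DSLattice

/-! ### Local `L²` estimates -/

theorem integral_norm_sq_eq {α E : Type*} [MeasurableSpace α] [NormedAddCommGroup E]
    [InnerProductSpace ℝ E] {μ : Measure α} {f : α → E} (hf : MemLp f 2 μ) :
    ∫ x, ‖f x‖ ^ 2 ∂μ = (eLpNorm f 2 μ).toReal ^ 2 := by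
  rw [← Lp.norm_toLp f hf, ← real_inner_self_eq_norm_sq, ← integral_inner_eq_inner_toLp hf hf]
  simp_rw [real_inner_self_eq_norm_sq]

theorem setIntegral_sUnion_le {α : Type*} [MeasurableSpace α] {μ : Measure α} {F : Set (Set α)}
    (hF : F.Countable) (hd : F.PairwiseDisjoint id) (hm : ∀ S ∈ F, MeasurableSet S) {f : α → ℝ}
    (hf0 : ∀ x, 0 ≤ f x) (hf : Integrable f μ) {K : ℝ} (hK : 0 ≤ K) (hfin : μ (⋃₀ F) < ∞)
    (h : ∀ S ∈ F, ∫ x in S, f x ∂μ ≤ K * μ.real S) :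
    ∫ x in ⋃₀ F, f x ∂μ ≤ K * μ.real (⋃₀ F) := by
  have h1 : ENNReal.ofReal (∫ x in ⋃₀ F, f x ∂μ) ≤ ENNReal.ofReal K * μ (⋃₀ F) := by
    rw [ofReal_integral_eq_lintegral_ofReal hf.integrableOn (ae_of_all _ hf0),
      measure_sUnion hF hd hm, ← ENNReal.tsum_mul_left, Set.sUnion_eq_biUnion,
      lintegral_biUnion hF hm hd]
    refine ENNReal.tsum_le_tsum fun S => ?_
    rw [← ofReal_integral_eq_lintegral_ofReal hf.integrableOn (ae_of_all _ hf0)]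
    have hS : μ S ≠ ∞ := ((measure_mono (Set.subset_sUnion_of_mem S.2)).trans_lt hfin).ne
    rw [← ENNReal.ofReal_toReal hS, ← ENNReal.ofReal_mul hK]
    exact ENNReal.ofReal_le_ofReal (h S S.2)
  rw [← ENNReal.ofReal_toReal hfin.ne, ← ENNReal.ofReal_mul hK,
    ENNReal.ofReal_le_ofReal_iff (by positivity)] at h1
  exact h1

/-- The constant in the local `L²` bounds for the transforms of cutoffs. -/
noncomputable def localBound (d : ℕ) (C c : ℝ) : ℝ :=
  2 * C ^ 3 * 64 ^ d / c + 32 * (C * 4 ^ (d + 1)) ^ 2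

theorem localBound_pos (d : ℕ) {C c : ℝ} (hC : 0 < C) (hc : 0 < c) : 0 < localBound d C c := by
  unfold localBound; positivity

namespace DSLattice.Cell

variable {d : ℕ} {C c : ℝ} {μ : Measure (Space d)} {D : DSLattice μ} {φ₀ : Space d → ℝ} {ε : ℝ}
  {H : Submodule ℝ (Space d)}

/-- Split φ_Q at the ball of radius 8ℓ(S) about the center of S. The near part is controlled by L²
boundedness and regularity, the far part pointwise by the number of dyadic scales between S and Q,
which is of order 1 + j. -/
theorem setIntegral_rieszRegH_cutoff_le (hφ : IsUnitMollifier φ₀) (hε : 0 < ε) (hC : 0 < C)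
    (hc : 0 < c) (hμ : IsGoodMeasure C μ) (hl : IsLowerRegularIn Set.univ c μ)
    {Q S : D.Cell} (hSQ : S.carrier ⊆ Q.carrier) {j : ℕ} (hj : S.level = Q.level + j)
    {δ : ℝ} (hδ : 0 < δ) :
    ∫ x in S.carrier, ‖rieszRegH H δ μ (Q.cutoff φ₀ ε) x‖ ^ 2 ∂μ
      ≤ localBound d C c * (1 + j) ^ 2 * μ.real S.carrier := by
  have := hμ.1.isLocallyFinite
  have hs := S.size_pos
  have hQS : Q.size = 16 ^ j * S.size := size_of_level hj
  set φ := Q.cutoff φ₀ ε with hφdef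
  have hφi : Integrable φ μ := integrable_cutoff hφ hε Q μ
  set B := ball S.center (8 * S.size) with hB
  have hBm : MeasurableSet B := measurableSet_ball
  set φ₁ := B.indicator φ with hφ₁
  set φ₂ := Bᶜ.indicator φ with hφ₂
  have hi₁ : Integrable φ₁ μ := hφi.indicator hBm
  have hi₂ : Integrable φ₂ μ := hφi.indicator hBm.compl
  have hφ1 := abs_cutoff_le_one hφ hε Q
  have hb₁ : ∀ y, |φ₁ y| ≤ B.indicator 1 y := fun y => by
    by_cases hy : y ∈ B <;> simp [hφ₁, hy, hφdef, hφ1]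
  have hb₁' : ∀ y, |φ₁ y| ≤ 1 := fun y => (hb₁ y).trans (by
    by_cases hy : y ∈ B <;> simp [hy])
  have hb₂ : ∀ y, |φ₂ y| ≤ 1 := fun y => by
    by_cases hy : y ∈ Bᶜ
    · rw [hφ₂, Set.indicator_of_mem hy]; exact hφ1 y
    · rw [hφ₂, Set.indicator_of_notMem hy]; simp
  have hsum : φ = fun y => φ₁ y + φ₂ y := by
    ext y
    exact (congrFun (Set.indicator_self_add_compl B φ) y).symm
  have hm₁ : MemLp φ₁ 2 μ := memLp_two_of_bounded hi₁ hb₁'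
  have hcont := continuous_rieszReg hC.le hμ.1 hi₁ zero_le_one hb₁' hδ
  have hR₁ : MemLp (rieszReg δ μ φ₁) 2 μ := ⟨hcont.aestronglyMeasurable,
    (hμ.2 δ hδ φ₁ hm₁).trans_lt (ENNReal.mul_lt_top ENNReal.ofReal_lt_top hm₁.2)⟩
  have hBfin : μ B < ∞ := (hμ.1 _ _ (by positivity)).trans_lt ENNReal.ofReal_lt_top
  have hμB : μ.real B ≤ C * (8 * S.size) ^ d :=
    ENNReal.toReal_le_of_le_ofReal (by positivity) (hμ.1 _ _ (by positivity))
  have h₁ : ∫ x, ‖rieszReg δ μ φ₁ x‖ ^ 2 ∂μ ≤ C ^ 3 * 64 ^ d / c * μ.real S.carrier := by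
    calc ∫ x, ‖rieszReg δ μ φ₁ x‖ ^ 2 ∂μ = (eLpNorm (rieszReg δ μ φ₁) 2 μ).toReal ^ 2 :=
          integral_norm_sq_eq hR₁
      _ ≤ (C * (eLpNorm φ₁ 2 μ).toReal) ^ 2 := by
          gcongr
          have h := ENNReal.toReal_mono (ENNReal.mul_lt_top ENNReal.ofReal_lt_top hm₁.2).ne
            (hμ.2 δ hδ φ₁ hm₁)
          rwa [ENNReal.toReal_mul, ENNReal.toReal_ofReal hC.le] at h
      _ = C ^ 2 * ∫ x, ‖φ₁ x‖ ^ 2 ∂μ := by rw [mul_pow, integral_norm_sq_eq hm₁]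
      _ ≤ C ^ 2 * ∫ x, B.indicator 1 x ∂μ := by
          have hone : Integrable (B.indicator (1 : Space d → ℝ)) μ :=
            (integrable_indicator_iff hBm).2 (integrableOn_const hBfin.ne)
          refine mul_le_mul_of_nonneg_left (integral_mono (integrable_norm_sq hm₁) hone
            fun x => ?_) (sq_nonneg _)
          simp only [Real.norm_eq_abs]
          calc |φ₁ x| ^ 2 ≤ |φ₁ x| := pow_le_of_le_one (abs_nonneg _) (hb₁' x) two_ne_zero
            _ ≤ _ := hb₁ x
      _ = C ^ 2 * μ.real B := by rw [integral_indicator_one hBm]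
      _ ≤ C ^ 2 * (C * (8 * S.size) ^ d) := by gcongr
      _ = C ^ 3 * 8 ^ d * S.size ^ d := by rw [mul_pow]; ring
      _ ≤ C ^ 3 * 8 ^ d * (8 ^ d / c * μ.real S.carrier) := by
          gcongr
          exact S.pow_size_le hc hμ.1 hl
      _ = _ := by rw [show (64 : ℝ) = 8 * 8 by norm_num, mul_pow]; ring
  have h₂ : ∀ x ∈ S.carrier, ‖rieszReg δ μ φ₂ x‖ ≤ 1 * (C * 4 ^ (d + 1) * (4 * (1 + j))) := by
    intro x hx
    have hsupp : ∀ y, φ₂ y ≠ 0 → y ∉ B ∧ y ∈ Q.carrier := fun y hy => by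
      have hyB : y ∈ Bᶜ := by
        by_contra hn
        exact hy (Set.indicator_of_notMem hn _)
      rw [hφ₂, Set.indicator_of_mem hyB] at hy
      exact ⟨hyB, mem_of_cutoff_ne_zero hφ hε hy⟩
    -- The gap is 8ℓ(S) - 4ℓ(S), and 2^(4j+1) · 4ℓ(S) = 8ℓ(Q) bounds the distances within Q.
    refine (norm_rieszReg_le_of_far hC.le hμ.1 zero_le_one hb₂ hδ (r := 4 * S.size)
      (by positivity) (4 * j + 1) x (fun y hy => ?_) (fun y hy => ?_)).trans ?_
    · have h1 := (hsupp y hy).1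
      rw [hB, mem_ball, not_lt] at h1
      have h2 := mem_ball.1 (S.carrier_subset_ball hx)
      have h3 := dist_triangle y x S.center
      rw [← dist_eq_norm, dist_comm x y]
      linarith
    · refine (dist_lt (hSQ hx) (hsupp y hy).2).trans_le (le_of_eq ?_)
      rw [hQS, pow_succ, pow_mul]
      norm_num
      ring
    · push_cast
      gcongr
      linarith
  have hpt : ∀ x ∈ S.carrier, ‖rieszRegH H δ μ φ x‖ ^ 2
      ≤ 2 * ‖rieszReg δ μ φ₁ x‖ ^ 2 + 32 * (C * 4 ^ (d + 1)) ^ 2 * (1 + j) ^ 2 := by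
    intro x hx
    have h1 : ‖rieszRegH H δ μ φ x‖ ≤ ‖rieszReg δ μ φ₁ x‖ + ‖rieszReg δ μ φ₂ x‖ := by
      refine (norm_rieszRegH_le H hφi hδ x).trans ?_
      rw [hsum, rieszReg_add hi₁ hi₂ hδ]
      exact norm_add_le _ _
    have h3 := h₂ x hx
    calc ‖rieszRegH H δ μ φ x‖ ^ 2 ≤ (‖rieszReg δ μ φ₁ x‖ + ‖rieszReg δ μ φ₂ x‖) ^ 2 := by gcongr
      _ ≤ 2 * (‖rieszReg δ μ φ₁ x‖ ^ 2 + ‖rieszReg δ μ φ₂ x‖ ^ 2) := add_sq_le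
      _ ≤ 2 * (‖rieszReg δ μ φ₁ x‖ ^ 2 + (1 * (C * 4 ^ (d + 1) * (4 * (1 + j)))) ^ 2) := by
          gcongr
      _ = _ := by ring
  have hSfin := S.measure_lt_top hμ.1
  have hi : IntegrableOn (fun x => 2 * ‖rieszReg δ μ φ₁ x‖ ^ 2) S.carrier μ :=
    ((integrable_norm_sq hR₁).const_mul 2).integrableOn
  have hRi := integrable_norm_sq (hμ.memLp_rieszRegH hC.le H hφi zero_le_one hφ1 hδ)
  calc ∫ x in S.carrier, ‖rieszRegH H δ μ φ x‖ ^ 2 ∂μ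
      ≤ ∫ x in S.carrier, (2 * ‖rieszReg δ μ φ₁ x‖ ^ 2
          + 32 * (C * 4 ^ (d + 1)) ^ 2 * (1 + j) ^ 2) ∂μ :=
        setIntegral_mono_on hRi.integrableOn
          (hi.add (integrableOn_const hSfin.ne)) S.measurableSet hpt
    _ = 2 * ∫ x in S.carrier, ‖rieszReg δ μ φ₁ x‖ ^ 2 ∂μ
          + 32 * (C * 4 ^ (d + 1)) ^ 2 * (1 + j) ^ 2 * μ.real S.carrier := by
        rw [integral_add hi (integrableOn_const hSfin.ne), integral_const_mul, setIntegral_const,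
          smul_eq_mul, mul_comm (μ.real _)]
    _ ≤ 2 * (C ^ 3 * 64 ^ d / c * μ.real S.carrier)
          + 32 * (C * 4 ^ (d + 1)) ^ 2 * (1 + j) ^ 2 * μ.real S.carrier := by
        gcongr
        exact (setIntegral_le_integral (integrable_norm_sq hR₁)
          (ae_of_all _ fun x => sq_nonneg _)).trans h₁
    _ ≤ 2 * (C ^ 3 * 64 ^ d / c * μ.real S.carrier) * (1 + j) ^ 2
          + 32 * (C * 4 ^ (d + 1)) ^ 2 * (1 + j) ^ 2 * μ.real S.carrier := by
        refine add_le_add ?_ le_rfl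
        refine le_mul_of_one_le_right (by positivity) (one_le_pow₀ ?_)
        linarith [(Nat.cast_nonneg j : (0 : ℝ) ≤ j)]
    _ = _ := by unfold localBound; ring

/-- `R^H_μ φ_Q - R^H ν_Q`. -/
noncomputable def field (φ₀ : Space d → ℝ) (ε : ℝ) (H : Submodule ℝ (Space d)) (Q : D.Cell)
    (x : Space d) : Space d :=
  rieszMu H μ (Q.cutoff φ₀ ε) x - Q.rieszApprox φ₀ ε H x

theorem summand_eq (Q : D.Cell) (x : Space d) :
    Q.summand φ₀ ε H x = Q.cutoff φ₀ ε x • Q.field φ₀ ε H x := rfl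

/-- On a union of subcells that are not too small, the `L²` norm of `R^H_μ φ_Q` is controlled by
the measure. -/
theorem setIntegral_rieszMu_sq_le (hφ : IsUnitMollifier φ₀) (hε : 0 < ε) (hC : 0 < C)
    (hc : 0 < c) (hμ : IsGoodMeasure C μ) (hl : IsLowerRegularIn Set.univ c μ)
    {Q : D.Cell} (hex : Q.SummandExists φ₀ ε H) {F : Set (Set (Space d))} {n : ℤ} {m : ℕ}
    (hn : Q.level ≤ n) (hnm : n ≤ Q.level + m) (hF : F ⊆ D.cells n)
    (hFQ : ∀ S ∈ F, S ⊆ Q.carrier) :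
    ∫ x in ⋃₀ F, ‖rieszMu H μ (Q.cutoff φ₀ ε) x‖ ^ 2 ∂μ
      ≤ localBound d C c * (1 + m) ^ 2 * μ.real (⋃₀ F) := by
  have := hμ.1.isLocallyFinite
  obtain ⟨j, rfl⟩ := Int.le.dest hn
  have hjm : j ≤ m := by omega
  have hK := localBound_pos d hC hc
  have hcount : F.Countable := (D.countable_cells _).mono hF
  have hmeas : ∀ S ∈ F, MeasurableSet S := fun S hS => D.measurableSet _ _ (hF hS)
  have hR : ∀ δ > 0, MemLp (rieszRegH H δ μ (Q.cutoff φ₀ ε)) 2 μ := fun δ hδ =>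
    hμ.memLp_rieszRegH hC.le H (integrable_cutoff hφ hε Q μ) zero_le_one
      (abs_cutoff_le_one hφ hε Q) hδ
  -- Lower semicontinuity is applied to the whole union, so that only regularized transforms have to
  -- be estimated cell by cell.
  refine hex.2.2.1.setIntegral_norm_sq_le (MeasurableSet.sUnion hcount hmeas) hR fun δ hδ => ?_
  refine setIntegral_sUnion_le hcount ((D.pairwiseDisjoint _).subset hF) hmeas
    (fun x => sq_nonneg _) (integrable_norm_sq (hR δ hδ)) (by positivity)
    ((measure_mono (Set.sUnion_subset hFQ)).trans_lt (Q.measure_lt_top hμ.1)) fun S hS => ?_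
  refine (setIntegral_rieszRegH_cutoff_le hφ hε hC hc hμ hl (S := ⟨Q.level + j, S, hF hS⟩)
    (hFQ S hS) rfl hδ).trans ?_
  gcongr

/-- The transform of the approximating measure is bounded by a logarithm of `ε`. -/
theorem norm_rieszApprox_le (hφ : IsUnitMollifier φ₀) (hε : 0 < ε) (hε' : ε < 1 / 48)
    (hd : 1 ≤ d) (hH : Module.finrank ℝ H = d) (hC : 0 ≤ C) (hμ : IsNiceMeasure C μ)
    {Q : D.Cell} {c₀ : ℝ} (hc₀ : 0 < c₀)
    (hL : ∀ x x', |Q.cutoff φ₀ ε x - Q.cutoff φ₀ ε x'| ≤ c₀ / (ε * Q.size) * ‖x - x'‖)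
    {n : ℕ} (hn : 8 ≤ 2 ^ n * ε) {x : Space d} (hx : x ∈ Q.carrier) :
    ‖Q.rieszApprox φ₀ ε H x‖ ≤ factorBound d C * unitBallVolume d * 4 ^ (d + 1) * (n + 1 + c₀) := by
  have hs := Q.size_pos
  have hΔ : 0 < ε * Q.size := mul_pos hε hs
  have hν := isNiceMeasure_planeMeasure hd hH Q.center
  have hi := integrable_approxDensity hφ hε hd hH Q
  have hA := factorBound_nonneg d hC
  have hb := abs_approxDensity_le hφ hε hε' hd hH hC hμ Q
  -- The density of ν_Q is Lipschitz on the scale εℓ(Q): removing the regularization at that scale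
  -- costs O(1), and the regularized transform sees only n + 1 dyadic scales.
  have h1 := norm_rieszPtw_sub_le hd hH Q.center hi (by positivity)
    (abs_approxDensity_sub_le hφ hε hε' hd hH hC hμ Q hL) hΔ x
  have h2 : ‖rieszRegH H (ε * Q.size) (planeMeasure H Q.center) (Q.approxDensity φ₀ ε H) x‖
      ≤ factorBound d C * (unitBallVolume d * 4 ^ (d + 1) * (n + 1)) := by
    refine (norm_rieszRegH_le H hi hΔ x).trans
      (norm_rieszReg_le_of_support_subset (unitBallVolume_pos d).le hν hA hb hΔ n x
        fun y hy => ?_)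
    have hy' : Q.cutoff φ₀ ε y ≠ 0 := fun h => hy (by rw [approxDensity, h, mul_zero])
    refine (dist_lt hx (mem_of_cutoff_ne_zero hφ hε hy')).trans_le ?_
    rw [← mul_assoc]
    gcongr
  rw [rieszApprox]
  have h3 := norm_le_norm_sub_add (rieszPtw H (planeMeasure H Q.center) (Q.approxDensity φ₀ ε H) x)
    (rieszRegH H (ε * Q.size) (planeMeasure H Q.center) (Q.approxDensity φ₀ ε H) x)
  refine (h3.trans (add_le_add h1 h2)).trans (le_of_eq ?_)
  field_simp
  ring

theorem continuous_rieszApprox (hφ : IsUnitMollifier φ₀) (hε : 0 < ε) (hε' : ε < 1 / 48)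
    (hd : 1 ≤ d) (hH : Module.finrank ℝ H = d) (hC : 0 ≤ C) (hμ : IsNiceMeasure C μ)
    (Q : D.Cell) : Continuous (Q.rieszApprox φ₀ ε H) := by
  obtain ⟨c₀, hc₀, hL⟩ := exists_cutoff_lipschitz hφ
  have hs := Q.size_pos
  exact continuous_rieszPtw hd hH Q.center (integrable_approxDensity hφ hε hd hH Q)
    (mul_nonneg (factorBound_nonneg d hC) (by positivity))
    (abs_approxDensity_sub_le hφ hε hε' hd hH hC hμ Q (hL μ D Q ε hε)) (factorBound_nonneg d hC)
    (abs_approxDensity_le hφ hε hε' hd hH hC hμ Q)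

/-- The fields of cells are square integrable on the cells. -/
theorem memLp_field_restrict (hφ : IsUnitMollifier φ₀) (hε : 0 < ε) (hε' : ε < 1 / 48)
    (hd : 1 ≤ d) (hH : Module.finrank ℝ H = d) (hC : 0 ≤ C) (hμ : IsNiceMeasure C μ)
    {Q : D.Cell} (hex : Q.SummandExists φ₀ ε H) :
    MemLp (Q.field φ₀ ε H) 2 (μ.restrict Q.carrier) := by
  have hcont := continuous_rieszApprox hφ hε hε' hd hH hC hμ Q
  have : IsFiniteMeasure (μ.restrict Q.carrier) :=
    ⟨by rw [Measure.restrict_apply_univ]; exact Q.measure_lt_top hμ⟩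
  obtain ⟨M, hM⟩ := (isCompact_closedBall Q.center (4 * Q.size)).exists_bound_of_continuousOn
    hcont.continuousOn
  refine (hex.2.2.1.1.restrict _).sub (MemLp.of_bound hcont.aestronglyMeasurable M ?_)
  refine (ae_restrict_iff' Q.measurableSet).2 (ae_of_all _ fun x hx => ?_)
  exact hM x (ball_subset_closedBall (Q.carrier_subset_ball hx))

/-- Local `L²` bound for the fields. -/
theorem setIntegral_field_sq_le (hφ : IsUnitMollifier φ₀) (hε : 0 < ε) (hε' : ε < 1 / 48)
    (hd : 1 ≤ d) (hH : Module.finrank ℝ H = d) (hC : 0 < C)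
    (hc : 0 < c) (hμ : IsGoodMeasure C μ) (hl : IsLowerRegularIn Set.univ c μ)
    {Q : D.Cell} (hex : Q.SummandExists φ₀ ε H) {F : Set (Set (Space d))} {n : ℤ} {m : ℕ}
    (hn : Q.level ≤ n) (hnm : n ≤ Q.level + m) (hF : F ⊆ D.cells n)
    (hFQ : ∀ S ∈ F, S ⊆ Q.carrier) {M : ℝ}
    (hM : ∀ x ∈ Q.carrier, ‖Q.rieszApprox φ₀ ε H x‖ ≤ M) :
    ∫ x in ⋃₀ F, ‖Q.field φ₀ ε H x‖ ^ 2 ∂μ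
      ≤ (2 * localBound d C c * (1 + m) ^ 2 + 2 * M ^ 2) * μ.real (⋃₀ F) := by
  have hcount : F.Countable := (D.countable_cells _).mono hF
  have hmeas : MeasurableSet (⋃₀ F) :=
    MeasurableSet.sUnion hcount fun S hS => D.measurableSet _ _ (hF hS)
  have hsub : ⋃₀ F ⊆ Q.carrier := Set.sUnion_subset hFQ
  have hfin : μ (⋃₀ F) < ∞ := (measure_mono hsub).trans_lt (Q.measure_lt_top hμ.1)
  have hi1 : IntegrableOn (fun x => ‖Q.field φ₀ ε H x‖ ^ 2) (⋃₀ F) μ :=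
    (IntegrableOn.mono_set (s := ⋃₀ F) (t := Q.carrier)
      (integrable_norm_sq (memLp_field_restrict hφ hε hε' hd hH hC.le hμ.1 hex)) hsub)
  have hi2 : IntegrableOn (fun x => 2 * ‖rieszMu H μ (Q.cutoff φ₀ ε) x‖ ^ 2) (⋃₀ F) μ :=
    ((integrable_norm_sq hex.2.2.1.1).const_mul 2).integrableOn
  calc ∫ x in ⋃₀ F, ‖Q.field φ₀ ε H x‖ ^ 2 ∂μ
      ≤ ∫ x in ⋃₀ F, (2 * ‖rieszMu H μ (Q.cutoff φ₀ ε) x‖ ^ 2 + 2 * M ^ 2) ∂μ := by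
        refine setIntegral_mono_on hi1 (hi2.add (integrableOn_const hfin.ne)) hmeas fun x hx => ?_
        have h1 : ‖Q.field φ₀ ε H x‖ ≤ ‖rieszMu H μ (Q.cutoff φ₀ ε) x‖ + M :=
          (norm_sub_le _ _).trans (by gcongr; exact hM x (hsub hx))
        calc _ ≤ (‖rieszMu H μ (Q.cutoff φ₀ ε) x‖ + M) ^ 2 := by gcongr
          _ ≤ 2 * (‖rieszMu H μ (Q.cutoff φ₀ ε) x‖ ^ 2 + M ^ 2) := add_sq_le
          _ = _ := by ring
    _ = 2 * ∫ x in ⋃₀ F, ‖rieszMu H μ (Q.cutoff φ₀ ε) x‖ ^ 2 ∂μ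
          + 2 * M ^ 2 * μ.real (⋃₀ F) := by
        rw [integral_add hi2 (integrableOn_const hfin.ne), integral_const_mul, setIntegral_const,
          smul_eq_mul, mul_comm (μ.real _)]
    _ ≤ 2 * (localBound d C c * (1 + m) ^ 2 * μ.real (⋃₀ F)) + 2 * M ^ 2 * μ.real (⋃₀ F) := by
        gcongr
        exact setIntegral_rieszMu_sq_le hφ hε hC hc hμ hl hex hn hnm hF hFQ
    _ = _ := by ring

/-- The same bound on the intersection of the cell with a union of cells of a possibly lower
level. -/
theorem setIntegral_field_sq_inter_le (hφ : IsUnitMollifier φ₀) (hε : 0 < ε) (hε' : ε < 1 / 48)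
    (hd : 1 ≤ d) (hH : Module.finrank ℝ H = d) (hC : 0 < C)
    (hc : 0 < c) (hμ : IsGoodMeasure C μ) (hl : IsLowerRegularIn Set.univ c μ)
    {Q : D.Cell} (hex : Q.SummandExists φ₀ ε H) {F : Set (Set (Space d))} {n : ℤ} {m : ℕ}
    (hnm : n ≤ Q.level + m) (hF : F ⊆ D.cells n) {M : ℝ}
    (hM : ∀ x ∈ Q.carrier, ‖Q.rieszApprox φ₀ ε H x‖ ≤ M) :
    ∫ x in ⋃₀ F ∩ Q.carrier, ‖Q.field φ₀ ε H x‖ ^ 2 ∂μ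
      ≤ (2 * localBound d C c * (1 + m) ^ 2 + 2 * M ^ 2) * μ.real (⋃₀ F ∩ Q.carrier) := by
  -- Cells of level at least that of Q are either inside Q or disjoint from it. If the level is
  -- smaller, the intersection is empty or all of Q, and Q itself is taken as the only cell.
  rcases le_or_gt Q.level n with hn | hn
  · have e : ⋃₀ F ∩ Q.carrier = ⋃₀ {S | S ∈ F ∧ S ⊆ Q.carrier} := by
      ext x
      constructor
      · rintro ⟨⟨S, hS, hxS⟩, hxQ⟩
        exact ⟨S, ⟨hS, subset_of_level_le hn (hF hS) Q.mem_cells hxS hxQ⟩, hxS⟩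
      · rintro ⟨S, ⟨hS, hSQ⟩, hxS⟩
        exact ⟨⟨S, hS, hxS⟩, hSQ hxS⟩
    rw [e]
    exact setIntegral_field_sq_le hφ hε hε' hd hH hC hc hμ hl hex hn hnm (fun S hS => hF hS.1)
      (fun S hS => hS.2) hM
  · rcases (⋃₀ F ∩ Q.carrier).eq_empty_or_nonempty with h0 | ⟨x, ⟨S, hS, hxS⟩, hxQ⟩
    · simp [h0]
    · have hQS : Q.carrier ⊆ S := subset_of_level_le hn.le Q.mem_cells (hF hS) hxQ hxS
      have e : ⋃₀ F ∩ Q.carrier = ⋃₀ {Q.carrier} := by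
        rw [Set.sUnion_singleton]
        exact Set.inter_eq_right.2 (hQS.trans (Set.subset_sUnion_of_mem hS))
      rw [e]
      exact setIntegral_field_sq_le hφ hε hε' hd hH hC hc hμ hl hex le_rfl (by omega)
        (by simpa using Q.mem_cells) (by simp) hM

end DSLattice.Cell

namespace DSLattice.Cell

variable {d : ℕ} {C c : ℝ} {μ : Measure (Space d)} {D : DSLattice μ} {φ₀ : Space d → ℝ} {ε : ℝ}
  {H : Submodule ℝ (Space d)}

/-! ### Flatness and the approximating measures -/

/-- On flat cells the measures `φ_Q μ` and `ν_Q` are close in the dual Lipschitz norm. -/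
theorem abs_integral_cutoff_sub_le (hφ : IsUnitMollifier φ₀) (hε : 0 < ε) (hε' : ε < 1 / 48)
    (hd : 1 ≤ d) (hH : Module.finrank ℝ H = d) (hμ : IsNiceMeasure C μ)
    {Q : D.Cell} {c₀ : ℝ} (hc₀ : 0 < c₀)
    (hL : ∀ x x', |Q.cutoff φ₀ ε x - Q.cutoff φ₀ ε x'| ≤ c₀ / (ε * Q.size) * ‖x - x'‖)
    {A α : ℝ} (hA : 5 < A) (hflat : Q.IsFlat H A α) {g : Space d → ℝ} {G : ℝ} (hG : 0 < G)
    (hg : ∀ x y, |g x - g y| ≤ G * ‖x - y‖) :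
    |∫ y, Q.cutoff φ₀ ε y * g y ∂μ
        - ∫ y, Q.approxDensity φ₀ ε H y * g y ∂(planeMeasure H Q.center)|
      ≤ α * Q.size ^ (d + 1) * (G * (1 + 8 * c₀ / ε)) := by
  have hs := Q.size_pos
  set m := planeMeasure H Q.center with hm
  have hlf := (isNiceMeasure_planeMeasure hd hH Q.center).isLocallyFinite
  have hlfμ := hμ.isLocallyFinite
  set φ := Q.cutoff φ₀ ε with hφdef
  have hφc : Continuous φ := continuous_cutoff hφ hε Q
  have hφs : HasCompactSupport φ := hasCompactSupport_cutoff hφ hε Q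
  have hφ1 : ∀ y, |φ y| ≤ 1 := abs_cutoff_le_one hφ hε Q
  have hφ0 : ∀ y, 0 ≤ φ y := cutoff_nonneg hφ hε Q
  have hgc : Continuous g := by
    refine (LipschitzWith.of_dist_le_mul (K := ⟨G, hG.le⟩) fun x y => ?_).continuous
    rw [Real.dist_eq, dist_eq_norm]
    exact hg x y
  have hφgμ : Integrable (fun y => φ y * g y) μ :=
    (hφc.mul hgc).integrable_of_hasCompactSupport hφs.mul_right
  have hφgm : Integrable (fun y => φ y * g y) m :=
    (hφc.mul hgc).integrable_of_hasCompactSupport hφs.mul_right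
  have hφμ : Integrable φ μ := hφc.integrable_of_hasCompactSupport hφs
  have hφm : Integrable φ m := hφc.integrable_of_hasCompactSupport hφs
  have hpos : 0 < ∫ y, φ y ∂m := integral_cutoff_plane_pos hφ hε hε' hd hH Q
  -- The φ-weighted mean of g on the plane makes φ(g - κ) integrate to zero there. On the other
  -- side, κ ∫ φ dμ is exactly ∫ g dν_Q by the choice of a_Q.
  set κ := (∫ y, φ y ∂m)⁻¹ * ∫ y, φ y * g y ∂m with hκ
  have hκg : ∀ x ∈ Q.carrier, |g x - κ| ≤ 8 * Q.size * G := by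
    intro x hx
    have e : g x - κ = (∫ y, φ y ∂m)⁻¹ * ∫ y, φ y * (g x - g y) ∂m := by
      simp_rw [mul_sub]
      rw [integral_sub (hφm.mul_const _) hφgm, integral_mul_const, mul_sub, ← mul_assoc,
        inv_mul_cancel₀ hpos.ne', one_mul]
    rw [e, abs_mul, abs_of_pos (inv_pos.2 hpos), inv_mul_le_iff₀ hpos, ← integral_mul_const]
    refine (abs_integral_le_integral_abs).trans (integral_mono_of_nonneg
      (ae_of_all _ fun y => abs_nonneg _) (hφm.mul_const _) (ae_of_all _ fun y => ?_))
    simp only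
    rw [abs_mul, abs_of_nonneg (hφ0 y)]
    by_cases hy : φ y = 0
    · simp [hy]
    · have := dist_lt hx (mem_of_cutoff_ne_zero hφ hε hy)
      refine mul_le_mul_of_nonneg_left ((hg x y).trans ?_) (hφ0 y)
      rw [mul_comm]
      gcongr
  set Λ := G * (1 + 8 * c₀ / ε) with hΛ
  have hΛ0 : 0 < Λ := by positivity
  set f₀ : Space d → ℝ := fun y => φ y * (g y - κ) with hf₀
  have hmul : 8 * Q.size * G * (c₀ / (ε * Q.size)) + G = Λ := by
    rw [hΛ]; field_simp; ring
  have hlip1 : ∀ x ∈ Q.carrier, ∀ y, |f₀ x - f₀ y| ≤ Λ * ‖x - y‖ := by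
    intro x hx y
    have e : f₀ x - f₀ y = (g x - κ) * (φ x - φ y) + φ y * (g x - g y) := by
      simp only [hf₀]; ring
    rw [e, ← hmul, add_mul]
    refine (abs_add_le _ _).trans (add_le_add ?_ ?_)
    · rw [abs_mul, mul_assoc]
      exact mul_le_mul (hκg x hx) (hL x y) (abs_nonneg _) (by positivity)
    · rw [abs_mul]
      exact (mul_le_of_le_one_left (abs_nonneg _) (hφ1 y)).trans (hg x y)
  have hlip : ∀ x y, |f₀ x - f₀ y| ≤ Λ * ‖x - y‖ := by
    intro x y
    by_cases hx : x ∈ Q.carrier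
    · exact hlip1 x hx y
    · by_cases hy : y ∈ Q.carrier
      · rw [abs_sub_comm, norm_sub_rev]
        exact hlip1 y hy x
      · simp only [hf₀, hφdef, cutoff_eq_zero_of_notMem hφ hε hx,
          cutoff_eq_zero_of_notMem hφ hε hy]
        simp
        positivity
  -- Flatness tests functions with Lipschitz constant 1/ℓ supported in B(z_Q, Aℓ). Rescaling secures
  -- the first; the second holds because Q ⊂ B(z_Q, 4ℓ) and A > 5.
  set f₁ : Space d → ℝ := fun y => (Q.size * Λ)⁻¹ * f₀ y with hf₁
  have hflat' := hflat.2 f₁ ?_ ?_ ?_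
  · have e : ∫ y, f₁ y ∂μ = (Q.size * Λ)⁻¹ * (∫ y, φ y * g y ∂μ
        - ∫ y, Q.approxDensity φ₀ ε H y * g y ∂m) := by
      simp only [hf₁, hf₀, mul_sub (φ _)]
      rw [integral_const_mul, integral_sub hφgμ (hφμ.mul_const κ), integral_mul_const]
      congr 2
      simp only [approxDensity, normFactor, ← hφdef, ← hm, mul_assoc]
      rw [integral_const_mul, integral_const_mul, hκ]
      ring
    rw [e, abs_mul, abs_of_pos (by positivity), inv_mul_le_iff₀ (by positivity)] at hflat'
    refine hflat'.trans (le_of_eq ?_)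
    ring
  · refine (closure_mono ?_).trans ((tsupport_cutoff_subset_carrier hφ hε Q).trans
      (Q.carrier_subset_ball.trans (ball_subset_ball ?_)))
    · intro y hy h
      refine hy ?_
      simp only [hf₁, hf₀]
      rw [show φ y = 0 from h]
      simp
    · gcongr
      linarith
  · refine LipschitzWith.of_dist_le_mul fun x y => ?_
    rw [Real.dist_eq, dist_eq_norm, Real.coe_toNNReal _ (by positivity)]
    simp only [hf₁]
    rw [← mul_sub, abs_mul, abs_of_pos (by positivity), inv_mul_le_iff₀ (by positivity)]
    refine (hlip x y).trans (le_of_eq ?_)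
    field_simp
  · simp only [hf₁, hf₀, mul_sub (φ _)]
    rw [integral_const_mul, integral_sub hφgm (hφm.mul_const κ), integral_mul_const, hκ,
      ← mul_assoc (∫ y, φ y ∂m), mul_inv_cancel₀ hpos.ne', one_mul, sub_self, mul_zero]

/-- On flat cells the regularized transforms of `φ_Q μ` and `ν_Q` are close. -/
theorem norm_rieszRegH_cutoff_sub_le (hφ : IsUnitMollifier φ₀) (hε : 0 < ε) (hε' : ε < 1 / 48)
    (hd : 1 ≤ d) (hH : Module.finrank ℝ H = d) (hμ : IsNiceMeasure C μ)
    {Q : D.Cell} {c₀ : ℝ} (hc₀ : 0 < c₀)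
    (hL : ∀ x x', |Q.cutoff φ₀ ε x - Q.cutoff φ₀ ε x'| ≤ c₀ / (ε * Q.size) * ‖x - x'‖)
    {A α : ℝ} (hα : 0 < α) (hA : 5 < A) (hflat : Q.IsFlat H A α) {Δ : ℝ} (hΔ : 0 < Δ)
    (x : Space d) :
    ‖rieszRegH H Δ μ (Q.cutoff φ₀ ε) x
        - rieszRegH H Δ (planeMeasure H Q.center) (Q.approxDensity φ₀ ε H) x‖
      ≤ α * Q.size ^ (d + 1) * (2 * (d + 2) * (Δ ^ (d + 1))⁻¹ * (1 + 8 * c₀ / ε)) := by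
  have hs := Q.size_pos
  have hlfμ := hμ.isLocallyFinite
  have hi1 := integrable_smul_rieszKernelH H (integrable_cutoff hφ hε Q μ) hΔ x
  have hi2 := integrable_smul_rieszKernelH H
    (integrable_approxDensity (H := H) hφ hε hd hH Q) hΔ x
  set v := rieszRegH H Δ μ (Q.cutoff φ₀ ε) x
    - rieszRegH H Δ (planeMeasure H Q.center) (Q.approxDensity φ₀ ε H) x with hv
  rcases eq_or_ne v 0 with h0 | h0
  · rw [h0, norm_zero]; positivity
  have hvpos : 0 < ‖v‖ := norm_pos_iff.2 h0
  -- Pairing with the direction of the difference turns its norm into the integral of a scalar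
  -- Lipschitz function against φ_Q μ - ν_Q.
  set e : Space d := ‖v‖⁻¹ • v with he
  have he1 : ‖e‖ = 1 := by
    rw [he, norm_smul, norm_inv, norm_norm, inv_mul_cancel₀ hvpos.ne']
  have hev : ‖v‖ = inner ℝ e v := by
    rw [he, real_inner_smul_left, real_inner_self_eq_norm_sq]
    field_simp
  set g : Space d → ℝ := fun y => inner ℝ e (H.starProjection (rieszKernel Δ (x - y))) with hg
  have h := abs_integral_cutoff_sub_le hφ hε hε' hd hH hμ hc₀ hL hA hflat (g := g)
    (G := 2 * (d + 2) * (Δ ^ (d + 1))⁻¹) (by positivity) fun y y' => ?_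
  · have e1 : ‖v‖ = ∫ y, Q.cutoff φ₀ ε y * g y ∂μ
        - ∫ y, Q.approxDensity φ₀ ε H y * g y ∂(planeMeasure H Q.center) := by
      rw [hev, hv, inner_sub_right, rieszRegH, rieszRegH, ← integral_inner (𝕜 := ℝ) hi1,
        ← integral_inner (𝕜 := ℝ) hi2]
      simp only [real_inner_smul_right, hg]
    rw [e1]
    exact (le_abs_self _).trans h
  · simp only [hg]
    rw [← inner_sub_right, ← map_sub]
    refine (abs_real_inner_le_norm _ _).trans ?_
    rw [he1, one_mul]
    refine (H.norm_starProjection_apply_le _).trans ((norm_rieszKernel_sub_le' hΔ _ _).trans ?_)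
    rw [sub_sub_sub_cancel_left, norm_sub_rev]

/-! ### Pairing a field with a Lipschitz function -/

/-- The pairing of the field of a flat cell with `θ Ψ`, where `Ψ` is Lipschitz and `θ` is a cutoff
supported well inside the cell, is small. -/
theorem abs_integral_inner_field_le (hφ : IsUnitMollifier φ₀) (hε : 0 < ε) (hε' : ε < 1 / 48)
    (hd : 1 ≤ d) (hH : Module.finrank ℝ H = d) (hC : 0 < C) (hμ : IsGoodMeasure C μ)
    {Q : D.Cell} (hex : Q.SummandExists φ₀ ε H) {c₀ : ℝ} (hc₀ : 0 < c₀)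
    (hL : ∀ x x', |Q.cutoff φ₀ ε x - Q.cutoff φ₀ ε x'| ≤ c₀ / (ε * Q.size) * ‖x - x'‖)
    {A α : ℝ} (hα : 0 < α) (hA : 5 < A) (hflat : Q.IsFlat H A α) {Δ : ℝ} (hΔ : 0 < Δ)
    {U : Set (Space d)} (hU : MeasurableSet U) (hUQ : U ⊆ Q.carrier)
    (hUφ : ∀ x ∈ U, Q.cutoff φ₀ ε x = 1)
    {θ : Space d → ℝ} (hθ0 : ∀ x, 0 ≤ θ x) (hθ1 : ∀ x, θ x ≤ 1) (hθc : Continuous θ) {Lθ : ℝ}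
    (hLθ : 0 ≤ Lθ)
    (hθL : ∀ x y, |θ x - θ y| ≤ Lθ * ‖x - y‖)
    (hθU : ∀ x y, θ x ≠ 0 → ‖x - y‖ < Δ → y ∈ U)
    {Ψ : Space d → Space d} (hΨc : Continuous Ψ) {Λ : ℝ} (hΛ : 0 ≤ Λ)
    (hΨ : ∀ x y, ‖Ψ x - Ψ y‖ ≤ Λ * ‖x - y‖) :
    |∫ x, inner ℝ (θ x • Ψ x) (Q.field φ₀ ε H x) ∂μ|
      ≤ C * 4 ^ (d + 1) * Δ * (Λ * μ.real Q.carrier + Lθ * ∫ x in U, ‖Ψ x‖ ∂μ)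
        + (α * Q.size ^ (d + 1) * (2 * (d + 2) * (Δ ^ (d + 1))⁻¹ * (1 + 8 * c₀ / ε))
          + factorBound d C * (c₀ / (ε * Q.size)) * (unitBallVolume d * 4 ^ (d + 1) * Δ))
          * ∫ x in U, ‖Ψ x‖ ∂μ := by
  have hlfμ := hμ.1.isLocallyFinite
  have hs := Q.size_pos
  have hφi := integrable_cutoff hφ hε Q μ
  have hQfin := Q.measure_lt_top hμ.1
  have hUfin : μ U < ∞ := (measure_mono hUQ).trans_lt hQfin
  have hR : ∀ δ > 0, MemLp (rieszRegH H δ μ (Q.cutoff φ₀ ε)) 2 μ := fun δ hδ =>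
    hμ.memLp_rieszRegH hC.le H hφi zero_le_one (abs_cutoff_le_one hφ hε Q) hδ
  set g : Space d → Space d := fun x => θ x • Ψ x with hgdef
  have hgc : Continuous g := hθc.smul hΨc
  have hθU' : ∀ x, θ x ≠ 0 → x ∈ U := fun x hx => hθU x x hx (by simpa using hΔ)
  have hgsupp : HasCompactSupport g := by
    refine HasCompactSupport.intro (isCompact_closedBall Q.center (4 * Q.size)) fun x hx => ?_
    have : θ x = 0 := by
      by_contra h
      exact hx (ball_subset_closedBall (Q.carrier_subset_ball (hUQ (hθU' x h))))
    simp [hgdef, this]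
  have hgi : Integrable g μ := hgc.integrable_of_hasCompactSupport hgsupp
  have hg2 : MemLp g 2 μ := hgc.memLp_of_hasCompactSupport hgsupp
  have hΨU : IntegrableOn (fun x => ‖Ψ x‖) U μ :=
    ((hΨc.norm.locallyIntegrable.integrableOn_isCompact
      (isCompact_closedBall Q.center (4 * Q.size))).mono_set
      (hUQ.trans (Q.carrier_subset_ball.trans ball_subset_closedBall)))
  have hgle : ∀ x, ‖g x‖ ≤ U.indicator (fun x => ‖Ψ x‖) x := by
    intro x
    by_cases hx : θ x = 0
    · simp only [hgdef, hx, zero_smul, norm_zero]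
      exact Set.indicator_nonneg (fun _ _ => norm_nonneg _) x
    · rw [Set.indicator_of_mem (hθU' x hx), hgdef, norm_smul, Real.norm_of_nonneg (hθ0 x)]
      exact mul_le_of_le_one_left (norm_nonneg _) (hθ1 x)
  -- Since φ_Q = 1 on U, which contains the Δ-neighborhood of {θ ≠ 0}, the antisymmetric expression
  -- is just g(x) - g(y). The Lipschitz constant of φ_Q does not enter.
  set W : Space d → ℝ := U.indicator fun y => Λ + Lθ * ‖Ψ y‖ with hW
  have hWon : IntegrableOn (fun y => Λ + Lθ * ‖Ψ y‖) U μ :=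
    (integrableOn_const hUfin.ne).add (hΨU.const_mul Lθ)
  have hWi : Integrable W μ := hWon.integrable_indicator hU
  have hW0 : ∀ y, 0 ≤ W y := fun y =>
    Set.indicator_nonneg (fun _ _ => by positivity) y
  have hΛi : Integrable (fun _ : Space d => Λ) (μ.restrict U) := integrableOn_const hUfin.ne
  have hWint : ∫ y, W y ∂μ ≤ Λ * μ.real Q.carrier + Lθ * ∫ x in U, ‖Ψ x‖ ∂μ := by
    rw [hW, integral_indicator hU, integral_add hΛi (hΨU.const_mul Lθ), integral_const_mul, setIntegral_const, smul_eq_mul, mul_comm (μ.real U)]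
    gcongr
    exact hQfin.ne
  have hsym1 : ∀ x y, ‖x - y‖ < Δ → θ x ≠ 0 ∨ θ y ≠ 0 →
      ‖Q.cutoff φ₀ ε y • g x - Q.cutoff φ₀ ε x • g y‖ ≤ ‖x - y‖ * W y := by
    intro x y hxy h
    have hxyU : x ∈ U ∧ y ∈ U := by
      rcases h with h | h
      · exact ⟨hθU' x h, hθU x y h hxy⟩
      · exact ⟨hθU y x h (by rwa [norm_sub_rev]), hθU' y h⟩
    rw [hUφ x hxyU.1, hUφ y hxyU.2, one_smul, one_smul, hW, Set.indicator_of_mem hxyU.2]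
    have e : g x - g y = θ x • (Ψ x - Ψ y) + (θ x - θ y) • Ψ y := by
      simp only [hgdef, smul_sub, sub_smul]; abel
    rw [e]
    refine (norm_add_le _ _).trans ?_
    rw [norm_smul, norm_smul, Real.norm_of_nonneg (hθ0 x), Real.norm_eq_abs]
    calc θ x * ‖Ψ x - Ψ y‖ + |θ x - θ y| * ‖Ψ y‖
        ≤ 1 * (Λ * ‖x - y‖) + (Lθ * ‖x - y‖) * ‖Ψ y‖ := by
          gcongr
          · exact hθ1 x
          · exact hΨ x y
          · exact hθL x y
      _ = _ := by ring
  have hsym : ∀ x y, ‖x - y‖ < Δ →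
      ‖Q.cutoff φ₀ ε y • g x - Q.cutoff φ₀ ε x • g y‖ ≤ ‖x - y‖ * W y := by
    intro x y hxy
    by_cases h : θ x ≠ 0 ∨ θ y ≠ 0
    · exact hsym1 x y hxy h
    · push Not at h
      simp only [hgdef, h.1, h.2, zero_smul, smul_zero, sub_zero, norm_zero]
      exact mul_nonneg (norm_nonneg _) (hW0 y)
  have hT : |∫ x, inner ℝ (rieszMu H μ (Q.cutoff φ₀ ε) x) (g x) ∂μ
      - ∫ x, inner ℝ (rieszRegH H Δ μ (Q.cutoff φ₀ ε) x) (g x) ∂μ|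
      ≤ C * 4 ^ (d + 1) * Δ * (Λ * μ.real Q.carrier + Lθ * ∫ x in U, ‖Ψ x‖ ∂μ) := by
    refine le_of_tendsto ((hex.2.2.1.2 g hg2).sub_const _).abs ?_
    filter_upwards [Ioc_mem_nhdsGT hΔ] with δ hδ
    rw [← integral_sub (integrable_inner (hR δ hδ.1) hg2) (integrable_inner (hR Δ hΔ) hg2)]
    simp_rw [← inner_sub_left, real_inner_comm (g _)]
    refine (abs_integral_inner_rieszRegH_sub_le H hC.le hμ.1 hφi hgi hWi hW0 hδ.1 hδ.2
      hsym).trans ?_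
    gcongr
  set e₂ := α * Q.size ^ (d + 1) * (2 * (d + 2) * (Δ ^ (d + 1))⁻¹ * (1 + 8 * c₀ / ε))
    + factorBound d C * (c₀ / (ε * Q.size)) * (unitBallVolume d * 4 ^ (d + 1) * Δ) with he₂
  have hcontS : Continuous (Q.rieszApprox φ₀ ε H) :=
    continuous_rieszApprox hφ hε hε' hd hH hC.le hμ.1 Q
  have hcontR : Continuous (rieszRegH H Δ μ (Q.cutoff φ₀ ε)) :=
    continuous_rieszRegH H hC.le hμ.1 hφi zero_le_one (abs_cutoff_le_one hφ hε Q) hΔ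
  -- Two replacements at scale Δ: flatness passes from φ_Q μ to ν_Q, and the linear rate on the
  -- plane then removes the regularization of ν_Q.
  have hpt : ∀ x, ‖rieszRegH H Δ μ (Q.cutoff φ₀ ε) x - Q.rieszApprox φ₀ ε H x‖ ≤ e₂ := by
    intro x
    have h1 := norm_rieszRegH_cutoff_sub_le hφ hε hε' hd hH hμ.1 hc₀ hL hα hA hflat hΔ x
    have h2 := norm_rieszPtw_sub_le hd hH Q.center
      (integrable_approxDensity (H := H) hφ hε hd hH Q)
      (mul_nonneg (factorBound_nonneg d hC.le) (by positivity))
      (abs_approxDensity_sub_le hφ hε hε' hd hH hC.le hμ.1 Q hL) hΔ x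
    rw [norm_sub_rev] at h2
    exact (norm_sub_le_norm_sub_add_norm_sub _ _ _).trans (add_le_add h1 h2)
  have hgS : Integrable (fun x => inner ℝ (Q.rieszApprox φ₀ ε H x) (g x)) μ :=
    (hcontS.inner hgc).integrable_of_hasCompactSupport
      (hgsupp.mono' fun x hx => subset_tsupport g fun h => hx (by simp [h]))
  have hsplit : ∫ x, inner ℝ (g x) (Q.field φ₀ ε H x) ∂μ
      = (∫ x, inner ℝ (rieszMu H μ (Q.cutoff φ₀ ε) x) (g x) ∂μ
        - ∫ x, inner ℝ (rieszRegH H Δ μ (Q.cutoff φ₀ ε) x) (g x) ∂μ)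
        + ∫ x, inner ℝ (rieszRegH H Δ μ (Q.cutoff φ₀ ε) x - Q.rieszApprox φ₀ ε H x) (g x) ∂μ := by
    simp_rw [real_inner_comm _ (g _), field, inner_sub_left]
    rw [integral_sub (integrable_inner hex.2.2.1.1 hg2) hgS,
      integral_sub (integrable_inner (hR Δ hΔ) hg2) hgS]
    ring
  have hlast : |∫ x, inner ℝ (rieszRegH H Δ μ (Q.cutoff φ₀ ε) x - Q.rieszApprox φ₀ ε H x)
      (g x) ∂μ| ≤ e₂ * ∫ x in U, ‖Ψ x‖ ∂μ := by
    rw [← integral_indicator hU, ← integral_const_mul]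
    refine abs_integral_le_integral_abs.trans (integral_mono_of_nonneg
      (ae_of_all _ fun _ => abs_nonneg _) ((hΨU.integrable_indicator hU).const_mul _)
      (ae_of_all _ fun x => ?_))
    refine (abs_real_inner_le_norm _ _).trans ?_
    exact mul_le_mul (hpt x) (hgle x) (norm_nonneg _) ((norm_nonneg _).trans (hpt x))
  rw [hsplit]
  exact (abs_add_le _ _).trans (add_le_add hT hlast)

end DSLattice.Cell

namespace DSLattice.Cell

variable {d : ℕ} {C c : ℝ} {μ : Measure (Space d)} {D : DSLattice μ} {φ₀ : Space d → ℝ} {ε : ℝ}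
  {H : Submodule ℝ (Space d)}

/-! ### Pairs of nested cells -/

/-- The rate at which the regularized transforms of the approximating measures converge, on the
scale `ε ℓ(Q)`. -/
noncomputable def approxRate (d : ℕ) (C c₀ : ℝ) : ℝ :=
  factorBound d C * c₀ * (unitBallVolume d * 4 ^ (d + 1))

theorem approxRate_nonneg (d : ℕ) {c₀ : ℝ} (hC : 0 ≤ C) (hc₀ : 0 < c₀) :
    0 ≤ approxRate d C c₀ := by
  have := factorBound_nonneg d hC
  have := unitBallVolume_pos d
  unfold approxRate; positivity

theorem norm_rieszApprox_sub_le (hφ : IsUnitMollifier φ₀) (hε : 0 < ε) (hε' : ε < 1 / 48)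
    (hd : 1 ≤ d) (hH : Module.finrank ℝ H = d) (hC : 0 ≤ C) (hμ : IsNiceMeasure C μ)
    {Q : D.Cell} {c₀ : ℝ} (hc₀ : 0 < c₀)
    (hL : ∀ x x', |Q.cutoff φ₀ ε x - Q.cutoff φ₀ ε x'| ≤ c₀ / (ε * Q.size) * ‖x - x'‖)
    {s : ℝ} (hs : 0 < s) (x : Space d) :
    ‖Q.rieszApprox φ₀ ε H x
        - rieszRegH H (ε * s * Q.size) (planeMeasure H Q.center) (Q.approxDensity φ₀ ε H) x‖
      ≤ approxRate d C c₀ * s := by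
  have hQ := Q.size_pos
  refine (norm_rieszPtw_sub_le hd hH Q.center (integrable_approxDensity hφ hε hd hH Q)
    (mul_nonneg (factorBound_nonneg d hC) (by positivity))
    (abs_approxDensity_sub_le hφ hε hε' hd hH hC hμ Q hL) (by positivity) x).trans (le_of_eq ?_)
  unfold approxRate
  field_simp

/-- The piecewise linear function equal to `0` on the negative half-line and to `1` on `[1, ∞)`. -/
noncomputable def ramp (u : ℝ) : ℝ := max 0 (min 1 u)

theorem ramp_nonneg (u : ℝ) : 0 ≤ ramp u := le_max_left _ _

theorem ramp_le_one (u : ℝ) : ramp u ≤ 1 := max_le zero_le_one (min_le_left _ _)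

theorem continuous_ramp : Continuous ramp :=
  continuous_const.max (continuous_const.min continuous_id)

theorem abs_ramp_sub_le (u v : ℝ) : |ramp u - ramp v| ≤ |u - v| := by
  refine (abs_max_sub_max_le_max _ _ _ _).trans ?_
  rw [sub_self, abs_zero]
  refine max_le (abs_nonneg _) ((abs_min_sub_min_le_max _ _ _ _).trans ?_)
  simp

theorem pos_of_ramp_ne_zero {u : ℝ} (h : ramp u ≠ 0) : 0 < u := by
  by_contra hu
  exact h (max_eq_left ((min_le_right _ _).trans (not_lt.1 hu)))

theorem ramp_eq_one {u : ℝ} (h : 1 ≤ u) : ramp u = 1 := by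
  simp [ramp, min_eq_left h]

/-- A cutoff supported well inside both cells. -/
noncomputable def interiorCutoff (ε : ℝ) (Q Q' : D.Cell) (x : Space d) : ℝ :=
  ramp (Q.depth x / (ε * Q.size) - 5) * ramp (Q'.depth x / (ε * Q'.size) - 5)

section Interior

variable {Q Q' : D.Cell}

theorem interiorCutoff_nonneg (x : Space d) : 0 ≤ interiorCutoff ε Q Q' x :=
  mul_nonneg (ramp_nonneg _) (ramp_nonneg _)

theorem interiorCutoff_le_one (x : Space d) : interiorCutoff ε Q Q' x ≤ 1 :=
  mul_le_one₀ (ramp_le_one _) (ramp_nonneg _) (ramp_le_one _)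

theorem continuous_interiorCutoff : Continuous (interiorCutoff ε Q Q') :=
  (continuous_ramp.comp ((Q.continuous_depth.div_const _).sub continuous_const)).mul
    (continuous_ramp.comp ((Q'.continuous_depth.div_const _).sub continuous_const))

/-- Depth 5ε leaves room for two enlargements by at most εℓ(Q'): first to depth 4ε, the set U on
which the fields are compared, then to depth 3ε, where the cutoffs are still 1. -/
theorem depth_of_interiorCutoff_ne_zero (hε : 0 < ε) {x : Space d}
    (h : interiorCutoff ε Q Q' x ≠ 0) :
    5 * ε * Q.size ≤ Q.depth x ∧ 5 * ε * Q'.size ≤ Q'.depth x := by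
  have h1 := pos_of_ramp_ne_zero (left_ne_zero_of_mul h)
  have h2 := pos_of_ramp_ne_zero (right_ne_zero_of_mul h)
  rw [sub_pos, lt_div_iff₀ (mul_pos hε (size_pos _))] at h1 h2
  constructor <;> linarith

theorem interiorCutoff_eq_one (hε : 0 < ε) {x : Space d} (h1 : 6 * ε * Q.size ≤ Q.depth x)
    (h2 : 6 * ε * Q'.size ≤ Q'.depth x) : interiorCutoff ε Q Q' x = 1 := by
  rw [interiorCutoff, ramp_eq_one, ramp_eq_one, one_mul]
  · rw [le_sub_iff_add_le, le_div_iff₀ (mul_pos hε (size_pos _))]; linarith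
  · rw [le_sub_iff_add_le, le_div_iff₀ (mul_pos hε (size_pos _))]; linarith

theorem abs_ramp_depth_sub_le (hε : 0 < ε) (Q : D.Cell) (x y : Space d) :
    |ramp (Q.depth x / (ε * Q.size) - 5) - ramp (Q.depth y / (ε * Q.size) - 5)|
      ≤ ‖x - y‖ / (ε * Q.size) := by
  have := mul_pos hε Q.size_pos
  refine (abs_ramp_sub_le _ _).trans ?_
  rw [sub_sub_sub_cancel_right, ← sub_div, abs_div, abs_of_pos this]
  gcongr
  exact Q.abs_depth_sub_le x y

theorem abs_interiorCutoff_sub_le (hε : 0 < ε) (hQ : Q'.carrier ⊆ Q.carrier) (x y : Space d) :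
    |interiorCutoff ε Q Q' x - interiorCutoff ε Q Q' y| ≤ 2 / (ε * Q'.size) * ‖x - y‖ := by
  have hs' := Q'.size_pos
  have h1 := abs_ramp_depth_sub_le hε Q x y
  have h2 := abs_ramp_depth_sub_le hε Q' x y
  have h3 : ‖x - y‖ / (ε * Q.size) ≤ ‖x - y‖ / (ε * Q'.size) := by
    gcongr
    exact size_le_of_subset hQ
  unfold interiorCutoff
  generalize ramp (Q.depth x / (ε * Q.size) - 5) = a at *
  have hb1 := ramp_nonneg (Q.depth y / (ε * Q.size) - 5)
  have hb2 := ramp_le_one (Q.depth y / (ε * Q.size) - 5)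
  generalize ramp (Q.depth y / (ε * Q.size) - 5) = b at *
  have hp1 := ramp_nonneg (Q'.depth x / (ε * Q'.size) - 5)
  have hp2 := ramp_le_one (Q'.depth x / (ε * Q'.size) - 5)
  generalize ramp (Q'.depth x / (ε * Q'.size) - 5) = p at *
  generalize ramp (Q'.depth y / (ε * Q'.size) - 5) = q at *
  have e : a * p - b * q = (a - b) * p + b * (p - q) := by ring
  rw [e]
  calc _ ≤ |(a - b) * p| + |b * (p - q)| := abs_add_le _ _
    _ ≤ |a - b| * 1 + 1 * |p - q| := by
        rw [abs_mul, abs_mul, abs_of_nonneg hp1, abs_of_nonneg hb1]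
        gcongr
    _ ≤ ‖x - y‖ / (ε * Q'.size) + ‖x - y‖ / (ε * Q'.size) := by linarith
    _ = _ := by ring

end Interior

/-- The Lipschitz constant of the regularized difference of the fields. -/
noncomputable def pairLipschitz (d : ℕ) (C : ℝ) : ℝ :=
  (d + 2) * (2 * 4 ^ (d + 1)) * (C + 2 * (factorBound d C * unitBallVolume d))

theorem pairLipschitz_nonneg (d : ℕ) (hC : 0 ≤ C) : 0 ≤ pairLipschitz d C := by
  have := factorBound_nonneg d hC
  have := unitBallVolume_pos d
  unfold pairLipschitz; positivity

/-- The regularized difference of the fields of two nested cells. -/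
noncomputable def regDiff (φ₀ : Space d → ℝ) (ε s : ℝ) (H : Submodule ℝ (Space d)) (Q Q' : D.Cell)
    (x : Space d) : Space d :=
  rieszRegH H (ε * s * Q'.size) μ (fun y => Q.cutoff φ₀ ε y - Q'.cutoff φ₀ ε y) x
    - rieszRegH H (ε * s * Q.size) (planeMeasure H Q.center) (Q.approxDensity φ₀ ε H) x
    + rieszRegH H (ε * s * Q'.size) (planeMeasure H Q'.center) (Q'.approxDensity φ₀ ε H) x

theorem abs_cutoff_sub_cutoff_le (hφ : IsUnitMollifier φ₀) (hε : 0 < ε) (Q Q' : D.Cell)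
    (y : Space d) : |Q.cutoff φ₀ ε y - Q'.cutoff φ₀ ε y| ≤ 1 := by
  have h1 := cutoff_nonneg hφ hε Q y
  have h2 := cutoff_nonneg hφ hε Q' y
  have h3 := cutoff_le_one hφ hε Q y
  have h4 := cutoff_le_one hφ hε Q' y
  rw [abs_le]
  constructor <;> linarith

/-- Each of the three transforms has a bounded density and Lipschitz constant inverse to its
regularization. The scale for ν_Q is the larger one, so it only helps; the factor 2 in
`pairLipschitz` counts the two plane measures. -/
theorem norm_regDiff_sub_le (hφ : IsUnitMollifier φ₀) (hε : 0 < ε) (hε' : ε < 1 / 48)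
    (hd : 1 ≤ d) (hH : Module.finrank ℝ H = d) (hC : 0 ≤ C) (hμ : IsNiceMeasure C μ)
    {Q Q' : D.Cell} (hQ : Q'.carrier ⊆ Q.carrier) {s : ℝ} (hs : 0 < s) (x y : Space d) :
    ‖regDiff φ₀ ε s H Q Q' x - regDiff φ₀ ε s H Q Q' y‖
      ≤ pairLipschitz d C / (ε * s * Q'.size) * ‖x - y‖ := by
  have hlf := hμ.isLocallyFinite
  have h1 := Q.size_pos
  have h2 := Q'.size_pos
  have h3 := size_le_of_subset hQ
  have hA := factorBound_nonneg d hC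
  have hV := unitBallVolume_pos d
  have e1 := norm_rieszRegH_sub_le H hC hμ
    ((integrable_cutoff hφ hε Q μ).sub (integrable_cutoff hφ hε Q' μ)) zero_le_one
    (abs_cutoff_sub_cutoff_le hφ hε Q Q') (show 0 < ε * s * Q'.size by positivity) x y
  have e2 := norm_rieszRegH_sub_le H hV.le (isNiceMeasure_planeMeasure hd hH Q.center)
    (integrable_approxDensity (H := H) hφ hε hd hH Q) hA
    (abs_approxDensity_le hφ hε hε' hd hH hC hμ Q) (show 0 < ε * s * Q.size by positivity) x y
  have e3 := norm_rieszRegH_sub_le H hV.le (isNiceMeasure_planeMeasure hd hH Q'.center)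
    (integrable_approxDensity (H := H) hφ hε hd hH Q') hA
    (abs_approxDensity_le hφ hε hε' hd hH hC hμ Q') (show 0 < ε * s * Q'.size by positivity) x y
  have e2' : factorBound d C * (d + 2) * (2 * unitBallVolume d * 4 ^ (d + 1)) / (ε * s * Q.size)
      * ‖x - y‖ ≤ factorBound d C * (d + 2) * (2 * unitBallVolume d * 4 ^ (d + 1))
        / (ε * s * Q'.size) * ‖x - y‖ := by
    gcongr
  unfold regDiff
  set a := rieszRegH H (ε * s * Q'.size) μ (fun y => Q.cutoff φ₀ ε y - Q'.cutoff φ₀ ε y)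
  set b := rieszRegH H (ε * s * Q.size) (planeMeasure H Q.center) (Q.approxDensity φ₀ ε H)
  set b' := rieszRegH H (ε * s * Q'.size) (planeMeasure H Q'.center) (Q'.approxDensity φ₀ ε H)
  have e : a x - b x + b' x - (a y - b y + b' y) = (a x - a y) - (b x - b y) + (b' x - b' y) := by
    abel
  rw [e]
  refine (norm_add_le _ _).trans ((add_le_add (norm_sub_le _ _) le_rfl).trans ?_)
  refine (add_le_add (add_le_add e1 (e2.trans e2')) e3).trans (le_of_eq ?_)
  unfold pairLipschitz
  field_simp
  ring

/-- Well inside both cells, the regularization of the difference of the fields has a small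
effect. -/
theorem ae_norm_field_sub_le (hφ : IsUnitMollifier φ₀) (hε : 0 < ε) (hε' : ε < 1 / 48)
    (hd : 1 ≤ d) (hH : Module.finrank ℝ H = d) (hC : 0 ≤ C) (hμ : IsGoodMeasure C μ)
    {Q Q' : D.Cell} (hQ : Q'.carrier ⊆ Q.carrier) (hex : Q.SummandExists φ₀ ε H)
    (hex' : Q'.SummandExists φ₀ ε H) {c₀ : ℝ} (hc₀ : 0 < c₀)
    (hL : ∀ (Q : D.Cell) (x x' : Space d),
      |Q.cutoff φ₀ ε x - Q.cutoff φ₀ ε x'| ≤ c₀ / (ε * Q.size) * ‖x - x'‖)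
    {s : ℝ} (hs : 0 < s) (hs1 : s ≤ 1) :
    ∀ᵐ x ∂μ, 4 * ε * Q.size ≤ Q.depth x ∧ 4 * ε * Q'.size ≤ Q'.depth x →
      ‖(Q.field φ₀ ε H x - Q'.field φ₀ ε H x) - regDiff φ₀ ε s H Q Q' x‖
        ≤ 2 * approxRate d C c₀ * s := by
  have hlf := hμ.1.isLocallyFinite
  have h1 := Q.size_pos
  have h2 := Q'.size_pos
  have h3 := size_le_of_subset hQ
  have hi := integrable_cutoff hφ hε Q μ
  have hi' := integrable_cutoff hφ hε Q' μ
  have hw := hex.2.2.1.sub hex'.2.2.1 hi hi'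
    (fun δ hδ => hμ.memLp_rieszRegH hC H hi zero_le_one (abs_cutoff_le_one hφ hε Q) hδ)
    (fun δ hδ => hμ.memLp_rieszRegH hC H hi' zero_le_one (abs_cutoff_le_one hφ hε Q') hδ)
  have hUm : MeasurableSet {x | 4 * ε * Q.size ≤ Q.depth x ∧ 4 * ε * Q'.size ≤ Q'.depth x} :=
    ((isClosed_le continuous_const Q.continuous_depth).inter
      (isClosed_le continuous_const Q'.continuous_depth)).measurableSet
  -- Both cutoffs equal 1 within εsℓ(Q') of the set in question, so their difference vanishes there.
  -- The weak limit of its transform is then an exact regularized transform, and only the two plane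
  -- measures contribute an error.
  have hae := hw.ae_eq_of_far hUm
    (fun δ hδ => hμ.memLp_rieszRegH hC H (hi.sub hi') zero_le_one
      (abs_cutoff_sub_cutoff_le hφ hε Q Q') hδ) (show 0 < ε * s * Q'.size by positivity)
    fun x hx y hy => ?_
  · filter_upwards [hae] with x hx hxU
    have hx := hx hxU
    have e1 := norm_rieszApprox_sub_le hφ hε hε' hd hH hC hμ.1 hc₀ (hL Q) hs x
    have e2 := norm_rieszApprox_sub_le hφ hε hε' hd hH hC hμ.1 hc₀ (hL Q') hs x
    have e : (Q.field φ₀ ε H x - Q'.field φ₀ ε H x) - regDiff φ₀ ε s H Q Q' x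
        = (Q'.rieszApprox φ₀ ε H x - rieszRegH H (ε * s * Q'.size) (planeMeasure H Q'.center)
            (Q'.approxDensity φ₀ ε H) x)
          - (Q.rieszApprox φ₀ ε H x - rieszRegH H (ε * s * Q.size) (planeMeasure H Q.center)
            (Q.approxDensity φ₀ ε H) x) := by
      rw [regDiff, ← hx, field, field]
      abel
    rw [e]
    refine (norm_sub_le _ _).trans ((add_le_add e2 e1).trans (le_of_eq (by ring)))
  · by_contra hlt
    push Not at hlt
    refine hy ?_
    have hb : ‖x - y‖ < ε * Q'.size := hlt.trans_le (by
      gcongr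
      exact mul_le_of_le_one_right hε.le hs1)
    have hb' : ε * Q'.size ≤ ε * Q.size := by gcongr
    have d1 := abs_le.1 (Q.abs_depth_sub_le x y)
    have d2 := abs_le.1 (Q'.abs_depth_sub_le x y)
    rw [cutoff_eq_one hφ hε (by linarith [hx.1]), cutoff_eq_one hφ hε (by linarith [hx.2]),
      sub_self]

/-- The constant in the bound for the pairing of a flat cell with an ancestor. -/
noncomputable def pairConst (d : ℕ) (C c₀ ε : ℝ) : ℝ :=
  C * 4 ^ (d + 1) * pairLipschitz d C
    + (1 + 2 * approxRate d C c₀) * (2 * (C * 4 ^ (d + 1))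
      + (2 * (d + 2) * (1 + 8 * c₀ / ε)) / (ε ^ 2) ^ (d + 1) + approxRate d C c₀)
    + 2 * approxRate d C c₀

theorem pairConst_nonneg {c₀ : ℝ} (hC : 0 ≤ C) (hc₀ : 0 < c₀) (hε : 0 < ε) :
    0 ≤ pairConst d C c₀ ε := by
  have := pairLipschitz_nonneg d hC
  have := approxRate_nonneg d hC hc₀
  unfold pairConst; positivity

/-- The main term of the pairing of the fields of two nested cells. -/
theorem abs_integral_interior_le (hφ : IsUnitMollifier φ₀) (hε : 0 < ε) (hε' : ε < 1 / 48)
    (hd : 1 ≤ d) (hH : Module.finrank ℝ H = d) (hC : 0 < C) (hμ : IsGoodMeasure C μ)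
    {Q Q' : D.Cell} (hQ : Q'.carrier ⊆ Q.carrier) (hex : Q.SummandExists φ₀ ε H)
    (hex' : Q'.SummandExists φ₀ ε H) {c₀ : ℝ} (hc₀ : 0 < c₀)
    (hL : ∀ (Q : D.Cell) (x x' : Space d),
      |Q.cutoff φ₀ ε x - Q.cutoff φ₀ ε x'| ≤ c₀ / (ε * Q.size) * ‖x - x'‖)
    {s A α : ℝ} (hs : 0 < s) (hs1 : s ≤ 1) (hsα : s ^ (2 * d + 3) = α) (hA : 5 < A)
    (hflat : Q'.IsFlat H A α) :
    |∫ x in Q'.carrier, inner ℝ (interiorCutoff ε Q Q' x • (Q.field φ₀ ε H x - Q'.field φ₀ ε H x))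
        (Q'.field φ₀ ε H x) ∂μ|
      ≤ s * pairConst d C c₀ ε * (μ.real Q'.carrier
        + ∫ x in Q'.carrier, (‖Q.field φ₀ ε H x‖ + ‖Q'.field φ₀ ε H x‖) ∂μ) := by
  have hlf := hμ.1.isLocallyFinite
  have hl' := Q'.size_pos
  have hll := size_le_of_subset hQ
  have hfin := Q'.measure_lt_top hμ.1
  have hα : 0 < α := hsα ▸ by positivity
  have hfinm : IsFiniteMeasure (μ.restrict Q'.carrier) :=
    ⟨by rw [Measure.restrict_apply_univ]; exact hfin⟩
  set f := Q.field φ₀ ε H with hf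
  set f' := Q'.field φ₀ ε H with hf'
  set θ := interiorCutoff ε Q Q' with hθ
  set Ψ := regDiff φ₀ ε s H Q Q' with hΨ
  set E := approxRate d C c₀ with hE
  have hE0 : 0 ≤ E := approxRate_nonneg d hC.le hc₀
  have hP0 := pairLipschitz_nonneg d hC.le
  have hft : ε * s ≤ ε := mul_le_of_le_one_right hε.le hs1
  set U := {x | 4 * ε * Q.size ≤ Q.depth x ∧ 4 * ε * Q'.size ≤ Q'.depth x} with hU
  have hUm : MeasurableSet U :=
    ((isClosed_le continuous_const Q.continuous_depth).inter
      (isClosed_le continuous_const Q'.continuous_depth)).measurableSet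
  have hUQ : U ⊆ Q'.carrier := fun x hx =>
    mem_of_depth_pos (lt_of_lt_of_le (by positivity) hx.2)
  have hUφ : ∀ x ∈ U, Q'.cutoff φ₀ ε x = 1 := fun x hx =>
    cutoff_eq_one hφ hε (le_trans (by gcongr; norm_num) hx.2)
  have hΨL := norm_regDiff_sub_le hφ hε hε' hd hH hC.le hμ.1 (Q := Q) (Q' := Q') hQ hs
  have hΨc : Continuous Ψ := by
    refine (LipschitzWith.of_dist_le_mul
      (K := ⟨pairLipschitz d C / (ε * s * Q'.size), by positivity⟩) fun x y => ?_).continuous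
    rw [dist_eq_norm, dist_eq_norm]
    exact hΨL x y
  have hε1 : ε ≤ 1 := by linarith
  have hts : (ε * s) ^ 2 ≤ ε := by
    calc (ε * s) ^ 2 = ε * (ε * s ^ 2) := by ring
      _ ≤ ε * (1 * 1 ^ 2) := by gcongr
      _ = ε := by ring
  -- The scale Δ = (εs)²ℓ(Q') is smaller by a factor εs than the scale on which Ψ varies, so
  -- antisymmetry gains εs; it is still large enough for flatness to act, as α/s^(2(d+1)) = s.
  have hcore := abs_integral_inner_field_le hφ hε hε' hd hH hC hμ hex' hc₀ (hL Q') hα hA hflat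
    (Δ := (ε * s) ^ 2 * Q'.size) (by positivity) hUm hUQ hUφ (θ := θ) interiorCutoff_nonneg
    interiorCutoff_le_one continuous_interiorCutoff (Lθ := 2 / (ε * Q'.size)) (by positivity)
    (abs_interiorCutoff_sub_le hε hQ) (fun x y hx hxy => ?_) hΨc
    (Λ := pairLipschitz d C / (ε * s * Q'.size)) (by positivity) hΨL
  swap
  · have hx' := depth_of_interiorCutoff_ne_zero hε hx
    have hb : ‖x - y‖ < ε * Q'.size := hxy.trans_le (by gcongr)
    have hb' : ε * Q'.size ≤ ε * Q.size := by gcongr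
    have d1 := abs_le.1 (Q.abs_depth_sub_le x y)
    have d2 := abs_le.1 (Q'.abs_depth_sub_le x y)
    constructor
    · linarith [hx'.1]
    · linarith [hx'.2]
  have hθU : ∀ x, θ x ≠ 0 → x ∈ U := fun x hx => by
    have hx' := depth_of_interiorCutoff_ne_zero hε hx
    have : 0 < ε * Q.size := mul_pos hε Q.size_pos
    have : 0 < ε * Q'.size := mul_pos hε Q'.size_pos
    constructor
    · linarith [hx'.1]
    · linarith [hx'.2]
  have hf2 : MemLp f 2 (μ.restrict Q'.carrier) :=
    (memLp_field_restrict hφ hε hε' hd hH hC.le hμ.1 hex).mono_measure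
      (Measure.restrict_mono hQ le_rfl)
  have hf'2 : MemLp f' 2 (μ.restrict Q'.carrier) :=
    memLp_field_restrict hφ hε hε' hd hH hC.le hμ.1 hex'
  have hΨ2 : MemLp Ψ 2 (μ.restrict Q'.carrier) := by
    obtain ⟨M, hM⟩ := (isCompact_closedBall Q'.center (4 * Q'.size)).exists_bound_of_continuousOn
      hΨc.continuousOn
    refine MemLp.of_bound hΨc.aestronglyMeasurable M ?_
    refine (ae_restrict_iff' Q'.measurableSet).2 (ae_of_all _ fun x hx => ?_)
    exact hM x (ball_subset_closedBall (Q'.carrier_subset_ball hx))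
  have hθmul : ∀ g : Space d → Space d, MemLp g 2 (μ.restrict Q'.carrier) →
      MemLp (fun x => θ x • g x) 2 (μ.restrict Q'.carrier) := fun g hg => by
    refine hg.of_le (continuous_interiorCutoff.aestronglyMeasurable.smul hg.1)
      (ae_of_all _ fun x => ?_)
    rw [norm_smul, Real.norm_of_nonneg (interiorCutoff_nonneg x)]
    exact mul_le_of_le_one_left (norm_nonneg _) (interiorCutoff_le_one x)
  have hae := (ae_norm_field_sub_le hφ hε hε' hd hH hC.le hμ hQ hex hex' hc₀ hL hs hs1)
  set N := ∫ x in Q'.carrier, (‖f x‖ + ‖f' x‖) ∂μ with hN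
  have hfi : IntegrableOn (fun x => ‖f x‖) Q'.carrier μ := (hf2.integrable (by norm_num)).norm
  have hf'i : IntegrableOn (fun x => ‖f' x‖) Q'.carrier μ := (hf'2.integrable (by norm_num)).norm
  have hNi : IntegrableOn (fun x => ‖f x‖ + ‖f' x‖) Q'.carrier μ := hfi.add hf'i
  have hf'N : ∫ x in Q'.carrier, ‖f' x‖ ∂μ ≤ N :=
    integral_mono hf'i hNi fun x => le_add_of_nonneg_left (norm_nonneg _)
  have hN0 : 0 ≤ N := integral_nonneg fun x => by positivity
  have hΨi : IntegrableOn (fun x => ‖Ψ x‖) Q'.carrier μ := (hΨ2.integrable (by norm_num)).norm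
  -- On U the function Ψ is f - f' up to O(s), so its L¹ norm is controlled by those of the fields.
  have hI : ∫ x in U, ‖Ψ x‖ ∂μ ≤ N + 2 * E * s * μ.real Q'.carrier := by
    have hci : IntegrableOn (fun _ => 2 * E * s) Q'.carrier μ := integrableOn_const hfin.ne
    calc ∫ x in U, ‖Ψ x‖ ∂μ ≤ ∫ x in U, (‖f x‖ + ‖f' x‖ + 2 * E * s) ∂μ := by
          refine setIntegral_mono_on_ae (hΨi.mono_set hUQ) ((hNi.add hci).mono_set hUQ) hUm ?_
          filter_upwards [hae] with x hx hxU
          have h1 := hx hxU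
          have h2 := norm_sub_le (f x) (f' x)
          have h3 := norm_le_norm_add_norm_sub (f x - f' x) (Ψ x)
          linarith
      _ ≤ ∫ x in Q'.carrier, (‖f x‖ + ‖f' x‖ + 2 * E * s) ∂μ :=
          setIntegral_mono_set (hNi.add hci) (ae_of_all _ fun x => by positivity)
            hUQ.eventuallyLE
      _ = _ := by
          rw [integral_add hNi hci, setIntegral_const, smul_eq_mul, mul_comm (μ.real _)]
  have hsplit : ∫ x in Q'.carrier, inner ℝ (θ x • (f x - f' x)) (f' x) ∂μ
      = ∫ x, inner ℝ (θ x • Ψ x) (f' x) ∂μ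
        + ∫ x in Q'.carrier, inner ℝ (θ x • (f x - f' x - Ψ x)) (f' x) ∂μ := by
    have h1 : ∫ x, inner ℝ (θ x • Ψ x) (f' x) ∂μ
        = ∫ x in Q'.carrier, inner ℝ (θ x • Ψ x) (f' x) ∂μ := by
      rw [setIntegral_eq_integral_of_forall_compl_eq_zero]
      intro x hx
      have : θ x = 0 := by
        by_contra h
        exact hx (hUQ (hθU x h))
      simp [this]
    rw [h1, ← integral_add (integrable_inner (hθmul _ hΨ2) hf'2)
      (integrable_inner (hθmul (fun x => f x - f' x - Ψ x) ((hf2.sub hf'2).sub hΨ2)) hf'2)]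
    refine integral_congr_ae (ae_of_all _ fun x => ?_)
    simp only
    rw [← inner_add_left, ← smul_add, add_sub_cancel]
  have hrest : |∫ x in Q'.carrier, inner ℝ (θ x • (f x - f' x - Ψ x)) (f' x) ∂μ|
      ≤ 2 * E * s * N := by
    calc _ ≤ ∫ x in Q'.carrier, 2 * E * s * ‖f' x‖ ∂μ := by
          refine abs_integral_le_integral_abs.trans (integral_mono_of_nonneg
            (ae_of_all _ fun _ => abs_nonneg _) (hf'i.const_mul _) (ae_restrict_of_ae ?_))
          filter_upwards [hae] with x hx
          refine (abs_real_inner_le_norm _ _).trans ?_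
          gcongr
          by_cases h0 : θ x = 0
          · rw [h0, zero_smul, norm_zero]; positivity
          · rw [norm_smul, Real.norm_of_nonneg (interiorCutoff_nonneg x)]
            exact (mul_le_of_le_one_left (norm_nonneg _) (interiorCutoff_le_one x)).trans
              (hx (hθU x h0))
      _ = 2 * E * s * ∫ x in Q'.carrier, ‖f' x‖ ∂μ := integral_const_mul _ _
      _ ≤ _ := by gcongr
  set I := ∫ x in U, ‖Ψ x‖ ∂μ with hIdef
  have hI0 : 0 ≤ I := integral_nonneg fun x => norm_nonneg _
  have hmm : 0 ≤ μ.real Q'.carrier := measureReal_nonneg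
  set mm := μ.real Q'.carrier with hmmdef
  have hs2 : s ^ 2 ≤ s := by
    rw [sq]; exact mul_le_of_le_one_left hs.le hs1
  have hA1 : C * 4 ^ (d + 1) * ((ε * s) ^ 2 * Q'.size)
      * (pairLipschitz d C / (ε * s * Q'.size) * mm + 2 / (ε * Q'.size) * I)
      ≤ s * (C * 4 ^ (d + 1) * pairLipschitz d C * mm + 2 * (C * 4 ^ (d + 1)) * I) := by
    calc _ = C * 4 ^ (d + 1) * pairLipschitz d C * mm * (ε * s)
          + 2 * (C * 4 ^ (d + 1)) * I * (ε * s ^ 2) := by field_simp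
      _ ≤ C * 4 ^ (d + 1) * pairLipschitz d C * mm * (1 * s)
          + 2 * (C * 4 ^ (d + 1)) * I * (1 * s) := by gcongr
      _ = _ := by ring
  have hA2 : α * Q'.size ^ (d + 1) * (2 * (d + 2) * (((ε * s) ^ 2 * Q'.size) ^ (d + 1))⁻¹
      * (1 + 8 * c₀ / ε)) + factorBound d C * (c₀ / (ε * Q'.size))
        * (unitBallVolume d * 4 ^ (d + 1) * ((ε * s) ^ 2 * Q'.size))
      ≤ s * ((2 * (d + 2) * (1 + 8 * c₀ / ε)) / (ε ^ 2) ^ (d + 1) + E) := by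
    -- The exponent 2d + 3 = 2(d + 1) + 1 leaves exactly one factor s after division by s^(2(d+1)).
    have e1 : α * Q'.size ^ (d + 1) * (2 * (d + 2) * (((ε * s) ^ 2 * Q'.size) ^ (d + 1))⁻¹
        * (1 + 8 * c₀ / ε)) = s * ((2 * (d + 2) * (1 + 8 * c₀ / ε)) / (ε ^ 2) ^ (d + 1)) := by
      rw [← hsα, mul_pow, mul_pow, mul_pow, show 2 * d + 3 = 2 * (d + 1) + 1 by ring, pow_succ,
        pow_mul]
      field_simp
    have e2 : factorBound d C * (c₀ / (ε * Q'.size))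
        * (unitBallVolume d * 4 ^ (d + 1) * ((ε * s) ^ 2 * Q'.size)) = E * (ε * s ^ 2) := by
      rw [hE, approxRate]
      field_simp
    rw [e1, e2, mul_add s]
    refine add_le_add le_rfl ?_
    calc E * (ε * s ^ 2) ≤ E * (1 * s) := by gcongr
      _ = s * E := by ring
  rw [hsplit]
  refine (abs_add_le _ _).trans ((add_le_add (hcore.trans (add_le_add hA1
    (mul_le_mul_of_nonneg_right hA2 hI0))) hrest).trans ?_)
  have hI' : I ≤ (1 + 2 * E) * (mm + N) := by
    calc I ≤ N + 2 * E * s * mm := hI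
      _ ≤ N + 2 * E * 1 * mm := by gcongr
      _ ≤ _ := by nlinarith [mul_nonneg hE0 hN0]
  set X := (2 * (d + 2) * (1 + 8 * c₀ / ε)) / (ε ^ 2) ^ (d + 1) with hX
  have hX0 : 0 ≤ X := by positivity
  calc s * (C * 4 ^ (d + 1) * pairLipschitz d C * mm + 2 * (C * 4 ^ (d + 1)) * I)
        + s * (X + E) * I + 2 * E * s * N
      = s * (C * 4 ^ (d + 1) * pairLipschitz d C * mm
          + (2 * (C * 4 ^ (d + 1)) + X + E) * I + 2 * E * N) := by ring
    _ ≤ s * (C * 4 ^ (d + 1) * pairLipschitz d C * (mm + N)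
          + (2 * (C * 4 ^ (d + 1)) + X + E) * ((1 + 2 * E) * (mm + N)) + 2 * E * (mm + N)) := by
        gcongr <;> linarith
    _ = _ := by unfold pairConst; rw [← hX, ← hE]; ring

end DSLattice.Cell

/-! ### Interactions of nested cells: interior and boundary parts combined -/

namespace DSLattice.Cell

variable {d : ℕ} {C c : ℝ} {μ : Measure (Space d)} {D : DSLattice μ} {φ₀ : Space d → ℝ} {ε : ℝ}
  {H : Submodule ℝ (Space d)}

/-- The constant in the local `L²` bounds for the fields, down to the depth `2 J`. -/
noncomputable def fieldConst (d : ℕ) (C c c₀ : ℝ) (J : ℕ) : ℝ :=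
  2 * localBound d C c * (1 + (2 * J : ℕ)) ^ 2
    + 2 * (factorBound d C * unitBallVolume d * 4 ^ (d + 1) * ((8 * J + 14 : ℕ) + 1 + c₀)) ^ 2

theorem fieldConst_pos {c₀ : ℝ} (hC : 0 < C) (hc : 0 < c) (J : ℕ) :
    0 < fieldConst d C c c₀ J := by
  have := localBound_pos d hC hc
  unfold fieldConst; positivity

theorem setIntegral_field_sq_inter_le_fieldConst (hφ : IsUnitMollifier φ₀) (hε : 0 < ε)
    (hε' : ε < 1 / 48) (hd : 1 ≤ d) (hH : Module.finrank ℝ H = d) (hC : 0 < C)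
    (hc : 0 < c) (hμ : IsGoodMeasure C μ) (hl : IsLowerRegularIn Set.univ c μ)
    {Q : D.Cell} (hex : Q.SummandExists φ₀ ε H) {c₀ : ℝ} (hc₀ : 0 < c₀)
    (hL : ∀ (Q : D.Cell) (x x' : Space d),
      |Q.cutoff φ₀ ε x - Q.cutoff φ₀ ε x'| ≤ c₀ / (ε * Q.size) * ‖x - x'‖)
    {J : ℕ} (hJ : 8 ≤ 2 ^ (8 * J + 14) * ε) {F : Set (Set (Space d))} {n : ℤ}
    (hn : n ≤ Q.level + (2 * J : ℕ)) (hF : F ⊆ D.cells n) :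
    ∫ x in ⋃₀ F ∩ Q.carrier, ‖Q.field φ₀ ε H x‖ ^ 2 ∂μ
      ≤ fieldConst d C c c₀ J * μ.real (⋃₀ F ∩ Q.carrier) :=
  setIntegral_field_sq_inter_le hφ hε hε' hd hH hC hc hμ hl hex hn hF
    fun _ hx => norm_rieszApprox_le hφ hε hε' hd hH hC.le hμ.1 hc₀ (hL Q) hJ hx

theorem setIntegral_field_sq_le_fieldConst (hφ : IsUnitMollifier φ₀) (hε : 0 < ε)
    (hε' : ε < 1 / 48) (hd : 1 ≤ d) (hH : Module.finrank ℝ H = d) (hC : 0 < C)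
    (hc : 0 < c) (hμ : IsGoodMeasure C μ) (hl : IsLowerRegularIn Set.univ c μ)
    {Q : D.Cell} (hex : Q.SummandExists φ₀ ε H) {c₀ : ℝ} (hc₀ : 0 < c₀)
    (hL : ∀ (Q : D.Cell) (x x' : Space d),
      |Q.cutoff φ₀ ε x - Q.cutoff φ₀ ε x'| ≤ c₀ / (ε * Q.size) * ‖x - x'‖)
    {J : ℕ} (hJ : 8 ≤ 2 ^ (8 * J + 14) * ε) :
    ∫ x in Q.carrier, ‖Q.field φ₀ ε H x‖ ^ 2 ∂μ
      ≤ fieldConst d C c c₀ J * μ.real Q.carrier := by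
  have h := setIntegral_field_sq_inter_le_fieldConst hφ hε hε' hd hH hC hc hμ hl hex hc₀ hL hJ
    (F := {Q.carrier}) (n := Q.level) (by omega) (by simpa using Q.mem_cells)
  simpa using h

/-- The interaction of two nested cells. -/
noncomputable def interaction (φ₀ : Space d → ℝ) (ε : ℝ) (H : Submodule ℝ (Space d))
    (Q Q' : D.Cell) (x : Space d) : ℝ :=
  inner ℝ (Q.summand φ₀ ε H x - Q'.summand φ₀ ε H x) (Q'.summand φ₀ ε H x)

theorem memLp_summand (hφ : IsUnitMollifier φ₀) (hε : 0 < ε) (hε' : ε < 1 / 48)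
    (hd : 1 ≤ d) (hH : Module.finrank ℝ H = d) (hC : 0 ≤ C) (hμ : IsNiceMeasure C μ)
    {Q : D.Cell} (hex : Q.SummandExists φ₀ ε H) : MemLp (Q.summand φ₀ ε H) 2 μ := by
  have h1 : MemLp (Q.summand φ₀ ε H) 2 (μ.restrict Q.carrier) := by
    have h := memLp_field_restrict hφ hε hε' hd hH hC hμ hex
    refine h.of_le ((continuous_cutoff hφ hε Q).aestronglyMeasurable.smul h.1)
      (ae_of_all _ fun x => ?_)
    rw [summand_eq, norm_smul, Real.norm_eq_abs]
    exact mul_le_of_le_one_left (norm_nonneg _) (abs_cutoff_le_one hφ hε Q x)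
  have h2 := (memLp_indicator_iff_restrict Q.measurableSet).2 h1
  convert h2 using 1
  ext1 x
  by_cases hx : x ∈ Q.carrier
  · rw [Set.indicator_of_mem hx]
  · rw [Set.indicator_of_notMem hx, summand_eq, cutoff_eq_zero_of_notMem hφ hε hx, zero_smul]

theorem integrable_interaction (hφ : IsUnitMollifier φ₀) (hε : 0 < ε) (hε' : ε < 1 / 48)
    (hd : 1 ≤ d) (hH : Module.finrank ℝ H = d) (hC : 0 ≤ C) (hμ : IsNiceMeasure C μ)
    {Q Q' : D.Cell} (hex : Q.SummandExists φ₀ ε H) (hex' : Q'.SummandExists φ₀ ε H) :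
    Integrable (interaction φ₀ ε H Q Q') μ :=
  integrable_inner ((memLp_summand hφ hε hε' hd hH hC hμ hex).sub
    (memLp_summand hφ hε hε' hd hH hC hμ hex')) (memLp_summand hφ hε hε' hd hH hC hμ hex')

/-- Outside the boundary layers, the interaction is given by the interior part. -/
theorem abs_interaction_sub_le (hφ : IsUnitMollifier φ₀) (hε : 0 < ε)
    {Q Q' : D.Cell} (hQ : Q'.carrier ⊆ Q.carrier) (j : ℕ) {q : ℝ} (hq : 0 < q) {x : Space d}
    (hx : x ∈ Q'.carrier) (hxs : x ∈ μ.support) :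
    |interaction φ₀ ε H Q Q' x - inner ℝ (interiorCutoff ε Q Q' x •
        (Q.field φ₀ ε H x - Q'.field φ₀ ε H x)) (Q'.field φ₀ ε H x)|
      ≤ q / 2 * ‖Q.field φ₀ ε H x‖ ^ 2 + (1 + 1 / (2 * q)) *
        ((Q.boundaryLayer j (6 * ε * Q.size)).indicator (fun x => ‖Q'.field φ₀ ε H x‖ ^ 2) x
        + (Q'.boundaryLayer j (6 * ε * Q'.size)).indicator
          (fun x => ‖Q'.field φ₀ ε H x‖ ^ 2) x) := by
  have hsQ := mul_pos hε Q.size_pos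
  have hsQ' := mul_pos hε Q'.size_pos
  set f := Q.field φ₀ ε H x with hf
  set f' := Q'.field φ₀ ε H x with hf'
  set E := Q.boundaryLayer j (6 * ε * Q.size) with hE
  set E' := Q'.boundaryLayer j (6 * ε * Q'.size) with hE'
  have hi0 : ∀ S : Set (Space d), 0 ≤ S.indicator (fun x => ‖Q'.field φ₀ ε H x‖ ^ 2) x :=
    fun S => Set.indicator_nonneg (fun _ _ => sq_nonneg _) _
  have hint : interaction φ₀ ε H Q Q' x = inner ℝ (Q.cutoff φ₀ ε x • f - Q'.cutoff φ₀ ε x • f')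
      (Q'.cutoff φ₀ ε x • f') := rfl
  rw [hint]
  by_cases hxE : x ∈ E ∨ x ∈ E'
  · have h1 : |inner ℝ (Q.cutoff φ₀ ε x • f - Q'.cutoff φ₀ ε x • f') (Q'.cutoff φ₀ ε x • f')
        - inner ℝ (interiorCutoff ε Q Q' x • (f - f')) f'| ≤ (‖f‖ + ‖f'‖) * ‖f'‖ := by
      by_cases hθ : interiorCutoff ε Q Q' x = 0
      · rw [hθ, zero_smul, inner_zero_left, sub_zero]
        refine (abs_real_inner_le_norm _ _).trans ?_
        have hc1 : ∀ (Q : D.Cell) (v : Space d), ‖Q.cutoff φ₀ ε x • v‖ ≤ ‖v‖ := fun Q v => by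
          rw [norm_smul, Real.norm_eq_abs]
          exact mul_le_of_le_one_left (norm_nonneg _) (abs_cutoff_le_one hφ hε Q x)
        gcongr
        · exact (norm_sub_le _ _).trans (add_le_add (hc1 _ _) (hc1 _ _))
        · exact hc1 _ _
      -- Where the interior cutoff does not vanish both φ's are 1, and the discrepancy is (1 - θ)⟨f
      -- - f', f'⟩.
      · have hdep := depth_of_interiorCutoff_ne_zero hε hθ
        rw [cutoff_eq_one hφ hε (by linarith [hdep.1]), cutoff_eq_one hφ hε (by linarith [hdep.2]),
          one_smul, one_smul, real_inner_smul_left, ← one_sub_mul, abs_mul]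
        have hθ0 := interiorCutoff_nonneg (ε := ε) (Q := Q) (Q' := Q') x
        have hθ1 := interiorCutoff_le_one (ε := ε) (Q := Q) (Q' := Q') x
        refine (mul_le_of_le_one_left (abs_nonneg _)
          (by rw [abs_le]; constructor <;> linarith)).trans ?_
        refine (abs_real_inner_le_norm _ _).trans ?_
        gcongr
        exact norm_sub_le _ _
    have h2 : ‖f'‖ ^ 2 ≤ E.indicator (fun x => ‖Q'.field φ₀ ε H x‖ ^ 2) x
        + E'.indicator (fun x => ‖Q'.field φ₀ ε H x‖ ^ 2) x := by
      rcases hxE with h | h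
      · rw [Set.indicator_of_mem h]
        linarith [hi0 E']
      · rw [Set.indicator_of_mem h]
        linarith [hi0 E]
    refine h1.trans ?_
    -- The weight is asymmetric: f is not localized and gets the small coefficient, while f' gets
    -- the large one but is restricted to the layers, whose measure will be of order q².
    have h3 : ‖f‖ * ‖f'‖ ≤ q / 2 * ‖f‖ ^ 2 + 1 / (2 * q) * ‖f'‖ ^ 2 := by
      have h4 : q / 2 * ‖f‖ ^ 2 + 1 / (2 * q) * ‖f'‖ ^ 2 - ‖f‖ * ‖f'‖
          = (q * ‖f‖ - ‖f'‖) ^ 2 / (2 * q) := by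
        field_simp
        ring
      have h5 : 0 ≤ (q * ‖f‖ - ‖f'‖) ^ 2 / (2 * q) := by positivity
      linarith
    calc (‖f‖ + ‖f'‖) * ‖f'‖ = ‖f‖ * ‖f'‖ + ‖f'‖ ^ 2 := by ring
      _ ≤ q / 2 * ‖f‖ ^ 2 + (1 + 1 / (2 * q)) * ‖f'‖ ^ 2 := by linarith
      _ ≤ _ := by gcongr
  · push Not at hxE
    have d1 : 6 * ε * Q.size ≤ Q.depth x := by
      by_contra h
      exact hxE.1 (mem_boundaryLayer j (hQ hx) hxs (not_le.1 h))
    have d2 : 6 * ε * Q'.size ≤ Q'.depth x := by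
      by_contra h
      exact hxE.2 (mem_boundaryLayer j hx hxs (not_le.1 h))
    rw [interiorCutoff_eq_one hε d1 d2, cutoff_eq_one hφ hε (by linarith),
      cutoff_eq_one hφ hε (by linarith), one_smul, one_smul, one_smul, sub_self, abs_zero]
    have := hi0 E
    have := hi0 E'
    positivity

/-- The bound for the interaction of two nested cells. -/
theorem abs_integral_interaction_le (hφ : IsUnitMollifier φ₀) (hε : 0 < ε) (hε' : ε < 1 / 48)
    (hd : 1 ≤ d) (hH : Module.finrank ℝ H = d) (hC : 0 < C) (hc : 0 < c)
    (hμ : IsGoodMeasure C μ) (hl : IsLowerRegularIn Set.univ c μ)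
    {Q Q' : D.Cell} (hQ : Q'.carrier ⊆ Q.carrier) (hex : Q.SummandExists φ₀ ε H)
    (hex' : Q'.SummandExists φ₀ ε H) {c₀ : ℝ} (hc₀ : 0 < c₀)
    (hL : ∀ (Q : D.Cell) (x x' : Space d),
      |Q.cutoff φ₀ ε x - Q.cutoff φ₀ ε x'| ≤ c₀ / (ε * Q.size) * ‖x - x'‖)
    {s A α : ℝ} (hs : 0 < s) (hs1 : s ≤ 1) (hsα : s ^ (2 * d + 3) = α) (hA : 5 < A)
    (hflat : Q'.IsFlat H A α) {J : ℕ} (hJ : 8 ≤ 2 ^ (8 * J + 14) * ε)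
    (hJ' : 256 ^ J * (6 * ε) ≤ 1) {q : ℝ} (hq : 0 < q) :
    |∫ x, interaction φ₀ ε H Q Q' x ∂μ|
      ≤ (q / 2 + s * pairConst d C c₀ ε / 2) * ∫ x in Q'.carrier, ‖Q.field φ₀ ε H x‖ ^ 2 ∂μ
        + (1 + 1 / (2 * q)) * fieldConst d C c c₀ J
          * (μ.real (Q.boundaryLayer (2 * J) (6 * ε * Q.size) ∩ Q'.carrier)
            + (boundaryRate d C c ^ 2) ^ J * μ.real Q'.carrier)
        + s * pairConst d C c₀ ε * (2 + fieldConst d C c c₀ J / 2) * μ.real Q'.carrier := by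
  have hlf := hμ.1.isLocallyFinite
  have hfin := Q'.measure_lt_top hμ.1
  have hsQ := mul_pos hε Q.size_pos
  have hsQ' := mul_pos hε Q'.size_pos
  have hfinm : IsFiniteMeasure (μ.restrict Q'.carrier) :=
    ⟨by rw [Measure.restrict_apply_univ]; exact hfin⟩
  have hK := fieldConst_pos (d := d) (c₀ := c₀) hC hc J
  have hpc := pairConst_nonneg (d := d) hC.le hc₀ hε
  set f := Q.field φ₀ ε H with hf
  set f' := Q'.field φ₀ ε H with hf'
  set E := Q.boundaryLayer (2 * J) (6 * ε * Q.size) with hE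
  set E' := Q'.boundaryLayer (2 * J) (6 * ε * Q'.size) with hE'
  have hEm : MeasurableSet E := Q.measurableSet_boundaryLayer _ _
  have hE'm : MeasurableSet E' := Q'.measurableSet_boundaryLayer _ _
  have hf2 : MemLp f 2 (μ.restrict Q'.carrier) :=
    (memLp_field_restrict hφ hε hε' hd hH hC.le hμ.1 hex).mono_measure
      (Measure.restrict_mono hQ le_rfl)
  have hf'2 : MemLp f' 2 (μ.restrict Q'.carrier) :=
    memLp_field_restrict hφ hε hε' hd hH hC.le hμ.1 hex'
  have hfsq : IntegrableOn (fun x => ‖f x‖ ^ 2) Q'.carrier μ := integrable_norm_sq hf2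
  have hf'sq : IntegrableOn (fun x => ‖f' x‖ ^ 2) Q'.carrier μ := integrable_norm_sq hf'2
  have hθ2 : MemLp (fun x => interiorCutoff ε Q Q' x • (f x - f' x)) 2
      (μ.restrict Q'.carrier) := by
    have hg := hf2.sub hf'2
    refine hg.of_le (continuous_interiorCutoff.aestronglyMeasurable.smul hg.1)
      (ae_of_all _ fun x => ?_)
    rw [norm_smul, Real.norm_of_nonneg (interiorCutoff_nonneg x)]
    exact mul_le_of_le_one_left (norm_nonneg _) (interiorCutoff_le_one x)
  have hin := (integrable_interaction hφ hε hε' hd hH hC.le hμ.1 hex hex').integrableOn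
    (s := Q'.carrier)
  have hmain := abs_integral_interior_le hφ hε hε' hd hH hC hμ hQ hex hex' hc₀ hL hs hs1 hsα hA
    hflat
  have h0 : ∫ x, interaction φ₀ ε H Q Q' x ∂μ = ∫ x in Q'.carrier, interaction φ₀ ε H Q Q' x ∂μ := by
    rw [setIntegral_eq_integral_of_forall_compl_eq_zero]
    intro x hx
    rw [interaction, summand_eq Q', cutoff_eq_zero_of_notMem hφ hε hx, zero_smul, inner_zero_right]
  have herr : |∫ x in Q'.carrier, (interaction φ₀ ε H Q Q' x
      - inner ℝ (interiorCutoff ε Q Q' x • (f x - f' x)) (f' x)) ∂μ|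
      ≤ q / 2 * ∫ x in Q'.carrier, ‖f x‖ ^ 2 ∂μ + (1 + 1 / (2 * q)) *
        (∫ x in E ∩ Q'.carrier, ‖f' x‖ ^ 2 ∂μ + ∫ x in E' ∩ Q'.carrier, ‖f' x‖ ^ 2 ∂μ) := by
    have i1 : IntegrableOn (E.indicator fun x => ‖f' x‖ ^ 2) Q'.carrier μ := hf'sq.indicator hEm
    have i2 : IntegrableOn (E'.indicator fun x => ‖f' x‖ ^ 2) Q'.carrier μ := hf'sq.indicator hE'm
    have hle : |∫ x in Q'.carrier, (interaction φ₀ ε H Q Q' x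
        - inner ℝ (interiorCutoff ε Q Q' x • (f x - f' x)) (f' x)) ∂μ|
        ≤ ∫ x in Q'.carrier, (q / 2 * ‖f x‖ ^ 2 + (1 + 1 / (2 * q)) *
          (E.indicator (fun x => ‖f' x‖ ^ 2) x + E'.indicator (fun x => ‖f' x‖ ^ 2) x)) ∂μ := by
      refine abs_integral_le_integral_abs.trans (integral_mono_of_nonneg
        (ae_of_all _ fun _ => abs_nonneg _)
        ((hfsq.const_mul _).add ((i1.add i2).const_mul _)) ?_)
      refine (ae_restrict_iff' Q'.measurableSet).2 ?_
      filter_upwards [Measure.support_mem_ae (μ := μ)] with x hxs hx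
      exact abs_interaction_sub_le hφ hε hQ (2 * J) hq hx hxs
    refine hle.trans (le_of_eq ?_)
    have s1 := integral_add (hfsq.const_mul (q / 2)) ((i1.add i2).const_mul (1 + 1 / (2 * q)))
    simp only [Pi.add_apply] at s1
    rw [s1, integral_const_mul, integral_const_mul, integral_add i1 i2, integral_indicator hEm,
      integral_indicator hE'm, Measure.restrict_restrict hEm, Measure.restrict_restrict hE'm]
  have hlevel := level_le_of_subset hQ
  -- The layer of Q consists of cells 2J levels below Q, hence at most 2J levels below Q', but
  -- possibly larger than Q'.
  have b1 : ∫ x in E ∩ Q'.carrier, ‖f' x‖ ^ 2 ∂μ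
      ≤ fieldConst d C c c₀ J * μ.real (E ∩ Q'.carrier) :=
    setIntegral_field_sq_inter_le_fieldConst hφ hε hε' hd hH hC hc hμ hl hex' hc₀ hL hJ
      (F := Q.boundaryFamily (2 * J) (6 * ε * Q.size)) (n := Q.level + (2 * J : ℕ)) (by omega)
      fun _ h => h.1
  have b2 : ∫ x in E' ∩ Q'.carrier, ‖f' x‖ ^ 2 ∂μ
      ≤ fieldConst d C c c₀ J * ((boundaryRate d C c ^ 2) ^ J * μ.real Q'.carrier) := by
    refine (setIntegral_field_sq_inter_le_fieldConst hφ hε hε' hd hH hC hc hμ hl hex' hc₀ hL hJ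
      (F := Q'.boundaryFamily (2 * J) (6 * ε * Q'.size)) (n := Q'.level + (2 * J : ℕ)) le_rfl
      fun _ h => h.1).trans ?_
    gcongr
    refine (measureReal_mono Set.inter_subset_left ?_).trans
      (Q'.measureReal_boundaryLayer_le hC hc hμ.1 hl J (by linarith) ?_)
    · exact ((measure_mono (Q'.boundaryLayer_subset _ _)).trans_lt hfin).ne
    · calc 256 ^ J * (6 * ε * Q'.size) = (256 ^ J * (6 * ε)) * Q'.size := by ring
        _ ≤ 1 * Q'.size := by gcongr; exact Q'.size_pos.le
        _ = _ := one_mul _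
  have b3 := setIntegral_field_sq_le_fieldConst hφ hε hε' hd hH hC hc hμ hl hex' hc₀ hL hJ
  -- From t ≤ (1 + t²)/2, so that only squared norms remain and can be added over Q'.
  have hN : ∫ x in Q'.carrier, (‖f x‖ + ‖f' x‖) ∂μ ≤ μ.real Q'.carrier
      + (∫ x in Q'.carrier, ‖f x‖ ^ 2 ∂μ) / 2 + (∫ x in Q'.carrier, ‖f' x‖ ^ 2 ∂μ) / 2 := by
    have i0 : IntegrableOn (fun _ => (1 : ℝ)) Q'.carrier μ := integrableOn_const hfin.ne
    have s1 := integral_add (i0.add (hfsq.div_const 2)) (hf'sq.div_const 2)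
    have s2 := integral_add i0 (hfsq.div_const 2)
    simp only [Pi.add_apply] at s1
    rw [s2, setIntegral_const, smul_eq_mul, mul_one, integral_div, integral_div] at s1
    rw [← s1]
    refine integral_mono ((hf2.integrable (by norm_num)).norm.add
      (hf'2.integrable (by norm_num)).norm)
      ((i0.add (hfsq.div_const 2)).add (hf'sq.div_const 2)) fun x => ?_
    simp only
    have := sq_nonneg (‖f x‖ - 1)
    have := sq_nonneg (‖f' x‖ - 1)
    linarith
  have hsplit : ∫ x, interaction φ₀ ε H Q Q' x ∂μ
      = ∫ x in Q'.carrier, (interaction φ₀ ε H Q Q' x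
        - inner ℝ (interiorCutoff ε Q Q' x • (f x - f' x)) (f' x)) ∂μ
        + ∫ x in Q'.carrier, inner ℝ (interiorCutoff ε Q Q' x • (f x - f' x)) (f' x) ∂μ := by
    rw [h0, integral_sub hin (integrable_inner hθ2 hf'2), sub_add_cancel]
  rw [hsplit]
  refine (abs_add_le _ _).trans ((add_le_add herr hmain).trans ?_)
  have hq' : 0 ≤ 1 + 1 / (2 * q) := by positivity
  calc q / 2 * ∫ x in Q'.carrier, ‖f x‖ ^ 2 ∂μ + (1 + 1 / (2 * q)) *
        (∫ x in E ∩ Q'.carrier, ‖f' x‖ ^ 2 ∂μ + ∫ x in E' ∩ Q'.carrier, ‖f' x‖ ^ 2 ∂μ)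
        + s * pairConst d C c₀ ε * (μ.real Q'.carrier + ∫ x in Q'.carrier, (‖f x‖ + ‖f' x‖) ∂μ)
      ≤ q / 2 * ∫ x in Q'.carrier, ‖f x‖ ^ 2 ∂μ + (1 + 1 / (2 * q)) *
        (fieldConst d C c c₀ J * μ.real (E ∩ Q'.carrier)
          + fieldConst d C c c₀ J * ((boundaryRate d C c ^ 2) ^ J * μ.real Q'.carrier))
        + s * pairConst d C c₀ ε * (μ.real Q'.carrier + (μ.real Q'.carrier
          + (∫ x in Q'.carrier, ‖f x‖ ^ 2 ∂μ) / 2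
          + (fieldConst d C c c₀ J * μ.real Q'.carrier) / 2)) := by
        gcongr
        exact hN.trans (by gcongr)
    _ = _ := by ring

/-- The bound for the total interaction of a cell with disjoint flat subcells. -/
theorem sum_abs_integral_interaction_le (hφ : IsUnitMollifier φ₀) (hε : 0 < ε) (hε' : ε < 1 / 48)
    (hd : 1 ≤ d) (hH : Module.finrank ℝ H = d) (hC : 0 < C) (hc : 0 < c)
    (hμ : IsGoodMeasure C μ) (hl : IsLowerRegularIn Set.univ c μ) {c₀ : ℝ} (hc₀ : 0 < c₀)
    (hL : ∀ (Q : D.Cell) (x x' : Space d),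
      |Q.cutoff φ₀ ε x - Q.cutoff φ₀ ε x'| ≤ c₀ / (ε * Q.size) * ‖x - x'‖)
    {s A α : ℝ} (hs : 0 < s) (hs1 : s ≤ 1) (hsα : s ^ (2 * d + 3) = α) (hA : 5 < A)
    {J : ℕ} (hJ : 8 ≤ 2 ^ (8 * J + 14) * ε) (hJ' : 256 ^ J * (6 * ε) ≤ 1)
    (Q : D.Cell) (S : Finset D.Cell) (hSQ : ∀ Q' ∈ S, Q'.carrier ⊆ Q.carrier)
    (hdisj : (S : Set D.Cell).PairwiseDisjoint carrier) (hflat : ∀ Q' ∈ S, Q'.IsFlat H A α) :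
    ∑ Q' ∈ S, |∫ x, interaction φ₀ ε H Q Q' x ∂μ|
      ≤ (4 * fieldConst d C c c₀ J * boundaryRate d C c ^ J
        + s * (pairConst d C c₀ ε * (2 + fieldConst d C c c₀ J))) * μ.real Q.carrier := by
  have hfin := Q.measure_lt_top hμ.1
  have hsQ := mul_pos hε Q.size_pos
  have hK := fieldConst_pos (d := d) (c₀ := c₀) hC hc J
  have hpc := pairConst_nonneg (d := d) hC.le hc₀ hε
  have hex := fun Q : D.Cell => Q.summandExists hφ hε hε' hd hH hC.le hμ
  set K := fieldConst d C c c₀ J with hKdef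
  set p := pairConst d C c₀ ε with hp
  -- The layers have relative measure at most q², so the weight q balances the two sides: q from f,
  -- and q²/q from f'.
  set q := boundaryRate d C c ^ J with hq
  have hq0 : 0 < q := pow_pos (boundaryRate_pos d C c) J
  have hq1 : q ≤ 1 := pow_le_one₀ (boundaryRate_pos d C c).le (boundaryRate_lt_one d hC hc).le
  have hq2 : (boundaryRate d C c ^ 2) ^ J = q ^ 2 := by rw [hq, ← pow_mul, ← pow_mul, mul_comm]
  set E := Q.boundaryLayer (2 * J) (6 * ε * Q.size) with hE
  have hm : ∀ Q' ∈ S, MeasurableSet Q'.carrier := fun Q' _ => Q'.measurableSet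
  have hsub : ⋃ Q' ∈ S, Q'.carrier ⊆ Q.carrier := Set.iUnion₂_subset hSQ
  have hfsq : IntegrableOn (fun x => ‖Q.field φ₀ ε H x‖ ^ 2) Q.carrier μ :=
    integrable_norm_sq (memLp_field_restrict hφ hε hε' hd hH hC.le hμ.1 (hex Q))
  -- Only the sum over the disjoint subcells is bounded; no bound on a single Q' uniform in its
  -- depth is needed.
  have t1 : ∑ Q' ∈ S, ∫ x in Q'.carrier, ‖Q.field φ₀ ε H x‖ ^ 2 ∂μ ≤ K * μ.real Q.carrier := by
    rw [← integral_biUnion_finset S hm hdisj fun Q' hQ' => hfsq.mono_set (hSQ Q' hQ')]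
    exact (setIntegral_mono_set hfsq (ae_of_all _ fun _ => sq_nonneg _) hsub.eventuallyLE).trans
      (setIntegral_field_sq_le_fieldConst hφ hε hε' hd hH hC hc hμ hl (hex Q) hc₀ hL hJ)
  have t2 : ∑ Q' ∈ S, μ.real Q'.carrier ≤ μ.real Q.carrier := by
    rw [← measureReal_biUnion_finset hdisj hm fun Q' _ => (Q'.measure_lt_top hμ.1).ne]
    exact measureReal_mono hsub hfin.ne
  have t3 : ∑ Q' ∈ S, μ.real (E ∩ Q'.carrier) ≤ q ^ 2 * μ.real Q.carrier := by
    have hEfin : μ E ≠ ∞ := ((measure_mono (Q.boundaryLayer_subset _ _)).trans_lt hfin).ne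
    rw [← measureReal_biUnion_finset (f := fun Q' : D.Cell => E ∩ Q'.carrier)
      (fun a ha b hb hab => (hdisj ha hb hab).mono Set.inter_subset_right Set.inter_subset_right)
      (fun Q' _ => (Q.measurableSet_boundaryLayer _ _).inter Q'.measurableSet)
      fun Q' _ => ((measure_mono Set.inter_subset_right).trans_lt (Q'.measure_lt_top hμ.1)).ne]
    refine (measureReal_mono (Set.iUnion₂_subset fun _ _ => Set.inter_subset_left) hEfin).trans ?_
    rw [← hq2]
    refine Q.measureReal_boundaryLayer_le hC hc hμ.1 hl J (by linarith) ?_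
    calc 256 ^ J * (6 * ε * Q.size) = (256 ^ J * (6 * ε)) * Q.size := by ring
      _ ≤ 1 * Q.size := by gcongr; exact Q.size_pos.le
      _ = _ := one_mul _
  have hmm : 0 ≤ μ.real Q.carrier := measureReal_nonneg
  calc ∑ Q' ∈ S, |∫ x, interaction φ₀ ε H Q Q' x ∂μ|
      ≤ ∑ Q' ∈ S, ((q / 2 + s * p / 2) * ∫ x in Q'.carrier, ‖Q.field φ₀ ε H x‖ ^ 2 ∂μ
        + (1 + 1 / (2 * q)) * K * (μ.real (E ∩ Q'.carrier) + q ^ 2 * μ.real Q'.carrier)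
        + s * p * (2 + K / 2) * μ.real Q'.carrier) := by
        refine Finset.sum_le_sum fun Q' hQ' => ?_
        rw [← hq2]
        exact abs_integral_interaction_le hφ hε hε' hd hH hC hc hμ hl (hSQ Q' hQ') (hex Q)
          (hex Q') hc₀ hL hs hs1 hsα hA (hflat Q' hQ') hJ hJ' hq0
    _ = (q / 2 + s * p / 2) * ∑ Q' ∈ S, ∫ x in Q'.carrier, ‖Q.field φ₀ ε H x‖ ^ 2 ∂μ
        + (1 + 1 / (2 * q)) * K * (∑ Q' ∈ S, μ.real (E ∩ Q'.carrier)
          + q ^ 2 * ∑ Q' ∈ S, μ.real Q'.carrier)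
        + s * p * (2 + K / 2) * ∑ Q' ∈ S, μ.real Q'.carrier := by
        simp only [Finset.sum_add_distrib, Finset.mul_sum, mul_add]
    _ ≤ (q / 2 + s * p / 2) * (K * μ.real Q.carrier)
        + (1 + 1 / (2 * q)) * K * (q ^ 2 * μ.real Q.carrier + q ^ 2 * μ.real Q.carrier)
        + s * p * (2 + K / 2) * μ.real Q.carrier := by gcongr
    _ = (K * (q / 2 + 2 * q ^ 2 + q) + s * (p * (2 + K))) * μ.real Q.carrier := by
        field_simp
        ring
    _ ≤ _ := by
        refine mul_le_mul_of_nonneg_right (add_le_add ?_ le_rfl) hmm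
        have hq4 : q / 2 + 2 * q ^ 2 + q ≤ 4 * q := by
          nlinarith [mul_le_of_le_one_right hq0.le hq1]
        calc K * (q / 2 + 2 * q ^ 2 + q) ≤ K * (4 * q) := by gcongr
          _ = _ := by ring

end DSLattice.Cell

/-! ### Summation over the layers -/

namespace DSLattice

variable {d : ℕ} {C c : ℝ} {μ : Measure (Space d)} {D : DSLattice μ} {φ₀ : Space d → ℝ} {ε : ℝ}
  {H : Submodule ℝ (Space d)}

theorem summand_eq_zero_of_notMem (hφ : IsUnitMollifier φ₀) (hε : 0 < ε) {Q : D.Cell}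
    {x : Space d} (hx : x ∉ Q.carrier) : Q.summand φ₀ ε H x = 0 := by
  rw [Cell.summand_eq, Cell.cutoff_eq_zero_of_notMem hφ hε hx, zero_smul]

theorem layerG_eq_of_mem (hφ : IsUnitMollifier φ₀) (hε : 0 < ε) {𝔔 : ℕ → Finset D.Cell} {k : ℕ}
    (hdisj : (𝔔 k : Set D.Cell).PairwiseDisjoint Cell.carrier) {Q : D.Cell} (hQ : Q ∈ 𝔔 k)
    {x : Space d} (hx : x ∈ Q.carrier) : D.layerG φ₀ ε H 𝔔 k x = Q.summand φ₀ ε H x := by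
  refine Finset.sum_eq_single_of_mem Q hQ fun Q' hQ' hne => ?_
  exact summand_eq_zero_of_notMem hφ hε fun hx' =>
    Set.disjoint_left.1 (hdisj hQ' hQ hne) hx' hx

theorem IsAlternatingLayers.exists_parent {ℱ : Set D.Cell} {A α η : ℝ} {K : ℕ} {P : D.Cell}
    {𝔓 𝔔 : ℕ → Finset D.Cell} (h : D.IsAlternatingLayers ℱ H A α K η P 𝔓 𝔔) {k : ℕ} (hk : k < K)
    {Q' : D.Cell} (hQ' : Q' ∈ 𝔔 (k + 1)) : ∃ Q ∈ 𝔔 k, Q'.carrier ⊆ Q.carrier := by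
  obtain ⟨P', hP', h1⟩ := h.flat_subset (k + 1) hk Q' hQ'
  obtain ⟨Q, hQ, h2⟩ := h.nonBAUP_subset k hk P' hP'
  exact ⟨Q, hQ, h1.trans h2⟩

theorem IsAlternatingLayers.sum_measureReal_le {ℱ : Set D.Cell} {A α η : ℝ} {K : ℕ} {P : D.Cell}
    {𝔓 𝔔 : ℕ → Finset D.Cell} (h : D.IsAlternatingLayers ℱ H A α K η P 𝔓 𝔔)
    (hμ : IsNiceMeasure C μ) {k : ℕ} (hk : k ≤ K) :
    ∑ Q ∈ 𝔔 k, μ.real Q.carrier ≤ μ.real P.carrier := by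
  rw [← measureReal_biUnion_finset (h.disjoint_flat k hk) (fun Q _ => Q.measurableSet)
    fun Q _ => (Q.measure_lt_top hμ).ne]
  refine measureReal_mono (Set.iUnion₂_subset fun Q hQ => ?_) (P.measure_lt_top hμ).ne
  obtain ⟨P', hP', h1⟩ := h.flat_subset k hk Q hQ
  exact h1.trans (h.nonBAUP k hk P' hP').2

/-- The almost orthogonality estimate, for an admissible choice of the auxiliary parameters. -/
theorem IsAlternatingLayers.integral_layer_le (hφ : IsUnitMollifier φ₀) (hε : 0 < ε)
    (hε' : ε < 1 / 48) (hd : 1 ≤ d) (hH : Module.finrank ℝ H = d) (hC : 0 < C) (hc : 0 < c)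
    (hμ : IsGoodMeasure C μ) (hl : IsLowerRegularIn Set.univ c μ) {c₀ : ℝ} (hc₀ : 0 < c₀)
    (hL : ∀ (Q : D.Cell) (x x' : Space d),
      |Q.cutoff φ₀ ε x - Q.cutoff φ₀ ε x'| ≤ c₀ / (ε * Q.size) * ‖x - x'‖)
    {s A α η : ℝ} (hs : 0 < s) (hs1 : s ≤ 1) (hsα : s ^ (2 * d + 3) = α) (hA : 5 < A)
    {J : ℕ} (hJ : 8 ≤ 2 ^ (8 * J + 14) * ε) (hJ' : 256 ^ J * (6 * ε) ≤ 1)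
    {ℱ : Set D.Cell} {K : ℕ} {P : D.Cell} {𝔓 𝔔 : ℕ → Finset D.Cell}
    (h : D.IsAlternatingLayers ℱ H A α K η P 𝔓 𝔔) {k : ℕ} (hk : k < K) :
    Integrable (fun x => inner ℝ (D.layerF φ₀ ε H 𝔔 K k x) (D.layerG φ₀ ε H 𝔔 (k + 1) x)) μ ∧
      |∫ x, inner ℝ (D.layerF φ₀ ε H 𝔔 K k x) (D.layerG φ₀ ε H 𝔔 (k + 1) x) ∂μ|
        ≤ (4 * Cell.fieldConst d C c c₀ J * Cell.boundaryRate d C c ^ J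
          + s * (Cell.pairConst d C c₀ ε * (2 + Cell.fieldConst d C c c₀ J)))
            * μ.real P.carrier := by
  classical
  have hex := fun Q : D.Cell => Q.summandExists hφ hε hε' hd hH hC.le hμ
  -- The parent map is made total by a default value outside the layer.
  have hpar : ∀ Q' : D.Cell, ∃ Q : D.Cell, Q' ∈ 𝔔 (k + 1) → Q ∈ 𝔔 k ∧ Q'.carrier ⊆ Q.carrier := by
    intro Q'
    by_cases hQ' : Q' ∈ 𝔔 (k + 1)
    · obtain ⟨Q, hQ⟩ := h.exists_parent hk hQ'
      exact ⟨Q, fun _ => hQ⟩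
    · exact ⟨Q', fun h' => absurd h' hQ'⟩
  choose par hpar using hpar
  -- At a point of Q' disjointness leaves only the parent's term in G_k and the term of Q' in
  -- G_{k+1}; off Q' the summand of Q' vanishes.
  have hpt : ∀ x, inner ℝ (D.layerF φ₀ ε H 𝔔 K k x) (D.layerG φ₀ ε H 𝔔 (k + 1) x)
      = ∑ Q' ∈ 𝔔 (k + 1), Cell.interaction φ₀ ε H (par Q') Q' x := by
    intro x
    conv_lhs => rw [layerG, inner_sum]
    refine Finset.sum_congr rfl fun Q' hQ' => ?_
    by_cases hx : x ∈ Q'.carrier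
    · rw [layerF, if_pos hk, layerG_eq_of_mem hφ hε (h.disjoint_flat k hk.le) (hpar Q' hQ').1
        ((hpar Q' hQ').2 hx), layerG_eq_of_mem hφ hε (h.disjoint_flat (k + 1) hk) hQ' hx]
      rfl
    · rw [Cell.interaction, summand_eq_zero_of_notMem hφ hε hx, inner_zero_right, inner_zero_right]
  simp_rw [hpt]
  have hint : ∀ Q' ∈ 𝔔 (k + 1), Integrable (Cell.interaction φ₀ ε H (par Q') Q') μ := fun Q' _ =>
    Cell.integrable_interaction hφ hε hε' hd hH hC.le hμ.1 (hex _) (hex _)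
  refine ⟨integrable_finsetSum _ hint, ?_⟩
  rw [integral_finsetSum _ hint]
  refine (Finset.abs_sum_le_sum_abs _ _).trans ?_
  -- Grouping by parent produces, for each Q, a disjoint family of flat subcells.
  rw [← Finset.sum_fiberwise_of_maps_to (g := par) (t := 𝔔 k) fun Q' hQ' => (hpar Q' hQ').1]
  set σ := 4 * Cell.fieldConst d C c c₀ J * Cell.boundaryRate d C c ^ J
    + s * (Cell.pairConst d C c₀ ε * (2 + Cell.fieldConst d C c c₀ J)) with hσ
  have hσ0 : 0 ≤ σ := by
    have := Cell.fieldConst_pos (d := d) (c₀ := c₀) hC hc J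
    have := Cell.pairConst_nonneg (d := d) hC.le hc₀ hε
    have := Cell.boundaryRate_pos d C c
    positivity
  calc ∑ Q ∈ 𝔔 k, ∑ Q' ∈ 𝔔 (k + 1) with par Q' = Q,
        |∫ x, Cell.interaction φ₀ ε H (par Q') Q' x ∂μ|
      ≤ ∑ Q ∈ 𝔔 k, σ * μ.real Q.carrier := by
        refine Finset.sum_le_sum fun Q hQ => ?_
        have e : ∑ Q' ∈ 𝔔 (k + 1) with par Q' = Q,
            |∫ x, Cell.interaction φ₀ ε H (par Q') Q' x ∂μ|
            = ∑ Q' ∈ 𝔔 (k + 1) with par Q' = Q,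
            |∫ x, Cell.interaction φ₀ ε H Q Q' x ∂μ| :=
          Finset.sum_congr rfl fun Q' hQ' => by rw [(Finset.mem_filter.1 hQ').2]
        rw [e]
        refine Cell.sum_abs_integral_interaction_le hφ hε hε' hd hH hC hc hμ hl hc₀ hL hs hs1 hsα
          hA hJ hJ' Q _ (fun Q' hQ' => ?_) ?_ fun Q' hQ' => ?_
        · rw [Finset.mem_filter] at hQ'
          rw [← hQ'.2]
          exact (hpar Q' hQ'.1).2
        · exact (h.disjoint_flat (k + 1) hk).subset (by
            intro Q' hQ'
            exact Finset.filter_subset _ _ hQ')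
        · exact h.flat (k + 1) hk Q' (Finset.mem_filter.1 hQ').1
    _ = σ * ∑ Q ∈ 𝔔 k, μ.real Q.carrier := (Finset.mul_sum _ _ _).symm
    _ ≤ σ * μ.real P.carrier := by
        gcongr
        exact h.sum_measureReal_le hμ.1 hk.le

/-! ### The choice of parameters -/

/-- The depth of the boundary layers as a function of `ε`. -/
noncomputable def layerDepth (ε : ℝ) : ℕ := Nat.log 256 ⌊(6 * ε)⁻¹⌋₊

theorem pow_layerDepth_mul_le (hε : 0 < ε) (hε' : ε < 1 / 48) :
    256 ^ layerDepth ε * (6 * ε) ≤ 1 := by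
  have h1 : 1 ≤ (6 * ε)⁻¹ := (one_le_inv₀ (by positivity)).2 (by linarith)
  have h2 : ⌊(6 * ε)⁻¹⌋₊ ≠ 0 := (Nat.floor_pos.2 h1).ne'
  have h3 : 256 ^ layerDepth ε ≤ ⌊(6 * ε)⁻¹⌋₊ := Nat.pow_log_le_self 256 h2
  have h4 : ((256 ^ layerDepth ε : ℕ) : ℝ) ≤ (6 * ε)⁻¹ :=
    (Nat.cast_le.2 h3).trans (Nat.floor_le (by positivity))
  push_cast at h4
  calc (256 : ℝ) ^ layerDepth ε * (6 * ε) ≤ (6 * ε)⁻¹ * (6 * ε) := by gcongr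
    _ = 1 := inv_mul_cancel₀ (by positivity)

/-- Maximality of the depth J gives 256^(J+1) · 6ε > 1, that is 256^J ε > 1/1536, and 2^14/1536 > 8;
this explains the offset 14. -/
theorem le_pow_layerDepth_mul (hε : 0 < ε) : 8 ≤ 2 ^ (8 * layerDepth ε + 14) * ε := by
  have h1 : ⌊(6 * ε)⁻¹⌋₊ < 256 ^ (layerDepth ε + 1) := Nat.lt_pow_succ_log_self (by norm_num) _
  have h2 : (6 * ε)⁻¹ < (256 ^ (layerDepth ε + 1) : ℕ) := (Nat.floor_lt (by positivity)).1 h1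
  rw [inv_lt_iff_one_lt_mul₀ (by positivity)] at h2
  push_cast at h2
  rw [pow_succ] at h2
  rw [pow_add, pow_mul]
  norm_num at h2 ⊢
  nlinarith

theorem tendsto_layerDepth : Tendsto layerDepth (𝓝[>] 0) atTop := by
  have h1 : Tendsto (fun ε : ℝ => (6 * ε)⁻¹) (𝓝[>] 0) atTop := by
    have : (fun ε : ℝ => (6 * ε)⁻¹) = fun ε => 6⁻¹ * ε⁻¹ := by
      ext ε; rw [mul_inv]
    rw [this]
    exact tendsto_inv_nhdsGT_zero.const_mul_atTop (by norm_num)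
  have h2 : Tendsto (Nat.log 256) atTop atTop :=
    tendsto_atTop_mono' _ (Eventually.of_forall fun _ => le_rfl)
      (tendsto_atTop.2 fun b => eventually_atTop.2 ⟨256 ^ b, fun n hn =>
        Nat.le_log_of_pow_le (by norm_num) hn⟩)
  exact h2.comp ((tendsto_nat_floor_atTop).comp h1)

/-- The field constant is a quadratic polynomial in J, so the geometric factor wins. -/
theorem tendsto_fieldConst_mul_pow {c₀ : ℝ} (hC : 0 < C) (hc : 0 < c) :
    Tendsto (fun J : ℕ => 4 * Cell.fieldConst d C c c₀ J * Cell.boundaryRate d C c ^ J) atTop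
      (𝓝 0) := by
  set r := Cell.boundaryRate d C c with hr
  have hr1 : |r| < 1 := by
    rw [abs_of_pos (Cell.boundaryRate_pos d C c)]
    exact Cell.boundaryRate_lt_one d hC hc
  set a := 2 * localBound d C c with ha
  set b := 2 * (Cell.factorBound d C * unitBallVolume d * 4 ^ (d + 1)) ^ 2 with hb
  have h := fun k : ℕ => tendsto_pow_const_mul_const_pow_of_abs_lt_one k hr1
  -- The coefficients of J², J and 1 in 4a(1 + 2J)² + 4b(8J + 15 + c₀)².
  have h3 := (((h 2).const_mul (16 * a + 256 * b)).add
    ((h 1).const_mul (16 * a + 64 * b * (15 + c₀)))).add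
    ((h 0).const_mul (4 * a + 4 * b * (15 + c₀) ^ 2))
  simp only [mul_zero, add_zero] at h3
  refine h3.congr fun J => ?_
  rw [Cell.fieldConst]
  push_cast
  rw [← ha, mul_pow _ _ 2, ← mul_assoc 2, ← hb]
  ring

end DSLattice

/-! ### The almost orthogonality estimate -/

theorem mainTheorem3 (d : ℕ) (hd : 1 ≤ d) (C c : ℝ) (hC : 0 < C) (hc : 0 < c)
    (φ₀ : Space d → ℝ) (hφ₀ : IsUnitMollifier φ₀) :
    ∃ σ : ℝ → ℝ → ℝ,
      (∀ ε α : ℝ, 0 < ε → 0 < α → 0 < σ ε α) ∧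
      (∃ s : ℝ → ℝ, (∀ ε : ℝ, 0 < ε → Tendsto (σ ε) (𝓝[>] 0) (𝓝 (s ε))) ∧
        Tendsto s (𝓝[>] 0) (𝓝 0)) ∧
      ∀ μ : Measure (Space d), IsGoodMeasure C μ → IsLowerRegularIn Set.univ c μ →
      ∀ (D : DSLattice μ) (H : Submodule ℝ (Space d)), Module.finrank ℝ H = d →
      ∀ (ε A α η β : ℝ), 0 < ε → ε < 1 / 48 → 5 < A → 0 < α → α < ε ^ 8 → 0 < η → 0 < β →
      ∀ (K N : ℕ) (P : D.Cell) (𝔓 𝔔 : ℕ → Finset D.Cell),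
        D.IsAlternatingLayers (D.nonBAUPFamily β H A α N) H A α K η P 𝔓 𝔔 →
        (∀ k ≤ K, ∀ Q ∈ 𝔔 k, Q.SummandExists φ₀ ε H) ∧
        ∀ k < K,
          Integrable (fun x => inner ℝ (D.layerF φ₀ ε H 𝔔 K k x)
            (D.layerG φ₀ ε H 𝔔 (k + 1) x)) μ ∧
          |∫ x, inner ℝ (D.layerF φ₀ ε H 𝔔 K k x) (D.layerG φ₀ ε H 𝔔 (k + 1) x) ∂μ|
            ≤ σ ε α * μ.real P.carrier := by
  obtain ⟨c₀, hc₀, hL⟩ := DSLattice.Cell.exists_cutoff_lipschitz hφ₀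
  set M : ℕ → ℝ := fun J => 4 * DSLattice.Cell.fieldConst d C c c₀ J
    * DSLattice.Cell.boundaryRate d C c ^ J with hM
  set B : ℝ → ℝ := fun ε => DSLattice.Cell.pairConst d C c₀ ε
    * (2 + DSLattice.Cell.fieldConst d C c c₀ (DSLattice.layerDepth ε)) with hB
  have hγ : 0 < ((2 * d + 3 : ℕ) : ℝ)⁻¹ := by positivity
  -- The first term is the boundary contribution, independent of α; the second is the interior one
  -- with s = α^(1/(2d+3)). The inner limit removes the second, the outer limit the first.
  refine ⟨fun ε α => M (DSLattice.layerDepth ε) + α ^ ((2 * d + 3 : ℕ) : ℝ)⁻¹ * B ε, ?_,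
    ⟨fun ε => M (DSLattice.layerDepth ε), ?_, ?_⟩, ?_⟩
  · intro ε α hε hα
    have h1 := DSLattice.Cell.fieldConst_pos (d := d) (c₀ := c₀) hC hc (DSLattice.layerDepth ε)
    have h2 := DSLattice.Cell.boundaryRate_pos d C c
    have h3 := DSLattice.Cell.pairConst_nonneg (d := d) hC.le hc₀ hε
    positivity
  · intro ε _
    have h1 : Tendsto (fun α : ℝ => α ^ ((2 * d + 3 : ℕ) : ℝ)⁻¹) (𝓝[>] 0) (𝓝 0) := by
      have h := (Real.continuousAt_rpow_const 0 _ (Or.inr hγ.le)).tendsto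
      rw [Real.zero_rpow hγ.ne'] at h
      exact h.mono_left nhdsWithin_le_nhds
    have h2 := (h1.mul_const (B ε)).const_add (M (DSLattice.layerDepth ε))
    simpa using h2
  · exact (DSLattice.tendsto_fieldConst_mul_pow hC hc).comp DSLattice.tendsto_layerDepth
  · intro μ hμ hl D H hH ε A α η β hε hε' hA hα hαε _ _ K N P 𝔓 𝔔 h
    refine ⟨fun k _ Q _ => Q.summandExists hφ₀ hε hε' hd hH hC.le hμ, fun k hk => ?_⟩
    have hα1 : α ≤ 1 := hαε.le.trans (pow_le_one₀ hε.le (by linarith))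
    exact h.integral_layer_le hφ₀ hε hε' hd hH hC hc hμ hl hc₀ (fun Q => hL μ D Q ε hε)
      (s := α ^ ((2 * d + 3 : ℕ) : ℝ)⁻¹) (Real.rpow_pos_of_pos hα _)
      (Real.rpow_le_one hα.le hα1 hγ.le) (Real.rpow_inv_natCast_pow hα.le (by omega)) hA
      (DSLattice.le_pow_layerDepth_mul hε) (DSLattice.pow_layerDepth_mul_le hε hε') hk
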